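/- **Setting.** Let $Z\subset\mathbb R^n$ be a lattice (a discrete additive subgroup) of dimension $d$, i.e. its real linear span $V$ has dimension $d$; let $\operatorname{vol}Z$ be the volume of $V/Z$, where $V$ carries its Euclidean Lebesgue measure. Let $R=(R_0,R_1,\dots)$ be a random walk on $Z$: $R_0=0$, the increments $R_i-R_{i-1}$ are independent and identically distributed with values in $Z$, and for every $z\in Z$ there is $k$ with $\mathbb P(R_k=z)>0$. Assume that $R$ is bounded (the increments are bounded) and balanced ($\mathbb E R_1=0$). Put $P_k(z)=\mathbb P(R_k=z)$. Fix an orthonormal basis $b_1,\dots,b_d$ of $V$, write points $z\in V$ in the coordinates $\langle b_i,z\rangle$, and let $M_{ij}=\mathbb E\,\langle R_1,b_i\rangle\langle R_1,b_j\rangle$ be the covariance matrix of a step. Let $$\mu_d(r)=\begin{cases}\log r & d=2,\\ r^{2-d} & d\neq 2.\end{cases}$$ **Theorem.** The matrix $M$ is positive definite, and for every $z\in Z$ the series $$a(z)=\sum_{k=0}^{\infty}\bigl(P_k(0)-P_k(z)\bigr)$$ (the harmonic potential of $R$) converges, as the limit of its partial sums. Let $A=M^{-1/2}$ be the positive definite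 square root of $M^{-1}$, and let $$\tau=\frac{\operatorname{vol}Z}{(2\pi)^{d/2}\,(\det M)^{1/2}}\cdot\begin{cases}2 & d=2,\\ -2^{d/2-1}\,\Gamma\!\left(\tfrac d2-1\right) & d\neq2.\end{cases}$$ There is a constant $\lambda\in\mathbb R$ such that for every integer $K>0$ there are a polynomial $Q=Q_K$ in $d$ variables with real coefficients and an integer $L=L_K\ge 0$ with $$a(z)=\tau\,\mu_d(\|Az\|)+\lambda+\frac{Q(z)}{\|Az\|^{L}}+O(\|z\|^{-K}),\qquad \frac{Q(z)}{\|Az\|^{L}}=O(\|z\|^{1-d})\qquad(z\in Z\setminus\{0\}).$$ If $d$ is even, then $L$ can be taken even, so that $\lambda=\lambda\|Az\|^L/\|Az\|^L$ may be absorbed into $Q$ and $a(z)=\tau\mu_d(\|Az\|)+Q(z)/\|Az\|^L+O(\|z\|^{-K})$. -/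

import Mathlib

open MeasureTheory ProbabilityTheory Filter Topology

noncomputable section

/-- `R` is a random walk on the lattice `Z`: it starts at `0`, its increments are independent and
identically distributed, and every point of `Z` is reached with positive probability. -/
structure IsRandomWalk {n : ℕ} {Ω : Type*} [MeasurableSpace Ω] (P : Measure Ω)
    (Z : Submodule ℤ (EuclideanSpace ℝ (Fin n))) (R : ℕ → Ω → Z) : Prop where
  measurable : ∀ k, Measurable (R k)
  start : ∀ᵐ ω ∂P, R 0 ω = 0
  indep : iIndepFun (fun (k : ℕ) (ω : Ω) => R (k + 1) ω - R k ω) P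
  identDistrib : ∀ k, IdentDistrib (fun ω => R (k + 1) ω - R k ω) (fun ω => R 1 ω - R 0 ω) P P
  reaches : ∀ z : Z, ∃ k, 0 < P {ω | R k ω = z}

/-- The steps of the walk are bounded. -/
def IsBoundedWalk {n : ℕ} {Ω : Type*} [MeasurableSpace Ω] (P : Measure Ω)
    {Z : Submodule ℤ (EuclideanSpace ℝ (Fin n))} (R : ℕ → Ω → Z) : Prop :=
  ∃ C : ℝ, ∀ k, ∀ᵐ ω ∂P, ‖R (k + 1) ω - R k ω‖ ≤ C

/-- The drift `𝔼 R₁` of the walk is zero (`R₁` is the first step, as `R₀ = 0`). -/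
def IsBalancedWalk {n : ℕ} {Ω : Type*} [MeasurableSpace Ω] (P : Measure Ω)
    {Z : Submodule ℤ (EuclideanSpace ℝ (Fin n))} (R : ℕ → Ω → Z) : Prop :=
  Integrable (fun ω => (R 1 ω : EuclideanSpace ℝ (Fin n))) P ∧
    ∫ ω, (R 1 ω : EuclideanSpace ℝ (Fin n)) ∂P = 0

/-- `P_k(z)`, the probability that the walk is at `z` at time `k`. -/
def walkProb {n : ℕ} {Ω : Type*} [MeasurableSpace Ω] (P : Measure Ω)
    {Z : Submodule ℤ (EuclideanSpace ℝ (Fin n))} (R : ℕ → Ω → Z) (k : ℕ) (z : Z) : ℝ :=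
  P.real {ω | R k ω = z}

/-- `a` is the harmonic potential: for every `z` the series `∑ₖ (P_k(0) - P_k(z))` converges to
`a z`. The series need not converge absolutely (periodic walks in dimension at most two), so
convergence is that of the partial sums in their natural order. -/
def IsHarmonicPotential {n : ℕ} {Ω : Type*} [MeasurableSpace Ω] (P : Measure Ω)
    {Z : Submodule ℤ (EuclideanSpace ℝ (Fin n))} (R : ℕ → Ω → Z) (a : Z → ℝ) : Prop :=
  ∀ z : Z, Tendsto
    (fun N : ℕ => ∑ k ∈ Finset.range N, (walkProb P R k 0 - walkProb P R k z)) atTop (𝓝 (a z))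

/-- The volume of the cell of the lattice `Z`, as a lattice in its linear span (with the Lebesgue
measure that the span carries as a Euclidean space). -/
def latticeVolume {n : ℕ} (Z : Submodule ℤ (EuclideanSpace ℝ (Fin n))) : ℝ :=
  ZLattice.covolume
    (ZLattice.comap ℝ Z (Submodule.span ℝ (Z : Set (EuclideanSpace ℝ (Fin n)))).subtype)

/-- The coordinates `⟨b i, v⟩` of a vector with respect to an orthonormal system `b`. -/
def coords {n d : ℕ} (b : Fin d → EuclideanSpace ℝ (Fin n)) (v : EuclideanSpace ℝ (Fin n)) :
    Fin d → ℝ :=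
  fun i => inner ℝ (b i) v

/-- The covariance matrix `M i j = 𝔼 ⟨R₁, b i⟩ ⟨R₁, b j⟩` of a step of the walk. -/
def covMatrix {n d : ℕ} {Ω : Type*} [MeasurableSpace Ω] (P : Measure Ω)
    {Z : Submodule ℤ (EuclideanSpace ℝ (Fin n))} (R : ℕ → Ω → Z)
    (b : Fin d → EuclideanSpace ℝ (Fin n)) : Matrix (Fin d) (Fin d) ℝ :=
  Matrix.of fun i j => ∫ ω, coords b (R 1 ω) i * coords b (R 1 ω) j ∂P

/-- The Euclidean norm `‖A x‖` of a matrix applied to a coordinate vector. -/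
def normMulVec {d : ℕ} (A : Matrix (Fin d) (Fin d) ℝ) (x : Fin d → ℝ) : ℝ :=
  ‖(WithLp.toLp 2 (A.mulVec x) : EuclideanSpace ℝ (Fin d))‖

/-- `μ_d(r)` is `log r` for `d = 2` and `r ^ (2 - d)` otherwise. -/
def radialProfile (d : ℕ) (r : ℝ) : ℝ :=
  if d = 2 then Real.log r else r ^ (2 - (d : ℤ))

/-- The constant `vol Z / ((2π)^{d/2} (det M)^{1/2})` times `2` if `d = 2`, and times
`-2^{d/2-1} Γ(d/2-1)` otherwise. -/
def leadingConst {n d : ℕ} (Z : Submodule ℤ (EuclideanSpace ℝ (Fin n)))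
    (M : Matrix (Fin d) (Fin d) ℝ) : ℝ :=
  latticeVolume Z / ((2 * Real.pi) ^ ((d : ℝ) / 2) * Real.sqrt M.det) *
    (if d = 2 then 2 else -((2 : ℝ) ^ ((d : ℝ) / 2 - 1) * Real.Gamma ((d : ℝ) / 2 - 1)))

end

/-!
The potential is analysed through its Fourier representation. In the coordinates `y = A ⟨b, z⟩` a
step of the walk has mean zero and the identity as covariance matrix. Let `ψ` be its
characteristic function and `F` a cell of `2π` times the dual lattice. Fourier inversion gives
`vol F * P_k(z) = ∫_F Re (ψ ^ k exp (-i ⟨y, η⟩)) dη` (`IsRandomWalk.walkFourier_eq`), and `1 - Re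
ψ ≥ c |η|²` on `F` because the steps generate the lattice (`IsRandomWalk.isFrequencyDomain`).
Summing the geometric series, the partial sums of the potential converge to the integral of `Re
((1 - exp (-i ⟨y, η⟩)) / (1 - ψ))` (`IsFrequencyDomain.tendsto_sum_walkFourier`). Taking real
parts is essential here: by the mean-zero condition they are bounded near the origin in every
dimension, while the full integrand is of order `1 / |η|`.

Writing `1 / (1 - ψ)` as a time integral turns the potential into `∫_0^∞ (p_t(0) - p_t(y)) dt`,
where `p_t` is the heat kernel of the walk in continuous time
(`IsFrequencyDomain.potential_eq_integral_heat`). For `t ≥ 1` the heat kernel has an Edgeworth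
expansion, uniformly in `y`, up to an error of any order in `1 / t`: a Gaussian plus finitely many
terms `y ^ β t ^ (-(d / 2 + 1 + k)) exp (-|y|² / 2t)` with `|β| ≤ 2 k + 1`
(`IsStandardStep.exists_local_expansion`). For `t ≤ ε |y|` the heat kernel at `y`, the Gaussian
and the correction terms are all smaller than any power of `|y|`, as the walk has bounded steps
(`exists_remainder_short_time`). So the error integrates to `O(|y| ^ (-K))`.

The remaining integrals are explicit. The difference of the Gaussians at `y` and at a reference
point integrates to `∫_1^{|y|² / 2} Γ(d / 2) σ ^ (-d / 2) dσ`, which is the leading term up to a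
constant (`integral_rpow_mul_exp_sub_exp`, `exists_integral_leading`); the part that does not
depend on `y` is the constant `λ`, whatever the order `K`. A correction term integrates to a
multiple of `y ^ β / |y| ^ (d + 2 k)` (`gaussTail_integral`): this is the rational term, its order
`1 - d`, and the parity of its denominator. The volume of `F` comes from the covolume of the
lattice (`exists_lattice_frame`, `volume_dualCell`) and turns the Gaussian normalization into the
constant `τ`.
-/

open Complex (I)

/-! ### Fourier transforms of polynomials times Gaussians -/

/-- `∫ x ^ a * exp (-t x² / 2 - i y x) dx`, the Fourier transform of a monomial times a Gaussian. -/
noncomputable def gaussMoment (t y : ℝ) (a : ℕ) : ℂ :=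
  ∫ x : ℝ, (x : ℂ) ^ a * Complex.exp (-(t / 2) * x ^ 2 - y * x * I)

lemma norm_cexp_gauss_phase (t y x : ℝ) :
    ‖Complex.exp (-(t / 2) * x ^ 2 - y * x * I)‖ = Real.exp (-(t / 2) * x ^ 2) := by
  rw [Complex.norm_exp]
  congr 1
  simp [← Complex.ofReal_pow]

lemma integrable_gaussMoment {t : ℝ} (ht : 0 < t) (y : ℝ) (a : ℕ) :
    Integrable fun x : ℝ => (x : ℂ) ^ a * Complex.exp (-(t / 2) * x ^ 2 - y * x * I) := by
  have h := (integrable_rpow_mul_exp_neg_mul_sq (b := t / 2) (by positivity) (s := a)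
    (by have : (0 : ℝ) ≤ a := Nat.cast_nonneg a
        linarith))
  refine h.norm.mono (by fun_prop) (ae_of_all _ fun x => ?_)
  rw [norm_mul, norm_cexp_gauss_phase, norm_norm, norm_mul, norm_pow]
  simp

lemma gaussMoment_zero {t : ℝ} (ht : 0 < t) (y : ℝ) :
    gaussMoment t y 0 = ((2 * Real.pi / t) ^ (1 / 2 : ℝ) * Real.exp (-(y ^ 2 / (2 * t))) : ℝ) := by
  have h := fourierIntegral_gaussian (b := (t / 2 : ℝ)) (by simpa using ht) (-y : ℂ)
  have ht' : (t : ℂ) ≠ 0 := by exact_mod_cast ht.ne'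
  unfold gaussMoment
  have e : ∀ x : ℝ, (x : ℂ) ^ 0 * Complex.exp (-(t / 2) * x ^ 2 - y * x * I)
      = Complex.exp (I * (-y) * x) * Complex.exp (-(t / 2 : ℝ) * x ^ 2) := by
    intro x
    rw [pow_zero, one_mul, ← Complex.exp_add]
    push_cast
    ring_nf
  simp_rw [e]
  rw [h, Complex.ofReal_mul, Complex.ofReal_exp, Complex.ofReal_cpow (by positivity)]
  push_cast
  congr 2
  · field_simp
  · field_simp
    ring

/-- Integration by parts: the recursion of the Hermite polynomials. -/
lemma gaussMoment_succ {t : ℝ} (ht : 0 < t) (y : ℝ) (a : ℕ) :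
    gaussMoment t y (a + 1)
      = (a : ℂ) * (1 / t : ℝ) * gaussMoment t y (a - 1)
        - I * (y * (1 / t) : ℝ) * gaussMoment t y a := by
  have ht' : (t : ℂ) ≠ 0 := by exact_mod_cast ht.ne'
  set e : ℝ → ℂ := fun x => Complex.exp (-(t / 2) * x ^ 2 - y * x * I) with he
  have hd : ∀ x : ℝ, HasDerivAt (fun x : ℝ => (x : ℂ) ^ a * e x)
      ((a : ℂ) * ((x : ℂ) ^ (a - 1) * e x) - t * ((x : ℂ) ^ (a + 1) * e x)
        - I * y * ((x : ℂ) ^ a * e x)) x := by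
    intro x
    have h1 : HasDerivAt (fun z : ℂ => z ^ a * Complex.exp (-(t / 2) * z ^ 2 - y * z * I))
        ((a : ℂ) * (x : ℂ) ^ (a - 1) * e x
          + (x : ℂ) ^ a * (e x * (-(t / 2) * (2 * (x : ℂ)) - y * I))) (x : ℂ) := by
      refine (hasDerivAt_pow a (x : ℂ)).mul (HasDerivAt.cexp ?_)
      refine HasDerivAt.sub ?_ ?_
      · simpa using (hasDerivAt_pow 2 (x : ℂ)).const_mul (-((t : ℂ) / 2))
      · simpa using ((hasDerivAt_id (x : ℂ)).const_mul (y : ℂ)).mul_const I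
    have h2 := h1.comp_ofReal
    convert h2 using 1
    ring
  have i0 := integrable_gaussMoment ht y a
  have i1 := integrable_gaussMoment ht y (a + 1)
  have i2 := integrable_gaussMoment ht y (a - 1)
  have h := integral_eq_zero_of_hasDerivAt_of_integrable hd
    (((i2.const_mul _).sub (i1.const_mul _)).sub (i0.const_mul _)) i0
  have i3 : Integrable fun x : ℝ =>
      (a : ℂ) * ((x : ℂ) ^ (a - 1) * e x) - t * ((x : ℂ) ^ (a + 1) * e x) :=
    (i2.const_mul _).sub (i1.const_mul _)
  rw [integral_sub i3 (i0.const_mul _), integral_sub (i2.const_mul _) (i1.const_mul _)] at h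
  simp only [integral_const_mul] at h
  change (a : ℂ) * gaussMoment t y (a - 1) - t * gaussMoment t y (a + 1)
    - I * y * gaussMoment t y a = 0 at h
  push_cast
  field_simp
  linear_combination -h

/-- Functions of `(y, u)` spanned by the `y ^ b * u ^ e` with `2 e = a + b`: the shape
of `u ^ (a / 2) He_a (u ^ (1 / 2) y)`. -/
def hermiteSpan (a : ℕ) : Submodule ℝ (ℝ × ℝ → ℝ) :=
  Submodule.span ℝ {f | ∃ b e : ℕ, 2 * e = a + b ∧ f = fun p => p.1 ^ b * p.2 ^ e}

lemma hermiteSpan_step {a : ℕ} {f g : ℝ × ℝ → ℝ} (hf : f ∈ hermiteSpan a)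
    (hg : g ∈ hermiteSpan (a + 1)) (c : ℝ) :
    (fun p => p.1 * p.2 * g p - c * (p.2 * f p)) ∈ hermiteSpan (a + 2) := by
  have h1 : (fun p : ℝ × ℝ => p.1 * p.2) * g ∈ hermiteSpan (a + 2) := by
    refine Submodule.span_induction (p := fun g _ => (fun p : ℝ × ℝ => p.1 * p.2) * g
      ∈ hermiteSpan (a + 2)) ?_ (by simp) (fun x y _ _ hx hy => by
          rw [mul_add]; exact add_mem hx hy)
      (fun c x _ hx => by rw [mul_smul_comm]; exact Submodule.smul_mem _ _ hx) hg
    rintro _ ⟨b, e, h, rfl⟩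
    refine Submodule.subset_span ⟨b + 1, e + 1, by omega, ?_⟩
    ext p
    simp only [Pi.mul_apply]
    ring
  have h2 : (fun p : ℝ × ℝ => p.2) * f ∈ hermiteSpan (a + 2) := by
    refine Submodule.span_induction (p := fun g _ => (fun p : ℝ × ℝ => p.2) * g
      ∈ hermiteSpan (a + 2)) ?_ (by simp) (fun x y _ _ hx hy => by
          rw [mul_add]; exact add_mem hx hy)
      (fun c x _ hx => by rw [mul_smul_comm]; exact Submodule.smul_mem _ _ hx) hf
    rintro _ ⟨b, e, h, rfl⟩
    refine Submodule.subset_span ⟨b, e + 1, by omega, ?_⟩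
    ext p
    simp only [Pi.mul_apply]
    ring
  exact sub_mem h1 (Submodule.smul_mem _ c h2)

/-- The Fourier transform of `x ^ a exp (-t x² / 2)` is a Gaussian times a Hermite polynomial. The
induction carries two consecutive degrees because the recursion has depth two. -/
lemma exists_gaussMoment_eq (a : ℕ) : ∃ g ∈ hermiteSpan a, ∀ t : ℝ, 0 < t → ∀ y : ℝ,
    gaussMoment t y a = (-I) ^ a *
      ((2 * Real.pi / t) ^ (1 / 2 : ℝ) * Real.exp (-(y ^ 2 / (2 * t))) * g (y, 1 / t) : ℝ) := by
  suffices H : ∀ a : ℕ, (∃ g ∈ hermiteSpan a, ∀ t : ℝ, 0 < t → ∀ y : ℝ,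
      gaussMoment t y a = (-I) ^ a *
        ((2 * Real.pi / t) ^ (1 / 2 : ℝ) * Real.exp (-(y ^ 2 / (2 * t))) * g (y, 1 / t) : ℝ)) ∧
      (∃ g ∈ hermiteSpan (a + 1), ∀ t : ℝ, 0 < t → ∀ y : ℝ,
      gaussMoment t y (a + 1) = (-I) ^ (a + 1) *
        ((2 * Real.pi / t) ^ (1 / 2 : ℝ) * Real.exp (-(y ^ 2 / (2 * t))) * g (y, 1 / t) : ℝ)) from
    (H a).1
  intro a
  induction a with
  | zero =>
    refine ⟨⟨fun _ => 1, Submodule.subset_span ⟨0, 0, by simp, by ext; simp⟩, ?_⟩,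
      ⟨fun p => p.1 * p.2, Submodule.subset_span ⟨1, 1, by simp, by ext; simp⟩, ?_⟩⟩
    · intro t ht y
      rw [gaussMoment_zero ht]
      simp
    · intro t ht y
      rw [gaussMoment_succ ht, gaussMoment_zero ht]
      push_cast
      ring
  | succ a ih =>
    obtain ⟨⟨f, hf, hf'⟩, ⟨g, hg, hg'⟩⟩ := ih
    refine ⟨⟨g, hg, hg'⟩, _, hermiteSpan_step hf hg (a + 1 : ℕ), ?_⟩
    intro t ht y
    rw [gaussMoment_succ ht, hg' t ht y, Nat.add_sub_cancel, hf' t ht y]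
    push_cast
    have h1 : (-I) ^ (a + 1 + 1) = - (-I) ^ a := by
      rw [pow_succ, pow_succ]; linear_combination (-I) ^ a * Complex.I_sq
    have h2 : I * (-I) ^ (a + 1) = (-I) ^ a := by
      rw [pow_succ]; linear_combination -(-I) ^ a * Complex.I_sq
    rw [h1]
    linear_combination (-(y * (1 / t) * (((2 * Real.pi / t) ^ (1 / 2 : ℝ) : ℝ) *
      Complex.exp (-(y ^ 2 / (2 * t))) * g (y, 1 / t)))) * h2

/-- The monomial `∏ x_l ^ α_l`. -/
def monoFn {d : ℕ} (α : Fin d → ℕ) (x : EuclideanSpace ℝ (Fin d)) : ℝ := ∏ l, x l ^ α l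

/-- Functions of `(y, u)` spanned by the `y ^ β * u ^ e` with `2 e = a + |β|`. -/
def hermiteSpanMulti (d a : ℕ) : Submodule ℝ (EuclideanSpace ℝ (Fin d) × ℝ → ℝ) :=
  Submodule.span ℝ {f | ∃ (β : Fin d → ℕ) (e : ℕ), 2 * e = a + ∑ l, β l ∧
    f = fun p => monoFn β p.1 * p.2 ^ e}

lemma hermiteSpan_toMulti {d a : ℕ} (l : Fin d) {g : ℝ × ℝ → ℝ} (hg : g ∈ hermiteSpan a) :
    (fun p : EuclideanSpace ℝ (Fin d) × ℝ => g (p.1 l, p.2)) ∈ hermiteSpanMulti d a := by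
  refine Submodule.span_induction (p := fun g _ =>
    (fun p : EuclideanSpace ℝ (Fin d) × ℝ => g (p.1 l, p.2)) ∈ hermiteSpanMulti d a) ?_
    (zero_mem _) (fun x y _ _ hx hy => add_mem hx hy)
    (fun c x _ hx => Submodule.smul_mem _ c hx) hg
  rintro _ ⟨b, e, h, rfl⟩
  refine Submodule.subset_span ⟨Pi.single l b, e, by simp [h], ?_⟩
  ext p
  simp only [monoFn]
  rw [Finset.prod_eq_single l] <;> simp +contextual

lemma hermiteSpanMulti_mul {d a a' : ℕ} {f g : EuclideanSpace ℝ (Fin d) × ℝ → ℝ}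
    (hf : f ∈ hermiteSpanMulti d a) (hg : g ∈ hermiteSpanMulti d a') :
    f * g ∈ hermiteSpanMulti d (a + a') := by
  have h := Submodule.mul_mem_mul hf hg
  rw [hermiteSpanMulti, hermiteSpanMulti, Submodule.span_mul_span] at h
  refine Submodule.span_mono ?_ h
  rintro _ ⟨_, ⟨β, e, h, rfl⟩, _, ⟨β', e', h', rfl⟩, rfl⟩
  refine ⟨β + β', e + e', by simp only [Pi.add_apply, Finset.sum_add_distrib]; omega, ?_⟩
  ext p
  simp only [monoFn, Pi.mul_apply, Pi.add_apply, pow_add, Finset.prod_mul_distrib]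
  ring

lemma hermiteSpanMulti_prod {d : ℕ} (α : Fin d → ℕ) (g : Fin d → ℝ × ℝ → ℝ)
    (hg : ∀ l, g l ∈ hermiteSpan (α l)) :
    (fun p : EuclideanSpace ℝ (Fin d) × ℝ => ∏ l, g l (p.1 l, p.2))
      ∈ hermiteSpanMulti d (∑ l, α l) := by
  suffices H : ∀ s : Finset (Fin d),
      (fun p : EuclideanSpace ℝ (Fin d) × ℝ => ∏ l ∈ s, g l (p.1 l, p.2))
        ∈ hermiteSpanMulti d (∑ l ∈ s, α l) from H _
  intro s
  classical
  induction s using Finset.induction_on with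
  | empty => exact Submodule.subset_span ⟨0, 0, by simp, by ext; simp [monoFn]⟩
  | insert l s hl ih =>
    simp only [Finset.prod_insert hl, Finset.sum_insert hl]
    exact hermiteSpanMulti_mul (hermiteSpan_toMulti l (hg l)) ih

lemma integral_monoFn_gauss_eq_prod {d : ℕ} (α : Fin d → ℕ) (t : ℝ)
    (y : EuclideanSpace ℝ (Fin d)) :
    ∫ x : EuclideanSpace ℝ (Fin d), (monoFn α x : ℂ) *
      Complex.exp (-(t / 2) * ‖x‖ ^ 2 - (inner ℝ y x : ℝ) * I)
      = ∏ l, gaussMoment t (y l) (α l) := by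
  rw [← (PiLp.volume_preserving_toLp (Fin d)).integral_comp
    (MeasurableEquiv.toLp 2 _).measurableEmbedding]
  unfold gaussMoment
  rw [← integral_fintype_prod_volume_eq_prod (fun (l : Fin d) (x : ℝ) =>
    (x : ℂ) ^ α l * Complex.exp (-(t / 2) * x ^ 2 - y l * x * I))]
  congr 1
  ext x
  rw [Finset.prod_mul_distrib, ← Complex.exp_sum]
  congr 1
  · simp [monoFn]
  · congr 1
    rw [Finset.sum_sub_distrib, ← Finset.mul_sum, ← Finset.sum_mul, ← Complex.ofReal_pow,
      EuclideanSpace.norm_sq_eq]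
    simp [PiLp.inner_apply, mul_comm]

lemma integrable_monoFn_gauss {d : ℕ} (α : Fin d → ℕ) {t : ℝ} (ht : 0 < t)
    (y : EuclideanSpace ℝ (Fin d)) :
    Integrable fun x : EuclideanSpace ℝ (Fin d) => (monoFn α x : ℂ) *
      Complex.exp (-(t / 2) * ‖x‖ ^ 2 - (inner ℝ y x : ℝ) * I) := by
  rw [← (PiLp.volume_preserving_toLp (Fin d)).integrable_comp_emb
    (MeasurableEquiv.toLp 2 _).measurableEmbedding]
  have := Integrable.fintype_prod (f := fun (l : Fin d) (x : ℝ) =>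
    (x : ℂ) ^ α l * Complex.exp (-(t / 2) * x ^ 2 - y l * x * I))
    (μ := fun _ => volume) (fun l => integrable_gaussMoment ht (y l) (α l))
  refine this.congr (ae_of_all _ fun x => ?_)
  simp only [Function.comp_apply]
  rw [Finset.prod_mul_distrib, ← Complex.exp_sum]
  congr 1
  · simp [monoFn]
  · congr 1
    rw [Finset.sum_sub_distrib, ← Finset.mul_sum, ← Finset.sum_mul, ← Complex.ofReal_pow,
      EuclideanSpace.norm_sq_eq]
    simp [PiLp.inner_apply, mul_comm]

lemma prod_gauss_factor {d : ℕ} {t : ℝ} (ht : 0 < t) (y : EuclideanSpace ℝ (Fin d)) :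
    ∏ l, ((2 * Real.pi / t) ^ (1 / 2 : ℝ) * Real.exp (-(y l ^ 2 / (2 * t))))
      = (2 * Real.pi) ^ ((d : ℝ) / 2) * (t ^ (-((d : ℝ) / 2)) * Real.exp (-(‖y‖ ^ 2 / 2 / t))) := by
  rw [Finset.prod_mul_distrib, ← Real.exp_sum, Finset.prod_const, Finset.card_univ,
    Fintype.card_fin, ← Real.rpow_natCast, ← Real.rpow_mul (by positivity),
    Real.div_rpow (by positivity) ht.le, Real.rpow_neg ht.le, EuclideanSpace.norm_sq_eq,
    Finset.sum_neg_distrib, ← Finset.sum_div]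
  simp only [Real.norm_eq_abs, sq_abs]
  rw [div_div, one_div_mul_eq_div]
  field_simp

/-- Functions of `(t, y)` spanned by the `y ^ β * t ^ (-(d / 2 + 1 + k)) * exp (-|y|² / 2t)` with
`|β| ≤ 2 k + 1`: the correction terms to the heat kernel. -/
def gaussTail (d : ℕ) : Submodule ℝ (ℝ → EuclideanSpace ℝ (Fin d) → ℝ) :=
  Submodule.span ℝ {f | ∃ (β : Fin d → ℕ) (k : ℕ), ∑ l, β l ≤ 2 * k + 1 ∧
    f = fun t y => monoFn β y * (t ^ (-((d : ℝ) / 2 + 1 + k)) * Real.exp (-(‖y‖ ^ 2 / 2 / t)))}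

/-- With `t ^ m` in front, a Hermite polynomial of degree `a > 2 m` contributes only terms at least
one factor `1 / t` below the heat kernel. This is what makes the corrections to the potential
decay. -/
lemma hermiteSpanMulti_gaussTail {d a m : ℕ} (h : 2 * m + 1 ≤ a)
    {f : EuclideanSpace ℝ (Fin d) × ℝ → ℝ} (hf : f ∈ hermiteSpanMulti d a) :
    ∃ H ∈ gaussTail d, ∀ t : ℝ, 0 < t → ∀ y, H t y
      = t ^ m * (t ^ (-((d : ℝ) / 2)) * Real.exp (-(‖y‖ ^ 2 / 2 / t)) * f (y, 1 / t)) := by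
  refine Submodule.span_induction (p := fun f _ => ∃ H ∈ gaussTail d, ∀ t : ℝ, 0 < t → ∀ y, H t y
      = t ^ m * (t ^ (-((d : ℝ) / 2)) * Real.exp (-(‖y‖ ^ 2 / 2 / t)) * f (y, 1 / t)))
    ?_ ?_ ?_ ?_ hf
  · rintro _ ⟨β, e, he, rfl⟩
    refine ⟨_, Submodule.subset_span ⟨β, e - m - 1, by omega, rfl⟩, ?_⟩
    intro t ht y
    have hk : ((e - m - 1 : ℕ) : ℝ) = (e : ℝ) - m - 1 := by
      rw [Nat.cast_sub (by omega), Nat.cast_sub (by omega)]; simp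
    have : t ^ (-((d : ℝ) / 2 + 1 + (e - m - 1 : ℕ))) = t ^ m * t ^ (-((d : ℝ) / 2)) *
        (1 / t) ^ e := by
      rw [hk, one_div, inv_pow, ← Real.rpow_natCast t m, ← Real.rpow_natCast t e,
        ← Real.rpow_neg ht.le, ← Real.rpow_add ht, ← Real.rpow_add ht]
      congr 1
      ring
    simp only [this]
    ring
  · exact ⟨0, zero_mem _, fun t _ y => by simp⟩
  · rintro f g _ _ ⟨F, hF, hF'⟩ ⟨G, hG, hG'⟩
    refine ⟨F + G, add_mem hF hG, fun t ht y => ?_⟩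
    simp only [Pi.add_apply, hF' t ht y, hG' t ht y]
    ring
  · rintro c f _ ⟨F, hF, hF'⟩
    refine ⟨c • F, Submodule.smul_mem _ c hF, fun t ht y => ?_⟩
    simp only [Pi.smul_apply, hF' t ht y, smul_eq_mul]
    ring

lemma exists_gaussTail_monoFn {d : ℕ} (α : Fin d → ℕ) {m : ℕ} (h : 2 * m + 1 ≤ ∑ l, α l) (c : ℂ) :
    ∃ H ∈ gaussTail d, ∀ t : ℝ, 0 < t → ∀ y,
      (∫ x : EuclideanSpace ℝ (Fin d), (t : ℂ) ^ m * (c * monoFn α x) *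
        Complex.exp (-(t / 2) * ‖x‖ ^ 2 - (inner ℝ y x : ℝ) * I)).re = H t y := by
  choose g hg hg' using fun l => exists_gaussMoment_eq (α l)
  obtain ⟨H, hH, hH'⟩ := hermiteSpanMulti_gaussTail h (hermiteSpanMulti_prod α g hg)
  refine ⟨((c * (-I) ^ (∑ l, α l)).re * (2 * Real.pi) ^ ((d : ℝ) / 2)) • H,
    Submodule.smul_mem _ _ hH, fun t ht y => ?_⟩
  have : ∀ x : EuclideanSpace ℝ (Fin d), (t : ℂ) ^ m * (c * monoFn α x) *
        Complex.exp (-(t / 2) * ‖x‖ ^ 2 - (inner ℝ y x : ℝ) * I) = ((t : ℂ) ^ m * c) *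
        ((monoFn α x : ℂ) * Complex.exp (-(t / 2) * ‖x‖ ^ 2 - (inner ℝ y x : ℝ) * I)) :=
    fun x => by ring
  simp_rw [this]
  rw [integral_const_mul, integral_monoFn_gauss_eq_prod]
  have h2 : ∏ l, gaussMoment t (y l) (α l) = (-I) ^ (∑ l, α l) *
      (((2 * Real.pi) ^ ((d : ℝ) / 2) * (t ^ (-((d : ℝ) / 2)) * Real.exp (-(‖y‖ ^ 2 / 2 / t))) *
        ∏ l, g l (y l, 1 / t) : ℝ) : ℂ) := by
    rw [← prod_gauss_factor ht, ← Finset.prod_mul_distrib, ← Finset.prod_pow_eq_pow_sum,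
      Complex.ofReal_prod, ← Finset.prod_mul_distrib]
    exact Finset.prod_congr rfl fun l _ => hg' l t ht (y l)
  rw [h2]
  have h3 : ∀ r : ℝ, ((t : ℂ) ^ m * c * ((-I) ^ (∑ l, α l) * (r : ℂ))).re
      = t ^ m * ((c * (-I) ^ (∑ l, α l)).re * r) := by
    intro r
    rw [← Complex.re_mul_ofReal, ← Complex.re_ofReal_mul]
    congr 1
    push_cast
    ring
  rw [h3]
  simp only [Pi.smul_apply, smul_eq_mul, hH' t ht y]
  ring

lemma integral_gauss_leading {d : ℕ} {t : ℝ} (ht : 0 < t) (y : EuclideanSpace ℝ (Fin d)) :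
    (∫ x : EuclideanSpace ℝ (Fin d),
      Complex.exp (-(t / 2) * ‖x‖ ^ 2 - (inner ℝ y x : ℝ) * I)).re
      = (2 * Real.pi) ^ ((d : ℝ) / 2) * (t ^ (-((d : ℝ) / 2)) * Real.exp (-(‖y‖ ^ 2 / 2 / t))) := by
  have h := integral_monoFn_gauss_eq_prod (0 : Fin d → ℕ) t y
  simp only [monoFn, Pi.zero_apply, pow_zero, Finset.prod_const_one, Complex.ofReal_one, one_mul,
    gaussMoment_zero ht, ← Complex.ofReal_prod] at h
  rw [h, prod_gauss_factor ht, Complex.ofReal_re]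

/-- Complex combinations of monomials of degree at least `k`, as functions. -/
def polyGE (d k : ℕ) : Submodule ℂ (EuclideanSpace ℝ (Fin d) → ℂ) :=
  Submodule.span ℂ {f | ∃ α : Fin d → ℕ, k ≤ ∑ l, α l ∧ f = fun x => (monoFn α x : ℂ)}

lemma polyGE_anti {d k l : ℕ} (h : k ≤ l) : polyGE d l ≤ polyGE d k :=
  Submodule.span_mono fun _ ⟨α, hα, hf⟩ => ⟨α, h.trans hα, hf⟩

lemma polyGE_mul {d k l : ℕ} {f g : EuclideanSpace ℝ (Fin d) → ℂ} (hf : f ∈ polyGE d k)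
    (hg : g ∈ polyGE d l) : f * g ∈ polyGE d (k + l) := by
  have h := Submodule.mul_mem_mul hf hg
  rw [polyGE, polyGE, Submodule.span_mul_span] at h
  refine Submodule.span_mono ?_ h
  rintro _ ⟨_, ⟨α, h, rfl⟩, _, ⟨β, h', rfl⟩, rfl⟩
  refine ⟨α + β, by simp only [Pi.add_apply, Finset.sum_add_distrib]; omega, ?_⟩
  ext p
  simp only [monoFn, Pi.mul_apply, Pi.add_apply, pow_add, Finset.prod_mul_distrib]
  push_cast
  ring

lemma polyGE_pow {d k : ℕ} {f : EuclideanSpace ℝ (Fin d) → ℂ} (hf : f ∈ polyGE d k) (m : ℕ) :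
    f ^ m ∈ polyGE d (k * m) := by
  induction m with
  | zero => exact Submodule.subset_span ⟨0, by simp, by ext; simp [monoFn]⟩
  | succ m ih => rw [pow_succ, Nat.mul_succ]; exact polyGE_mul ih hf

lemma inner_mem_polyGE {d : ℕ} (v : EuclideanSpace ℝ (Fin d)) :
    (fun x => ((inner ℝ v x : ℝ) : ℂ)) ∈ polyGE d 1 := by
  have : (fun x => ((inner ℝ v x : ℝ) : ℂ)) =
      ∑ l, (v l : ℂ) • fun x : EuclideanSpace ℝ (Fin d) => (monoFn (Pi.single l 1) x : ℂ) := by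
    ext x
    simp only [Finset.sum_apply, Pi.smul_apply, PiLp.inner_apply]
    push_cast
    refine Finset.sum_congr rfl fun l _ => ?_
    rw [monoFn, Finset.prod_eq_single l] <;> simp +contextual [mul_comm]
  rw [this]
  exact sum_mem fun l _ => Submodule.smul_mem _ _ (Submodule.subset_span ⟨_, by simp, rfl⟩)

lemma integrable_polyGE_gauss {d k : ℕ} {f : EuclideanSpace ℝ (Fin d) → ℂ} (hf : f ∈ polyGE d k)
    {t : ℝ} (ht : 0 < t) (y : EuclideanSpace ℝ (Fin d)) :
    Integrable fun x => f x * Complex.exp (-(t / 2) * ‖x‖ ^ 2 - (inner ℝ y x : ℝ) * I) := by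
  refine Submodule.span_induction (p := fun f _ => Integrable fun x => f x *
    Complex.exp (-(t / 2) * ‖x‖ ^ 2 - (inner ℝ y x : ℝ) * I)) ?_ (by simp) ?_ ?_ hf
  · rintro _ ⟨α, -, rfl⟩
    exact integrable_monoFn_gauss α ht y
  · intro f g _ _ hf hg
    refine (hf.add hg).congr (ae_of_all _ fun x => ?_)
    simp only [Pi.add_apply, add_mul]
  · intro c f _ hf
    simpa only [Pi.smul_apply, smul_eq_mul, mul_assoc] using hf.const_mul c

lemma exists_gaussTail_polyGE {d m : ℕ} {f : EuclideanSpace ℝ (Fin d) → ℂ}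
    (hf : f ∈ polyGE d (2 * m + 1)) (c : ℂ) : ∃ H ∈ gaussTail d, ∀ t : ℝ, 0 < t → ∀ y,
      (∫ x : EuclideanSpace ℝ (Fin d), (t : ℂ) ^ m * (c * f x) *
        Complex.exp (-(t / 2) * ‖x‖ ^ 2 - (inner ℝ y x : ℝ) * I)).re = H t y := by
  refine Submodule.span_induction (p := fun f _ => ∀ c : ℂ, ∃ H ∈ gaussTail d,
    ∀ t : ℝ, 0 < t → ∀ y, (∫ x : EuclideanSpace ℝ (Fin d), (t : ℂ) ^ m * (c * f x) *
        Complex.exp (-(t / 2) * ‖x‖ ^ 2 - (inner ℝ y x : ℝ) * I)).re = H t y) ?_ ?_ ?_ ?_ hf c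
  · rintro _ ⟨α, h, rfl⟩ c
    exact exists_gaussTail_monoFn α h c
  · exact fun c => ⟨0, zero_mem _, fun t _ y => by simp⟩
  · rintro f g hf hg hF hG c
    obtain ⟨F, hF, hF'⟩ := hF c
    obtain ⟨G, hG, hG'⟩ := hG c
    refine ⟨F + G, add_mem hF hG, fun t ht y => ?_⟩
    rw [Pi.add_apply, Pi.add_apply, ← hF' t ht y, ← hG' t ht y, ← Complex.add_re,
      ← integral_add]
    · congr 2
      ext x
      simp only [Pi.add_apply]
      ring
    · simpa only [mul_assoc] using
        ((integrable_polyGE_gauss hf ht y).const_mul c).const_mul ((t : ℂ) ^ m)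
    · simpa only [mul_assoc] using
        ((integrable_polyGE_gauss hg ht y).const_mul c).const_mul ((t : ℂ) ^ m)
  · rintro b f _ hF c
    obtain ⟨F, hF, hF'⟩ := hF (c * b)
    refine ⟨F, hF, fun t ht y => ?_⟩
    rw [← hF' t ht y]
    simp only [Pi.smul_apply, smul_eq_mul, mul_assoc]

/-! ### The characteristic function of a standardized step -/

/-- The characteristic function `η ↦ ∑ w_i exp (i ⟨v_i, η⟩)` of a step with finitely many values. -/
noncomputable def stepChar {d : ℕ} {ι : Type*} [Fintype ι] (w : ι → ℝ)
    (v : ι → EuclideanSpace ℝ (Fin d)) (η : EuclideanSpace ℝ (Fin d)) : ℂ :=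
  ∑ i, (w i : ℂ) * Complex.exp ((inner ℝ (v i) η : ℝ) * I)

/-- A step taking the value `v i` with probability `w i`, with mean zero and with the identity as
covariance matrix. -/
structure IsStandardStep {d : ℕ} {ι : Type*} [Fintype ι] (w : ι → ℝ)
    (v : ι → EuclideanSpace ℝ (Fin d)) : Prop where
  nonneg : ∀ i, 0 ≤ w i
  sum_eq_one : ∑ i, w i = 1
  mean : ∀ η, ∑ i, w i * inner ℝ (v i) η = 0
  cov : ∀ η, ∑ i, w i * (inner ℝ (v i) η) ^ 2 = ‖η‖ ^ 2

/-- A compact neighbourhood `F` of the origin on which `1 - Re ψ` is bounded below by a multiple of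
the square of the norm. -/
structure IsFrequencyDomain {d : ℕ} {ι : Type*} [Fintype ι] (w : ι → ℝ)
    (v : ι → EuclideanSpace ℝ (Fin d)) (F : Set (EuclideanSpace ℝ (Fin d))) : Prop where
  compact : IsCompact F
  mem_nhds : F ∈ 𝓝 0
  lower : ∃ c > 0, ∀ η ∈ F, c * ‖η‖ ^ 2 ≤ 1 - (stepChar w v η).re

/-- `∫_F Re exp (-t (1 - ψ(η)) - i ⟨y, η⟩) dη`; up to a constant factor the transition probability
of the continuous time walk. -/
noncomputable def heatKernel {d : ℕ} {ι : Type*} [Fintype ι] (w : ι → ℝ)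
    (v : ι → EuclideanSpace ℝ (Fin d)) (F : Set (EuclideanSpace ℝ (Fin d))) (t : ℝ)
    (y : EuclideanSpace ℝ (Fin d)) : ℝ :=
  ∫ η in F, (Complex.exp (-(t * (1 - stepChar w v η)) - (inner ℝ y η : ℝ) * I)).re

/-- The part of degrees `3, …, J - 1` of the Taylor expansion of the characteristic function. -/
noncomputable def stepTaylor {d : ℕ} {ι : Type*} [Fintype ι] (w : ι → ℝ)
    (v : ι → EuclideanSpace ℝ (Fin d)) (J : ℕ) (η : EuclideanSpace ℝ (Fin d)) : ℂ :=
  ∑ j ∈ Finset.Ico 3 J, ∑ i, (w i : ℂ) * (((inner ℝ (v i) η : ℝ) * I) ^ j / (j.factorial : ℂ))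

section
variable {d : ℕ} {ι : Type*} [Fintype ι] {w : ι → ℝ} {v : ι → EuclideanSpace ℝ (Fin d)}

lemma continuous_stepChar : Continuous (stepChar w v) := by
  unfold stepChar
  fun_prop

lemma stepTaylor_mem_polyGE (J : ℕ) : stepTaylor w v J ∈ polyGE d 3 := by
  have : stepTaylor w v J = ∑ j ∈ Finset.Ico 3 J, ∑ i, ((w i : ℂ) * I ^ j / (j.factorial : ℂ)) •
      (fun x : EuclideanSpace ℝ (Fin d) => ((inner ℝ (v i) x : ℝ) : ℂ)) ^ j := by
    ext η
    simp only [stepTaylor, Finset.sum_apply, Pi.smul_apply, Pi.pow_apply, smul_eq_mul]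
    refine Finset.sum_congr rfl fun j _ => Finset.sum_congr rfl fun i _ => ?_
    rw [mul_pow]
    ring
  rw [this]
  refine sum_mem fun j hj => sum_mem fun i _ => Submodule.smul_mem _ _ ?_
  refine polyGE_anti ?_ (polyGE_pow (inner_mem_polyGE (v i)) j)
  rw [one_mul]
  exact (Finset.mem_Ico.mp hj).1

lemma exists_step_bound (v : ι → EuclideanSpace ℝ (Fin d)) :
    ∃ B : ℝ, 0 ≤ B ∧ ∀ i η, |inner ℝ (v i) η| ≤ B * ‖η‖ := by
  refine ⟨∑ i, ‖v i‖, Finset.sum_nonneg fun _ _ => norm_nonneg _, fun i η => ?_⟩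
  refine (abs_real_inner_le_norm _ _).trans ?_
  gcongr
  exact Finset.single_le_sum (f := fun i => ‖v i‖) (fun _ _ => norm_nonneg _) (Finset.mem_univ i)

namespace IsStandardStep

lemma norm_stepChar_le_one (h : IsStandardStep w v) (η : EuclideanSpace ℝ (Fin d)) :
    ‖stepChar w v η‖ ≤ 1 := by
  rw [← h.sum_eq_one]
  refine norm_sum_le_of_le _ fun i _ => ?_
  rw [norm_mul, Complex.norm_exp_ofReal_mul_I, mul_one, Complex.norm_real, Real.norm_eq_abs,
    abs_of_nonneg (h.nonneg i)]

lemma exists_norm_stepTaylor_le (h : IsStandardStep w v) (J : ℕ) :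
    ∃ C : ℝ, 0 ≤ C ∧ ∀ η, ‖stepTaylor w v J η‖ ≤ C * (‖η‖ ^ 3 + ‖η‖ ^ J) := by
  obtain ⟨B, hB, hB'⟩ := exists_step_bound v
  refine ⟨∑ j ∈ Finset.Ico 3 J, B ^ j, Finset.sum_nonneg fun _ _ => by positivity, fun η => ?_⟩
  rw [Finset.sum_mul]
  refine norm_sum_le_of_le _ fun j hj => ?_
  obtain ⟨h3, hJ⟩ := Finset.mem_Ico.mp hj
  have hpow : ‖η‖ ^ j ≤ ‖η‖ ^ 3 + ‖η‖ ^ J := by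
    rcases le_total ‖η‖ 1 with h1 | h1
    · exact (pow_le_pow_of_le_one (norm_nonneg _) h1 h3).trans
        (le_add_of_nonneg_right (by positivity))
    · exact (pow_le_pow_right₀ h1 hJ.le).trans (le_add_of_nonneg_left (by positivity))
  calc ‖∑ i, (w i : ℂ) * (((inner ℝ (v i) η : ℝ) * I) ^ j / (j.factorial : ℂ))‖
      ≤ ∑ i, w i * (B * ‖η‖) ^ j := by
        refine norm_sum_le_of_le _ fun i _ => ?_
        rw [norm_mul, Complex.norm_real, Real.norm_eq_abs, abs_of_nonneg (h.nonneg i), norm_div,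
          norm_pow, norm_mul, Complex.norm_I, mul_one, Complex.norm_real, Complex.norm_natCast,
          Real.norm_eq_abs]
        refine mul_le_mul_of_nonneg_left ?_ (h.nonneg i)
        refine (div_le_self (by positivity) (by exact_mod_cast j.factorial_pos)).trans ?_
        gcongr
        exact hB' i η
    _ = B ^ j * ‖η‖ ^ j := by rw [← Finset.sum_mul, h.sum_eq_one, one_mul, mul_pow]
    _ ≤ _ := by gcongr

/-- Taylor's formula: the terms of degrees `1` and `2` are determined by the mean and the
covariance. -/
lemma exists_norm_stepChar_sub_le (h : IsStandardStep w v) {J : ℕ} (hJ : 3 ≤ J) (r : ℝ) :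
    ∃ C : ℝ, 0 ≤ C ∧ ∀ η, ‖η‖ ≤ r →
      ‖(stepChar w v η - 1 + ‖η‖ ^ 2 / 2) - stepTaylor w v J η‖ ≤ C * ‖η‖ ^ J := by
  obtain ⟨B, hB, hB'⟩ := exists_step_bound v
  refine ⟨B ^ J * Real.exp (B * r), by positivity, fun η hη => ?_⟩
  have key : (stepChar w v η - 1 + ‖η‖ ^ 2 / 2) - stepTaylor w v J η =
      ∑ i, (w i : ℂ) * (Complex.exp ((inner ℝ (v i) η : ℝ) * I) -
        ∑ j ∈ Finset.range J, ((inner ℝ (v i) η : ℝ) * I) ^ j / (j.factorial : ℂ)) := by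
    simp only [mul_sub, Finset.sum_sub_distrib, Finset.mul_sum]
    rw [Finset.sum_comm (s := Finset.univ), ← Finset.sum_range_add_sum_Ico _ hJ, stepTaylor]
    have e0 : ∑ i, (w i : ℂ) = 1 := by exact_mod_cast h.sum_eq_one
    have e1 : ∑ i, (w i : ℂ) * (inner ℝ (v i) η : ℝ) = 0 := by exact_mod_cast h.mean η
    have e2 : ∑ i, (w i : ℂ) * ((inner ℝ (v i) η : ℝ) : ℂ) ^ 2 = (‖η‖ : ℂ) ^ 2 := by
      exact_mod_cast h.cov η
    have f1 : ∑ i, (w i : ℂ) * (((inner ℝ (v i) η : ℝ) : ℂ) * I) = 0 := by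
      simp_rw [← mul_assoc]
      rw [← Finset.sum_mul, e1, zero_mul]
    have f2 : ∑ i, (w i : ℂ) * ((((inner ℝ (v i) η : ℝ) : ℂ) * I) ^ 2 / 2)
        = - ((‖η‖ : ℂ) ^ 2 / 2) := by
      rw [← e2, Finset.sum_div, ← Finset.sum_neg_distrib]
      refine Finset.sum_congr rfl fun i _ => ?_
      rw [mul_pow, Complex.I_sq]
      ring
    simp only [Finset.sum_range_succ, Finset.sum_range_zero, pow_zero, pow_one, Nat.factorial,
      Nat.cast_one, div_one, mul_one, zero_add, Nat.reduceAdd, Nat.cast_ofNat,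
      Nat.succ_eq_add_one, e0, f1, f2]
    rw [stepChar]
    ring
  rw [key]
  calc _ ≤ ∑ i, w i * (B ^ J * ‖η‖ ^ J * Real.exp (B * r)) := by
        refine norm_sum_le_of_le _ fun i _ => ?_
        rw [norm_mul, Complex.norm_real, Real.norm_eq_abs, abs_of_nonneg (h.nonneg i)]
        refine mul_le_mul_of_nonneg_left ?_ (h.nonneg i)
        refine (Complex.norm_exp_sub_sum_le_norm_mul_exp _ _).trans ?_
        rw [norm_mul, Complex.norm_I, mul_one, Complex.norm_real, Real.norm_eq_abs, ← mul_pow]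
        have := hB' i η
        gcongr
        exact this.trans (by gcongr)
    _ = _ := by rw [← Finset.sum_mul, h.sum_eq_one]; ring

lemma exists_norm_stepChar_sub_le_cube (h : IsStandardStep w v) (r : ℝ) :
    ∃ C : ℝ, 0 ≤ C ∧ ∀ η, ‖η‖ ≤ r → ‖stepChar w v η - 1 + ‖η‖ ^ 2 / 2‖ ≤ C * ‖η‖ ^ 3 := by
  obtain ⟨C, hC, hC'⟩ := h.exists_norm_stepChar_sub_le le_rfl r
  refine ⟨C, hC, fun η hη => ?_⟩
  simpa [stepTaylor] using hC' η hη

end IsStandardStep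

end

/-! ### The local expansion of the heat kernel -/

/-- The basic estimate behind the expansion: a factor `x ^ 2` under the Gaussian is worth a factor
`1 / t`. -/
lemma exists_pow_mul_exp_le {c : ℝ} (hc : 0 < c) {m k N : ℕ} (hk : 2 * (m + N) ≤ k) :
    ∃ C : ℝ, 0 ≤ C ∧ ∀ t : ℝ, 1 ≤ t → ∀ x : ℝ, 0 ≤ x →
      t ^ m * x ^ k * Real.exp (-(c * t * x ^ 2))
        ≤ C * ((t ^ N)⁻¹ * Real.exp (-(c / 2 * x ^ 2))) := by
  refine ⟨1 + (k.factorial : ℝ) * (2 / c) ^ k, by positivity, fun t ht x hx => ?_⟩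
  have ht0 : 0 < t := by linarith
  -- in the scaled variable `u` the exponential is `exp (-c u²)`; half of it absorbs the powers
  set u : ℝ := Real.sqrt t * x with hu
  have hu0 : 0 ≤ u := by positivity
  have hu2 : u ^ 2 = t * x ^ 2 := by rw [hu, mul_pow, Real.sq_sqrt ht0.le]
  have hxu : x ≤ u := by
    rw [hu]; exact le_mul_of_one_le_left hx (Real.one_le_sqrt.mpr ht)
  have h1 : t ^ (m + N) * x ^ k ≤ u ^ k := by
    obtain ⟨j, rfl⟩ := Nat.exists_eq_add_of_le hk
    rw [pow_add x, pow_add u, pow_mul u, hu2, mul_pow, ← pow_mul, ← mul_assoc]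
    gcongr
  have h2 : u ^ k ≤ (1 + (k.factorial : ℝ) * (2 / c) ^ k) * Real.exp (c / 2 * u ^ 2) := by
    have h3 := Real.pow_div_factorial_le_exp (x := c / 2 * u ^ 2) (by positivity) k
    rw [div_le_iff₀ (by positivity)] at h3
    have h4 : u ^ (2 * k) ≤ (k.factorial : ℝ) * (2 / c) ^ k * Real.exp (c / 2 * u ^ 2) := by
      calc u ^ (2 * k) = (2 / c) ^ k * (c / 2 * u ^ 2) ^ k := by
            rw [← mul_pow, pow_mul]; congr 1; field_simp
        _ ≤ (2 / c) ^ k * (Real.exp (c / 2 * u ^ 2) * k.factorial) := by gcongr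
        _ = _ := by ring
    have h5 : u ^ k ≤ 1 + u ^ (2 * k) := by
      rw [mul_comm 2 k, pow_mul]; nlinarith [sq_nonneg (u ^ k - 1)]
    have h6 : 1 ≤ Real.exp (c / 2 * u ^ 2) := Real.one_le_exp (by positivity)
    linarith
  have h7 : Real.exp (c / 2 * u ^ 2) * Real.exp (-(c * t * x ^ 2)) ≤
      Real.exp (-(c / 2 * x ^ 2)) := by
    rw [← Real.exp_add]
    refine Real.exp_le_exp.mpr ?_
    have : x ^ 2 ≤ u ^ 2 := by gcongr
    have h8 : c * t * x ^ 2 = c * u ^ 2 := by rw [hu2]; ring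
    nlinarith
  have h9 : t ^ m * x ^ k = (t ^ N)⁻¹ * (t ^ (m + N) * x ^ k) := by
    rw [pow_add]; field_simp
  rw [h9]
  calc (t ^ N)⁻¹ * (t ^ (m + N) * x ^ k) * Real.exp (-(c * t * x ^ 2))
      ≤ (t ^ N)⁻¹ * ((1 + (k.factorial : ℝ) * (2 / c) ^ k) * Real.exp (c / 2 * u ^ 2))
          * Real.exp (-(c * t * x ^ 2)) := by
          exact mul_le_mul_of_nonneg_right
            (mul_le_mul_of_nonneg_left (h1.trans h2) (by positivity)) (by positivity)
    _ = (1 + (k.factorial : ℝ) * (2 / c) ^ k) * ((t ^ N)⁻¹ *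
          (Real.exp (c / 2 * u ^ 2) * Real.exp (-(c * t * x ^ 2)))) := by ring
    _ ≤ _ := by gcongr

lemma norm_pow_sub_pow_le_of_norm_le {a b : ℂ} {A : ℝ} (ha : ‖a‖ ≤ A) (hb : ‖b‖ ≤ A) (m : ℕ) :
    ‖a ^ m - b ^ m‖ ≤ m * A ^ (m - 1) * ‖a - b‖ := by
  rw [← Commute.mul_geom_sum₂ (Commute.all a b), norm_mul, mul_comm]
  refine mul_le_mul_of_nonneg_right ?_ (norm_nonneg _)
  have hA : 0 ≤ A := (norm_nonneg _).trans ha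
  calc _ ≤ ∑ i ∈ Finset.range m, A ^ (m - 1) := by
        refine norm_sum_le_of_le _ fun i hi => ?_
        rw [norm_mul, norm_pow, norm_pow]
        have : m - 1 = i + (m - 1 - i) := by have := Finset.mem_range.mp hi; omega
        rw [this, pow_add]
        simp only [add_tsub_cancel_left]
        gcongr
    _ = _ := by simp

section
variable {d : ℕ} {ι : Type*} [Fintype ι] {w : ι → ℝ} {v : ι → EuclideanSpace ℝ (Fin d)}

lemma norm_cexp_neg_half_mul_sq (t x : ℝ) :
    ‖Complex.exp (-(t / 2) * x ^ 2)‖ = Real.exp (-(t / 2 * x ^ 2)) := by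
  rw [Complex.norm_exp]
  congr 1
  simp [← Complex.ofReal_pow]

lemma norm_cexp_stepChar (t : ℝ) (η : EuclideanSpace ℝ (Fin d)) :
    ‖Complex.exp (-(t * (1 - stepChar w v η)))‖ = Real.exp (-(t * (1 - (stepChar w v η).re))) := by
  rw [Complex.norm_exp]
  simp

/-- The Edgeworth polynomial `∑_{m < M} (t R)^m / m!`, `R` being the Taylor polynomial of the
characteristic function without its quadratic part. -/
noncomputable def edgeworth (w : ι → ℝ) (v : ι → EuclideanSpace ℝ (Fin d)) (M J : ℕ) (t : ℝ)
    (η : EuclideanSpace ℝ (Fin d)) : ℂ :=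
  ∑ m ∈ Finset.range M, (t * stepTaylor w v J η) ^ m / (m.factorial : ℂ)

namespace IsStandardStep

/-- Near the origin, with `r = ψ - 1 + |η|² / 2` of third order, `exp (-t (1 - ψ))` equals
`exp (-t |η|² / 2) exp (t r)`. Truncating the second exponential after `M` terms leaves
`t ^ M |η| ^ (3 M)`, and replacing `r` by its Taylor polynomial leaves `t ^ M |η| ^ J`: both are
small under the Gaussian. -/
lemma exists_near_bound (h : IsStandardStep w v) {N M J : ℕ} (hM : 2 * N ≤ M)
    (hJ : 2 * (M + N) ≤ J) (hJ3 : 3 ≤ J) :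
    ∃ δ > 0, ∃ C : ℝ, 0 ≤ C ∧ ∀ t : ℝ, 1 ≤ t → ∀ η, ‖η‖ ≤ δ →
      ‖Complex.exp (-(t * (1 - stepChar w v η)))
        - Complex.exp (-(t / 2) * ‖η‖ ^ 2) * edgeworth w v M J t η‖
        ≤ C * ((t ^ N)⁻¹ * Real.exp (-(1 / 8 * ‖η‖ ^ 2))) := by
  obtain ⟨C3, hC3, h3⟩ := h.exists_norm_stepChar_sub_le_cube 1
  obtain ⟨CJ, hCJ, hJb⟩ := h.exists_norm_stepChar_sub_le hJ3 1
  obtain ⟨CR, hCR, hRb⟩ := h.exists_norm_stepTaylor_le J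
  obtain ⟨K1, hK1, hK1b⟩ := exists_pow_mul_exp_le (c := 1 / 4) (by norm_num) (m := M) (k := 3 * M)
    (N := N) (by omega)
  obtain ⟨K2, hK2, hK2b⟩ := exists_pow_mul_exp_le (c := 1 / 4) (by norm_num) (m := M) (k := J)
    (N := N) hJ
  set A : ℝ := C3 + 2 * CR with hA
  -- this radius makes `‖r‖ ≤ |η|² / 4`, so that `exp (t r)` costs at most half of the Gaussian
  refine ⟨min 1 (1 / (4 * (C3 + 1))), by positivity,
    C3 ^ M * K1 + (∑ m ∈ Finset.range M, m * A ^ (m - 1)) * CJ * K2, by positivity, ?_⟩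
  intro t ht η hη
  have ht0 : 0 < t := by linarith
  have hη1 : ‖η‖ ≤ 1 := hη.trans (min_le_left _ _)
  have hη2 : ‖η‖ * (4 * (C3 + 1)) ≤ 1 := by
    have := hη.trans (min_le_right _ _)
    rwa [le_div_iff₀ (by positivity)] at this
  set x := ‖η‖ with hx
  have hx0 : 0 ≤ x := norm_nonneg _
  set R := stepTaylor w v J η with hR
  set r : ℂ := stepChar w v η - 1 + (x : ℂ) ^ 2 / 2 with hr
  have hr3 : ‖r‖ ≤ C3 * x ^ 3 := h3 η hη1
  have hrR : ‖r - R‖ ≤ CJ * x ^ J := hJb η hη1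
  have hx3 : x ^ 3 ≤ 1 := pow_le_one₀ hx0 hη1
  have hxJ : x ^ J ≤ 1 := pow_le_one₀ hx0 hη1
  have hrA : ‖r‖ ≤ A := by
    refine hr3.trans ?_
    rw [hA]
    nlinarith
  have hRA : ‖R‖ ≤ A := by
    refine (hRb η).trans ?_
    rw [hA]
    nlinarith
  have htr : ‖(t : ℂ) * r‖ ≤ t * (C3 * x ^ 3) := by
    rw [norm_mul, Complex.norm_real, Real.norm_eq_abs, abs_of_pos ht0]
    gcongr
  have htr4 : t * (C3 * x ^ 3) ≤ t * x ^ 2 / 4 := by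
    have : C3 * x ^ 3 ≤ x ^ 2 / 4 := by nlinarith [sq_nonneg x]
    nlinarith
  have hE : Complex.exp (-(t * (1 - stepChar w v η)))
      = Complex.exp (-(t / 2) * x ^ 2) * Complex.exp (t * r) := by
    rw [← Complex.exp_add, hr]
    congr 1
    ring
  -- the exponential series, truncated
  have b1 : ‖Complex.exp (t * r) - ∑ m ∈ Finset.range M, (t * r) ^ m / (m.factorial : ℂ)‖
      ≤ C3 ^ M * (t ^ M * x ^ (3 * M)) * Real.exp (t * x ^ 2 / 4) := by
    refine (Complex.norm_exp_sub_sum_le_norm_mul_exp _ _).trans ?_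
    have e : C3 ^ M * (t ^ M * x ^ (3 * M)) = (t * (C3 * x ^ 3)) ^ M := by
      rw [pow_mul, mul_pow, mul_pow]; ring
    rw [e]
    have := htr.trans htr4
    gcongr
  -- replacing `r` by its Taylor polynomial
  have b2 : ‖∑ m ∈ Finset.range M, (t * r) ^ m / (m.factorial : ℂ) - edgeworth w v M J t η‖
      ≤ (∑ m ∈ Finset.range M, m * A ^ (m - 1)) * CJ * (t ^ M * x ^ J) := by
    rw [edgeworth, ← Finset.sum_sub_distrib, Finset.sum_mul, Finset.sum_mul]
    refine norm_sum_le_of_le _ fun m hm => ?_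
    have hmM : m ≤ M := (Finset.mem_range.mp hm).le
    rw [← sub_div, mul_pow, mul_pow, ← mul_sub, norm_div, norm_mul, Complex.norm_natCast,
      norm_pow, Complex.norm_real, Real.norm_eq_abs, abs_of_pos ht0]
    refine (div_le_self (by positivity) (by exact_mod_cast m.factorial_pos)).trans ?_
    calc t ^ m * ‖r ^ m - R ^ m‖ ≤ t ^ M * (m * A ^ (m - 1) * (CJ * x ^ J)) := by
          refine mul_le_mul (pow_le_pow_right₀ ht hmM) ?_ (norm_nonneg _) (by positivity)
          refine (norm_pow_sub_pow_le_of_norm_le hrA hRA m).trans ?_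
          gcongr
      _ = _ := by ring
  rw [hE, ← mul_sub, norm_mul, norm_cexp_neg_half_mul_sq]
  have b3 : ‖Complex.exp (t * r) - edgeworth w v M J t η‖
      ≤ C3 ^ M * (t ^ M * x ^ (3 * M)) * Real.exp (t * x ^ 2 / 4)
        + (∑ m ∈ Finset.range M, m * A ^ (m - 1)) * CJ * (t ^ M * x ^ J)
          * Real.exp (t * x ^ 2 / 4) := by
    refine (norm_sub_le_norm_sub_add_norm_sub _ _ _).trans (add_le_add b1 (b2.trans ?_))
    exact le_mul_of_one_le_right (by positivity) (Real.one_le_exp (by positivity))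
  have e4 : Real.exp (-(t / 2 * x ^ 2)) * Real.exp (t * x ^ 2 / 4)
      = Real.exp (-(1 / 4 * t * x ^ 2)) := by
    rw [← Real.exp_add]; congr 1; ring
  have k1 := hK1b t ht x hx0
  have k2 := hK2b t ht x hx0
  have e8 : (1 / 4 / 2 : ℝ) = 1 / 8 := by norm_num
  rw [e8] at k1 k2
  calc _ ≤ Real.exp (-(t / 2 * x ^ 2)) * _ := mul_le_mul_of_nonneg_left b3 (Real.exp_pos _).le
    _ = C3 ^ M * (t ^ M * x ^ (3 * M) * (Real.exp (-(t / 2 * x ^ 2)) * Real.exp (t * x ^ 2 / 4)))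
        + (∑ m ∈ Finset.range M, m * A ^ (m - 1)) * CJ *
          (t ^ M * x ^ J * (Real.exp (-(t / 2 * x ^ 2)) * Real.exp (t * x ^ 2 / 4))) := by ring
    _ ≤ C3 ^ M * (K1 * ((t ^ N)⁻¹ * Real.exp (-(1 / 8 * x ^ 2))))
        + (∑ m ∈ Finset.range M, m * A ^ (m - 1)) * CJ *
          (K2 * ((t ^ N)⁻¹ * Real.exp (-(1 / 8 * x ^ 2)))) := by
        rw [e4]
        gcongr
    _ = _ := by ring

/-- Away from the origin a power of `|η| / δ ≥ 1` may be inserted, which the Gaussian turns into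
powers of `1 / t`. -/
lemma exists_far_bound (h : IsStandardStep w v) (N M : ℕ) {J : ℕ} (hJ3 : 3 ≤ J) {δ : ℝ}
    (hδ : 0 < δ) :
    ∃ C : ℝ, 0 ≤ C ∧ ∀ t : ℝ, 1 ≤ t → ∀ η, δ ≤ ‖η‖ →
      ‖Complex.exp (-(t / 2) * ‖η‖ ^ 2) * edgeworth w v M J t η‖
        ≤ C * ((t ^ N)⁻¹ * Real.exp (-(1 / 4 * ‖η‖ ^ 2))) := by
  obtain ⟨CR, hCR, hRb⟩ := h.exists_norm_stepTaylor_le J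
  have hK : ∀ m : ℕ, ∃ C : ℝ, 0 ≤ C ∧ ∀ t : ℝ, 1 ≤ t → ∀ x : ℝ, 0 ≤ x →
      t ^ M * x ^ (J * m + 2 * (M + N)) * Real.exp (-(1 / 2 * t * x ^ 2))
        ≤ C * ((t ^ N)⁻¹ * Real.exp (-(1 / 2 / 2 * x ^ 2))) := fun m =>
    exists_pow_mul_exp_le (by norm_num) (by omega)
  choose K hK0 hK using hK
  set D : ℝ := CR * ((δ⁻¹) ^ (J - 3) + 1) with hD
  have hD0 : 0 ≤ D := by positivity
  refine ⟨∑ m ∈ Finset.range M, D ^ m * (δ⁻¹) ^ (2 * (M + N)) * K m,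
    Finset.sum_nonneg fun m _ => by have := hK0 m; positivity, ?_⟩
  intro t ht η hη
  have ht0 : 0 < t := by linarith
  set x := ‖η‖ with hx
  have hx0 : 0 < x := hδ.trans_le hη
  have hxδ : 1 ≤ δ⁻¹ * x := by rw [inv_mul_eq_div, one_le_div hδ]; exact hη
  have hR : ‖stepTaylor w v J η‖ ≤ D * x ^ J := by
    refine (hRb η).trans ?_
    have : x ^ 3 ≤ (δ⁻¹) ^ (J - 3) * x ^ J := by
      obtain ⟨j, rfl⟩ := Nat.exists_eq_add_of_le hJ3
      rw [Nat.add_sub_cancel_left, pow_add]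
      calc x ^ 3 = x ^ 3 * 1 := (mul_one _).symm
        _ ≤ x ^ 3 * (δ⁻¹ * x) ^ j := by gcongr; exact one_le_pow₀ hxδ
        _ = _ := by rw [mul_pow]; ring
    rw [hD, mul_assoc]
    gcongr
    linarith
  rw [norm_mul, norm_cexp_neg_half_mul_sq, edgeworth, Finset.sum_mul, mul_comm]
  refine (mul_le_mul_of_nonneg_right (norm_sum_le _ _) (Real.exp_pos _).le).trans ?_
  rw [Finset.sum_mul]
  refine Finset.sum_le_sum fun m hm => ?_
  have hmM : m ≤ M := (Finset.mem_range.mp hm).le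
  have b1 : ‖(t * stepTaylor w v J η) ^ m / (m.factorial : ℂ)‖
      ≤ D ^ m * (δ⁻¹) ^ (2 * (M + N)) * (t ^ M * x ^ (J * m + 2 * (M + N))) := by
    rw [norm_div, norm_pow, norm_mul, Complex.norm_natCast, Complex.norm_real, Real.norm_eq_abs,
      abs_of_pos ht0]
    refine (div_le_self (by positivity) (by exact_mod_cast m.factorial_pos)).trans ?_
    calc (t * ‖stepTaylor w v J η‖) ^ m ≤ (t * (D * x ^ J)) ^ m := by gcongr
      _ = D ^ m * (t ^ m * x ^ (J * m)) * 1 := by rw [mul_pow, mul_pow, ← pow_mul]; ring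
      _ ≤ D ^ m * (t ^ M * x ^ (J * m)) * (δ⁻¹ * x) ^ (2 * (M + N)) := by
          gcongr
          exact one_le_pow₀ hxδ
      _ = _ := by rw [mul_pow, pow_add]; ring
  have k := hK m t ht x hx0.le
  have e4 : (1 / 2 / 2 : ℝ) = 1 / 4 := by norm_num
  rw [e4] at k
  have e5 : -(1 / 2 * t * x ^ 2) = -(t / 2 * x ^ 2) := by ring
  rw [e5] at k
  calc _ ≤ D ^ m * (δ⁻¹) ^ (2 * (M + N)) * (t ^ M * x ^ (J * m + 2 * (M + N)))
        * Real.exp (-(t / 2 * x ^ 2)) := by gcongr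
    _ = D ^ m * (δ⁻¹) ^ (2 * (M + N)) * (t ^ M * x ^ (J * m + 2 * (M + N))
        * Real.exp (-(t / 2 * x ^ 2))) := by ring
    _ ≤ D ^ m * (δ⁻¹) ^ (2 * (M + N)) *
        (K m * ((t ^ N)⁻¹ * Real.exp (-(1 / 4 * x ^ 2)))) := by gcongr
    _ = _ := by ring

/-- The Edgeworth expansion on the Fourier side, with an error that is small of any given order
in `1 / t`. -/
lemma exists_edgeworth_bound (h : IsStandardStep w v) {F : Set (EuclideanSpace ℝ (Fin d))}
    (hF : IsFrequencyDomain w v F) (N : ℕ) :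
    ∃ M J : ℕ, 0 < M ∧ ∃ c > 0, ∃ C : ℝ, 0 ≤ C ∧ ∀ t : ℝ, 1 ≤ t → ∀ η,
      ‖F.indicator (fun η => Complex.exp (-(t * (1 - stepChar w v η)))) η
        - Complex.exp (-(t / 2) * ‖η‖ ^ 2) * edgeworth w v M J t η‖
        ≤ C * ((t ^ N)⁻¹ * Real.exp (-(c * ‖η‖ ^ 2))) := by
  set M := 2 * N + 1 with hM
  set J := 2 * (M + N) + 3 with hJ
  obtain ⟨δ₀, hδ₀, C1, hC1, h1⟩ := h.exists_near_bound (N := N) (M := M) (J := J) (by omega)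
    (by omega) (by omega)
  obtain ⟨δ₁, hδ₁, hball⟩ := Metric.mem_nhds_iff.mp hF.mem_nhds
  obtain ⟨c, hc, hlow⟩ := hF.lower
  set δ := min δ₀ δ₁ with hδ
  have hδ0 : 0 < δ := lt_min hδ₀ hδ₁
  obtain ⟨C2, hC2, h2⟩ := h.exists_far_bound N M (J := J) (by omega) hδ0
  obtain ⟨K, hK, hKb⟩ := exists_pow_mul_exp_le hc (m := 0) (k := 2 * N) (N := N) (by omega)
  refine ⟨M, J, by omega, min (1 / 8) (c / 2), by positivity,
    C1 + (C2 + (δ⁻¹) ^ (2 * N) * K), by positivity, ?_⟩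
  intro t ht η
  have ht0 : 0 < t := by linarith
  set x := ‖η‖ with hx
  have hx0 : 0 ≤ x := norm_nonneg _
  set G := (t ^ N)⁻¹ * Real.exp (-(min (1 / 8) (c / 2) * x ^ 2)) with hG
  have hG0 : 0 ≤ G := by positivity
  have mono : ∀ b, min (1 / 8) (c / 2) ≤ b → (t ^ N)⁻¹ * Real.exp (-(b * x ^ 2)) ≤ G := by
    intro b hb
    rw [hG]
    gcongr
  rcases lt_or_ge x δ with hlt | hge
  · have hmem : η ∈ F := hball (by simpa [← hx] using hlt.trans_le (min_le_right _ _))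
    rw [Set.indicator_of_mem hmem]
    refine (h1 t ht η (hlt.le.trans (min_le_left _ _))).trans ?_
    calc C1 * ((t ^ N)⁻¹ * Real.exp (-(1 / 8 * x ^ 2))) ≤ C1 * G := by
          gcongr; exact mono _ (min_le_left _ _)
      _ ≤ _ := by gcongr; exact le_add_of_nonneg_right (by positivity)
  · have hfar : ‖F.indicator (fun η => Complex.exp (-(t * (1 - stepChar w v η)))) η‖
        ≤ (δ⁻¹) ^ (2 * N) * K * G := by
      by_cases hmem : η ∈ F
      · rw [Set.indicator_of_mem hmem, norm_cexp_stepChar]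
        have hxδ : 1 ≤ δ⁻¹ * x := by rw [inv_mul_eq_div, one_le_div hδ0]; exact hge
        have hl := hlow η hmem
        calc Real.exp (-(t * (1 - (stepChar w v η).re)))
            ≤ 1 * Real.exp (-(c * t * x ^ 2)) := by
              rw [one_mul]
              refine Real.exp_le_exp.mpr ?_
              nlinarith
          _ ≤ (δ⁻¹ * x) ^ (2 * N) * Real.exp (-(c * t * x ^ 2)) := by
              gcongr; exact one_le_pow₀ hxδ
          _ = (δ⁻¹) ^ (2 * N) * (t ^ 0 * x ^ (2 * N) * Real.exp (-(c * t * x ^ 2))) := by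
              rw [mul_pow]; ring
          _ ≤ (δ⁻¹) ^ (2 * N) * (K * ((t ^ N)⁻¹ * Real.exp (-(c / 2 * x ^ 2)))) := by
              have := hKb t ht x hx0
              gcongr
          _ ≤ (δ⁻¹) ^ (2 * N) * (K * G) := by gcongr; exact mono _ (min_le_right _ _)
          _ = _ := by ring
      · rw [Set.indicator_of_notMem hmem, norm_zero]
        positivity
    have h2' := (h2 t ht η hge).trans (mul_le_mul_of_nonneg_left
      (mono (1 / 4) ((min_le_left _ _).trans (by norm_num))) hC2)
    calc _ ≤ _ := norm_sub_le _ _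
      _ ≤ (δ⁻¹) ^ (2 * N) * K * G + C2 * G := add_le_add hfar h2'
      _ = 0 + (C2 + (δ⁻¹) ^ (2 * N) * K) * G := by ring
      _ ≤ C1 * G + (C2 + (δ⁻¹) ^ (2 * N) * K) * G := by gcongr; positivity
      _ = _ := by ring

/-- Fourier inversion of the Edgeworth polynomial. The term with index `m` consists of monomials of
degree at least `3 m ≥ 2 m + 1`, and hence is a correction term if `m > 0`. -/
lemma _root_.exists_gaussTail_edgeworth {M : ℕ} (J : ℕ) (hM : 0 < M) :
    ∃ H ∈ gaussTail d, ∀ t : ℝ, 0 < t → ∀ y,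
      Integrable (fun x : EuclideanSpace ℝ (Fin d) => edgeworth w v M J t x *
        Complex.exp (-(t / 2) * ‖x‖ ^ 2 - (inner ℝ y x : ℝ) * I)) ∧
      (∫ x : EuclideanSpace ℝ (Fin d), edgeworth w v M J t x *
        Complex.exp (-(t / 2) * ‖x‖ ^ 2 - (inner ℝ y x : ℝ) * I)).re
      = (2 * Real.pi) ^ ((d : ℝ) / 2) * (t ^ (-((d : ℝ) / 2)) * Real.exp (-(‖y‖ ^ 2 / 2 / t)))
        + H t y := by
  obtain ⟨M, rfl⟩ := Nat.exists_eq_add_one_of_ne_zero hM.ne'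
  have hmem : ∀ m : ℕ, (stepTaylor w v J) ^ (m + 1) ∈ polyGE d (2 * (m + 1) + 1) := fun m =>
    polyGE_anti (by omega) (polyGE_pow (stepTaylor_mem_polyGE J) (m + 1))
  have hone : (fun _ => 1 : EuclideanSpace ℝ (Fin d) → ℂ) ∈ polyGE d 0 :=
    Submodule.subset_span ⟨0, by simp, by ext; simp [monoFn]⟩
  choose H hH hH' using fun m : ℕ =>
    exists_gaussTail_polyGE (hmem m) (((m + 1).factorial : ℂ)⁻¹)
  refine ⟨∑ m ∈ Finset.range M, H m, sum_mem fun m _ => hH m, fun t ht y => ?_⟩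
  have hint : ∀ m : ℕ, Integrable fun x : EuclideanSpace ℝ (Fin d) => (t : ℂ) ^ (m + 1) *
      ((((m + 1).factorial : ℂ)⁻¹) * ((stepTaylor w v J) ^ (m + 1)) x) *
        Complex.exp (-(t / 2) * ‖x‖ ^ 2 - (inner ℝ y x : ℝ) * I) := by
    intro m
    simpa only [mul_assoc] using (((integrable_polyGE_gauss (hmem m) ht y).const_mul
      (((m + 1).factorial : ℂ)⁻¹)).const_mul ((t : ℂ) ^ (m + 1)))
  have h0 : Integrable fun x : EuclideanSpace ℝ (Fin d) =>
      Complex.exp (-(t / 2) * ‖x‖ ^ 2 - (inner ℝ y x : ℝ) * I) := by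
    simpa using integrable_polyGE_gauss hone ht y
  have key : (fun x : EuclideanSpace ℝ (Fin d) => edgeworth w v (M + 1) J t x *
        Complex.exp (-(t / 2) * ‖x‖ ^ 2 - (inner ℝ y x : ℝ) * I)) = fun x =>
      Complex.exp (-(t / 2) * ‖x‖ ^ 2 - (inner ℝ y x : ℝ) * I) +
        ∑ m ∈ Finset.range M, (t : ℂ) ^ (m + 1) *
      ((((m + 1).factorial : ℂ)⁻¹) * ((stepTaylor w v J) ^ (m + 1)) x) *
        Complex.exp (-(t / 2) * ‖x‖ ^ 2 - (inner ℝ y x : ℝ) * I) := by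
    ext x
    rw [edgeworth, Finset.sum_range_succ', ← Finset.sum_mul, add_comm, add_mul]
    congr 1
    · simp
    · congr 1
      refine Finset.sum_congr rfl fun m _ => ?_
      rw [Pi.pow_apply, mul_pow]
      ring
  rw [key]
  refine ⟨h0.add (integrable_finsetSum _ fun m _ => hint m), ?_⟩
  rw [integral_add h0 (integrable_finsetSum _ fun m _ => hint m),
    integral_finsetSum _ fun m _ => hint m, Complex.add_re, integral_gauss_leading ht,
    Complex.re_sum, Finset.sum_apply, Finset.sum_apply]
  congr 1
  exact Finset.sum_congr rfl fun m _ => hH' m t ht y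

/-- The local central limit theorem with an asymptotic expansion, uniformly in `y`. -/
lemma exists_local_expansion (h : IsStandardStep w v) {F : Set (EuclideanSpace ℝ (Fin d))}
    (hF : IsFrequencyDomain w v F) (N : ℕ) :
    ∃ H ∈ gaussTail d, ∃ C : ℝ, 0 ≤ C ∧ ∀ t : ℝ, 1 ≤ t → ∀ y,
      |heatKernel w v F t y - ((2 * Real.pi) ^ ((d : ℝ) / 2) *
        (t ^ (-((d : ℝ) / 2)) * Real.exp (-(‖y‖ ^ 2 / 2 / t))) + H t y)| ≤ C * (t ^ N)⁻¹ := by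
  obtain ⟨M, J, hM, c, hc, C, hC, hb⟩ := h.exists_edgeworth_bound hF N
  obtain ⟨H, hH, hH'⟩ := exists_gaussTail_edgeworth (w := w) (v := v) J hM
  have hgi : Integrable fun η : EuclideanSpace ℝ (Fin d) => Real.exp (-(c * ‖η‖ ^ 2)) := by
    have := GaussianFourier.integrable_cexp_neg_mul_sq_norm_add
      (V := EuclideanSpace ℝ (Fin d)) (b := (c : ℂ)) (by simpa using hc) 0 0
    refine this.norm.congr (ae_of_all _ fun η => ?_)
    simp [Complex.norm_exp, ← Complex.ofReal_pow]
  refine ⟨H, hH, C * ∫ η : EuclideanSpace ℝ (Fin d), Real.exp (-(c * ‖η‖ ^ 2)),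
    mul_nonneg hC (integral_nonneg fun _ => (Real.exp_pos _).le), fun t ht y => ?_⟩
  have ht0 : 0 < t := by linarith
  obtain ⟨hi, he⟩ := hH' t ht0 y
  rw [← he]
  have hcont : Continuous fun η : EuclideanSpace ℝ (Fin d) =>
      Complex.exp (-(t * (1 - stepChar w v η)) - (inner ℝ y η : ℝ) * I) := by
    have := continuous_stepChar (w := w) (v := v)
    fun_prop
  have hFi : IntegrableOn (fun η : EuclideanSpace ℝ (Fin d) =>
      Complex.exp (-(t * (1 - stepChar w v η)) - (inner ℝ y η : ℝ) * I)) F :=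
    hcont.continuousOn.integrableOn_compact hF.compact
  have hFi' := hFi.integrable_indicator hF.compact.measurableSet
  have e1 : heatKernel w v F t y = (∫ η, F.indicator (fun η =>
      Complex.exp (-(t * (1 - stepChar w v η)) - (inner ℝ y η : ℝ) * I)) η).re := by
    rw [integral_indicator hF.compact.measurableSet, heatKernel]
    exact integral_re hFi
  rw [e1, ← Complex.sub_re, ← integral_sub hFi' hi]
  refine (Complex.abs_re_le_norm _).trans ?_
  have hle : ∀ η, ‖F.indicator (fun η =>
      Complex.exp (-(t * (1 - stepChar w v η)) - (inner ℝ y η : ℝ) * I)) η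
      - edgeworth w v M J t η *
        Complex.exp (-(t / 2) * ‖η‖ ^ 2 - (inner ℝ y η : ℝ) * I)‖
      ≤ C * ((t ^ N)⁻¹ * Real.exp (-(c * ‖η‖ ^ 2))) := by
    intro η
    refine le_trans (le_of_eq ?_) (hb t ht η)
    have e2 : F.indicator (fun η =>
        Complex.exp (-(t * (1 - stepChar w v η)) - (inner ℝ y η : ℝ) * I)) η
        - edgeworth w v M J t η *
          Complex.exp (-(t / 2) * ‖η‖ ^ 2 - (inner ℝ y η : ℝ) * I)
        = (F.indicator (fun η => Complex.exp (-(t * (1 - stepChar w v η)))) η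
        - Complex.exp (-(t / 2) * ‖η‖ ^ 2) * edgeworth w v M J t η)
          * Complex.exp ((-(inner ℝ y η) : ℝ) * I) := by
      by_cases hm : η ∈ F
      · simp only [Set.indicator_of_mem hm, sub_eq_add_neg, Complex.exp_add]
        push_cast
        ring_nf
      · simp only [Set.indicator_of_notMem hm, sub_eq_add_neg, Complex.exp_add]
        push_cast
        ring_nf
    rw [e2, norm_mul, Complex.norm_exp_ofReal_mul_I, mul_one]
  refine (norm_integral_le_of_norm_le ((hgi.const_mul _).const_mul _) (ae_of_all _ hle)).trans ?_
  rw [integral_const_mul, integral_const_mul]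
  exact le_of_eq (by ring)

end IsStandardStep

end

/-! ### The harmonic potential as an integral -/

section
variable {d : ℕ} {ι : Type*} [Fintype ι] {w : ι → ℝ} {v : ι → EuclideanSpace ℝ (Fin d)}

/-- `∫_F Re (ψ(η) ^ k exp (-i ⟨y, η⟩)) dη`; up to a constant factor the probability that the walk is
at `y` at time `k`. -/
noncomputable def walkFourier (w : ι → ℝ) (v : ι → EuclideanSpace ℝ (Fin d))
    (F : Set (EuclideanSpace ℝ (Fin d))) (k : ℕ) (y : EuclideanSpace ℝ (Fin d)) : ℝ :=
  ∫ η in F, (stepChar w v η ^ k * Complex.exp (-(inner ℝ y η : ℝ) * I)).re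

/-- `∫_F Re ((1 - exp (-i ⟨y, η⟩)) / (1 - ψ(η))) dη`. Only the real part of the integrand is
bounded near the origin. -/
noncomputable def potentialIntegral (w : ι → ℝ) (v : ι → EuclideanSpace ℝ (Fin d))
    (F : Set (EuclideanSpace ℝ (Fin d))) (y : EuclideanSpace ℝ (Fin d)) : ℝ :=
  ∫ η in F, ((1 - Complex.exp (-(inner ℝ y η : ℝ) * I)) / (1 - stepChar w v η)).re

lemma one_sub_phase_re (u : ℝ) : (1 - Complex.exp (-(u : ℂ) * I)).re = 1 - Real.cos u := by
  rw [← Complex.ofReal_neg, Complex.exp_mul_I]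
  simp [← Complex.ofReal_cos, ← Complex.ofReal_sin]

lemma norm_one_sub_phase_le (u : ℝ) : ‖1 - Complex.exp (-(u : ℂ) * I)‖ ≤ |u| := by
  have h := Real.norm_exp_I_mul_ofReal_sub_one_le (x := -u)
  rw [norm_sub_rev, mul_comm]
  simpa [Real.norm_eq_abs] using h

lemma norm_one_sub_phase_le_two (u : ℝ) : ‖1 - Complex.exp (-(u : ℂ) * I)‖ ≤ 2 := by
  refine (norm_sub_le _ _).trans ?_
  rw [← Complex.ofReal_neg, Complex.norm_exp_ofReal_mul_I, norm_one]
  norm_num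

namespace IsFrequencyDomain

variable {F : Set (EuclideanSpace ℝ (Fin d))}

lemma measurableSet (hF : IsFrequencyDomain w v F) : MeasurableSet F := hF.compact.measurableSet

lemma exists_norm_le (hF : IsFrequencyDomain w v F) : ∃ r : ℝ, ∀ η ∈ F, ‖η‖ ≤ r :=
  hF.compact.isBounded.exists_norm_le

/-- The mean is zero and the quadratic part of `ψ` is real. -/
lemma exists_abs_im_le (hF : IsFrequencyDomain w v F) (h : IsStandardStep w v) :
    ∃ C : ℝ, 0 ≤ C ∧ ∀ η ∈ F, |(stepChar w v η).im| ≤ C * ‖η‖ ^ 3 := by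
  obtain ⟨r, hr⟩ := hF.exists_norm_le
  obtain ⟨C, hC, hb⟩ := h.exists_norm_stepChar_sub_le_cube r
  refine ⟨C, hC, fun η hη => le_trans ?_ (hb η (hr η hη))⟩
  refine le_trans (le_of_eq ?_) (Complex.abs_im_le_norm _)
  have : ((‖η‖ : ℂ) ^ 2 / 2).im = 0 := by
    rw [← Complex.ofReal_pow, ← Complex.ofReal_ofNat, ← Complex.ofReal_div, Complex.ofReal_im]
  rw [Complex.add_im, this]
  simp

/-- Cancellation of the odd part: the real part of `(1 - exp (-i ⟨y, η⟩)) exp (-t (1 - ψ))` is of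
order `|η|²`, although `1 - exp (-i ⟨y, η⟩)` is only of order `|η|`. This makes the time integral
converge absolutely in every dimension. -/
lemma exists_bound_heat_difference (hF : IsFrequencyDomain w v F) (h : IsStandardStep w v)
    (y : EuclideanSpace ℝ (Fin d)) :
    ∃ c > 0, ∃ K : ℝ, 0 ≤ K ∧ ∀ t : ℝ, 0 < t → ∀ η ∈ F,
      |((1 - Complex.exp (-(inner ℝ y η : ℝ) * I)) *
        Complex.exp (-(t * (1 - stepChar w v η)))).re| ≤
        K * (‖η‖ ^ 2 * Real.exp (-(c * ‖η‖ ^ 2) * t)) := by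
  obtain ⟨c, hc, hlow⟩ := hF.lower
  obtain ⟨C, hC, him⟩ := hF.exists_abs_im_le h
  refine ⟨c / 2, by positivity, ‖y‖ ^ 2 + ‖y‖ * C * (2 / c), by positivity, fun t ht η hη => ?_⟩
  set x := ‖η‖ with hx
  set u : ℝ := inner ℝ y η with hu
  have hux : |u| ≤ ‖y‖ * x := abs_real_inner_le_norm y η
  set ψ := stepChar w v η with hψ
  have hE : ‖Complex.exp (-(t * (1 - ψ)))‖ ≤ Real.exp (-(c * x ^ 2) * t) := by
    rw [hψ, norm_cexp_stepChar]
    have := hlow η hη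
    refine Real.exp_le_exp.mpr ?_
    nlinarith
  have hEim : |(Complex.exp (-(t * (1 - ψ)))).im| ≤
      Real.exp (-(c * x ^ 2) * t) * (t * (C * x ^ 3)) := by
    rw [Complex.exp_im, abs_mul, Real.abs_exp]
    have h1 : Real.exp (-(t * (1 - ψ))).re ≤ Real.exp (-(c * x ^ 2) * t) := by
      rwa [Complex.norm_exp] at hE
    have h2 : |Real.sin (-(t * (1 - ψ))).im| ≤ t * (C * x ^ 3) := by
      refine Real.abs_sin_le_abs.trans ?_
      have : (-((t : ℂ) * (1 - ψ))).im = t * ψ.im := by simp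
      rw [this, abs_mul, abs_of_pos ht]
      have := him η hη
      gcongr
    gcongr
  have hre : |(1 - Complex.exp (-(u : ℂ) * I)).re| ≤ ‖y‖ ^ 2 * x ^ 2 := by
    rw [one_sub_phase_re, abs_of_nonneg (by linarith [Real.cos_le_one u])]
    have h1 := Real.one_sub_sq_div_two_le_cos (x := u)
    have h2 : u ^ 2 ≤ (‖y‖ * x) ^ 2 := by rw [← sq_abs u]; gcongr
    nlinarith [sq_nonneg u]
  have him' : |(1 - Complex.exp (-(u : ℂ) * I)).im| ≤ ‖y‖ * x :=
    (Complex.abs_im_le_norm _).trans ((norm_one_sub_phase_le u).trans hux)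
  have hdecay : t * x ^ 2 * Real.exp (-(c * x ^ 2) * t) ≤
      2 / c * Real.exp (-(c / 2 * x ^ 2) * t) := by
    have h1 : c / 2 * x ^ 2 * t ≤ Real.exp (c / 2 * x ^ 2 * t) := by
      linarith [Real.add_one_le_exp (c / 2 * x ^ 2 * t)]
    have h2 : t * x ^ 2 = 2 / c * (c / 2 * x ^ 2 * t) := by field_simp
    have h3 : Real.exp (-(c / 2 * x ^ 2) * t) =
        Real.exp (c / 2 * x ^ 2 * t) * Real.exp (-(c * x ^ 2) * t) := by
      rw [← Real.exp_add]; congr 1; ring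
    rw [h2, h3, mul_assoc]
    gcongr
  have hdecay' : Real.exp (-(c * x ^ 2) * t) ≤ Real.exp (-(c / 2 * x ^ 2) * t) := by
    refine Real.exp_le_exp.mpr ?_
    have : 0 ≤ c * x ^ 2 * t := by positivity
    nlinarith
  have hEre : |(Complex.exp (-(t * (1 - ψ)))).re| ≤ Real.exp (-(c * x ^ 2) * t) :=
    (Complex.abs_re_le_norm _).trans hE
  rw [Complex.mul_re]
  calc _ ≤ _ := abs_sub _ _
    _ ≤ ‖y‖ ^ 2 * x ^ 2 * Real.exp (-(c * x ^ 2) * t) +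
        ‖y‖ * x * (Real.exp (-(c * x ^ 2) * t) * (t * (C * x ^ 3))) := by
        rw [abs_mul, abs_mul]
        gcongr
    _ = ‖y‖ ^ 2 * x ^ 2 * Real.exp (-(c * x ^ 2) * t) +
        ‖y‖ * C * x ^ 2 * (t * x ^ 2 * Real.exp (-(c * x ^ 2) * t)) := by ring
    _ ≤ ‖y‖ ^ 2 * x ^ 2 * Real.exp (-(c / 2 * x ^ 2) * t) +
        ‖y‖ * C * x ^ 2 * (2 / c * Real.exp (-(c / 2 * x ^ 2) * t)) := by gcongr
    _ = _ := by ring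

lemma stepChar_re_lt_one (hF : IsFrequencyDomain w v F) {η : EuclideanSpace ℝ (Fin d)}
    (hη : η ∈ F) (h0 : η ≠ 0) : (stepChar w v η).re < 1 := by
  obtain ⟨c, hc, hlow⟩ := hF.lower
  have := hlow η hη
  have : 0 < c * ‖η‖ ^ 2 := by positivity
  linarith

lemma integral_heat_difference (hF : IsFrequencyDomain w v F) (y : EuclideanSpace ℝ (Fin d))
    {η : EuclideanSpace ℝ (Fin d)} (hη : η ∈ F) :
    ∫ t in Set.Ioi (0 : ℝ), ((1 - Complex.exp (-(inner ℝ y η : ℝ) * I)) *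
        Complex.exp (-(t * (1 - stepChar w v η)))).re
      = ((1 - Complex.exp (-(inner ℝ y η : ℝ) * I)) / (1 - stepChar w v η)).re := by
  rcases eq_or_ne η 0 with rfl | h0
  · simp
  have hlt := hF.stepChar_re_lt_one hη h0
  have ha : (stepChar w v η - 1).re < 0 := by simpa using hlt
  have hi : IntegrableOn (fun t : ℝ => (1 - Complex.exp (-(inner ℝ y η : ℝ) * I)) *
        Complex.exp ((stepChar w v η - 1) * t)) (Set.Ioi 0) :=
    (integrableOn_exp_mul_complex_Ioi ha 0).const_mul _
  have e : ∀ t : ℝ, Complex.exp (-(t * (1 - stepChar w v η)))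
      = Complex.exp ((stepChar w v η - 1) * t) := fun t => by ring_nf
  simp_rw [e]
  have := integral_re hi
  simp only [RCLike.re_to_complex] at this
  rw [this, integral_const_mul, integral_exp_mul_complex_Ioi ha]
  congr 1
  have h1 : stepChar w v η - 1 ≠ 0 := fun h => by simp [h] at ha
  have h2 : 1 - stepChar w v η ≠ 0 := fun h => h1 (by linear_combination -h)
  simp only [Complex.ofReal_zero, mul_zero, Complex.exp_zero]
  field_simp
  ring

lemma integrable_exp_sq_mul {c : ℝ} (hc : 0 < c) (x : ℝ) :
    IntegrableOn (fun t : ℝ => x ^ 2 * Real.exp (-(c * x ^ 2) * t)) (Set.Ioi 0) := by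
  rcases eq_or_ne x 0 with rfl | h0
  · simp
  · have hneg : -(c * x ^ 2) < 0 := neg_lt_zero.mpr (by positivity)
    exact (integrableOn_exp_mul_Ioi hneg 0).const_mul _

lemma integral_exp_sq_mul_le {c : ℝ} (hc : 0 < c) (x : ℝ) :
    ∫ t in Set.Ioi (0 : ℝ), x ^ 2 * Real.exp (-(c * x ^ 2) * t) ≤ 1 / c := by
  rcases eq_or_ne x 0 with rfl | h0
  · simpa using hc.le
  · have hneg : -(c * x ^ 2) < 0 := neg_lt_zero.mpr (by positivity)
    rw [integral_const_mul, integral_exp_mul_Ioi hneg]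
    refine le_of_eq ?_
    simp only [mul_zero, Real.exp_zero]
    field_simp

lemma exists_bound_re (hF : IsFrequencyDomain w v F) (h : IsStandardStep w v)
    (y : EuclideanSpace ℝ (Fin d)) : ∃ K : ℝ, 0 ≤ K ∧ ∀ η ∈ F,
      |((1 - Complex.exp (-(inner ℝ y η : ℝ) * I)) / (1 - stepChar w v η)).re| ≤ K := by
  obtain ⟨c, hc, K, hK, hb⟩ := hF.exists_bound_heat_difference h y
  refine ⟨K * (1 / c), by positivity, fun η hη => ?_⟩
  rw [← hF.integral_heat_difference y hη, ← Real.norm_eq_abs]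
  refine (norm_integral_le_of_norm_le ((integrable_exp_sq_mul hc ‖η‖).const_mul K) ?_).trans ?_
  · exact (ae_restrict_iff' measurableSet_Ioi).mpr (ae_of_all _ fun t ht => hb t ht η hη)
  · rw [integral_const_mul]
    gcongr
    exact integral_exp_sq_mul_le hc _

lemma integrableOn_of_continuous (hF : IsFrequencyDomain w v F)
    {f : EuclideanSpace ℝ (Fin d) → ℝ} (hf : Continuous f) : IntegrableOn f F :=
  hf.continuousOn.integrableOn_compact hF.compact

lemma heatKernel_zero_sub (hF : IsFrequencyDomain w v F) (t : ℝ) (y : EuclideanSpace ℝ (Fin d)) :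
    heatKernel w v F t 0 - heatKernel w v F t y =
      ∫ η in F, ((1 - Complex.exp (-(inner ℝ y η : ℝ) * I)) *
        Complex.exp (-(t * (1 - stepChar w v η)))).re := by
  have hψ := continuous_stepChar (w := w) (v := v)
  rw [heatKernel, heatKernel, ← integral_sub (hF.integrableOn_of_continuous (by fun_prop))
    (hF.integrableOn_of_continuous (by fun_prop))]
  congr 1
  ext η
  rw [← Complex.sub_re]
  congr 1
  rw [inner_zero_left, Complex.ofReal_zero, zero_mul, sub_zero, sub_eq_add_neg _ (_ * I),
    Complex.exp_add, neg_mul]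
  ring

/-- Fubini: the potential is the time integral of the difference of heat kernels. -/
lemma potential_eq_integral_heat (hF : IsFrequencyDomain w v F) (h : IsStandardStep w v)
    (y : EuclideanSpace ℝ (Fin d)) :
    IntegrableOn (fun t => heatKernel w v F t 0 - heatKernel w v F t y) (Set.Ioi 0) ∧
    ∫ t in Set.Ioi (0 : ℝ), (heatKernel w v F t 0 - heatKernel w v F t y)
      = potentialIntegral w v F y := by
  have hψ := continuous_stepChar (w := w) (v := v)
  obtain ⟨c, hc, K, hK, hb⟩ := hF.exists_bound_heat_difference h y
  set g : ℝ → EuclideanSpace ℝ (Fin d) → ℝ := fun t η =>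
    ((1 - Complex.exp (-(inner ℝ y η : ℝ) * I)) * Complex.exp (-(t * (1 - stepChar w v η)))).re
    with hg
  have hfin : IsFiniteMeasure ((volume : Measure (EuclideanSpace ℝ (Fin d))).restrict F) :=
    isFiniteMeasure_restrict.mpr hF.compact.measure_lt_top.ne
  have hG : Integrable (fun p : ℝ × EuclideanSpace ℝ (Fin d) =>
      ‖p.2‖ ^ 2 * Real.exp (-(c * ‖p.2‖ ^ 2) * p.1))
      ((volume.restrict (Set.Ioi 0)).prod (volume.restrict F)) := by
    have hcont : Continuous (fun p : ℝ × EuclideanSpace ℝ (Fin d) =>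
      ‖p.2‖ ^ 2 * Real.exp (-(c * ‖p.2‖ ^ 2) * p.1)) := by fun_prop
    rw [integrable_prod_iff' hcont.aestronglyMeasurable]
    refine ⟨ae_of_all _ fun η => integrable_exp_sq_mul hc ‖η‖, ?_⟩
    refine Integrable.of_bound (C := 1 / c)
      ?_ (ae_of_all _ fun η => ?_)
    · have hcont' : Continuous (fun p : EuclideanSpace ℝ (Fin d) × ℝ =>
          ‖‖p.1‖ ^ 2 * Real.exp (-(c * ‖p.1‖ ^ 2) * p.2)‖) := by fun_prop
      exact hcont'.aestronglyMeasurable.integral_prod_right'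
    · rw [Real.norm_eq_abs, abs_of_nonneg (integral_nonneg fun _ => norm_nonneg _)]
      refine le_trans (le_of_eq ?_) (integral_exp_sq_mul_le hc ‖η‖)
      congr 1
      ext t
      exact abs_of_nonneg (by positivity)
  have hgi : Integrable (Function.uncurry g)
      ((volume.restrict (Set.Ioi 0)).prod (volume.restrict F)) := by
    refine (hG.const_mul K).mono' ?_ ?_
    · have : Continuous (Function.uncurry g) := by
        rw [hg]; unfold Function.uncurry; fun_prop
      exact this.aestronglyMeasurable
    · rw [Measure.prod_restrict]
      refine (ae_restrict_iff' (measurableSet_Ioi.prod hF.measurableSet)).mpr (ae_of_all _ ?_)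
      rintro ⟨t, η⟩ ⟨ht, hη⟩
      exact hb t ht η hη
  have e : (fun t => heatKernel w v F t 0 - heatKernel w v F t y) = fun t => ∫ η in F, g t η :=
    funext fun t => hF.heatKernel_zero_sub t y
  rw [e]
  refine ⟨hgi.integral_prod_left, ?_⟩
  rw [integral_integral_swap hgi, potentialIntegral]
  exact setIntegral_congr_fun hF.measurableSet fun η hη => hF.integral_heat_difference y hη

end IsFrequencyDomain

/-! ### Convergence of the partial sums -/

lemma measure_inner_eq_zero {u : EuclideanSpace ℝ (Fin d)} (hu : u ≠ 0) (a : ℝ) :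
    volume {η : EuclideanSpace ℝ (Fin d) | inner ℝ u η = a} = 0 := by
  have h0 : volume ((LinearMap.ker (innerₛₗ ℝ u) : Submodule ℝ (EuclideanSpace ℝ (Fin d))) :
      Set (EuclideanSpace ℝ (Fin d))) = 0 := by
    refine Measure.addHaar_submodule _ _ fun htop => hu ?_
    have : u ∈ LinearMap.ker (innerₛₗ ℝ u) := htop ▸ Submodule.mem_top
    simpa using this
  have e : {η : EuclideanSpace ℝ (Fin d) | inner ℝ u η = a} =
      (fun η => η + (-(a / ‖u‖ ^ 2) • u)) ⁻¹' (LinearMap.ker (innerₛₗ ℝ u) :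
        Submodule ℝ (EuclideanSpace ℝ (Fin d))) := by
    ext η
    have hn : ‖u‖ ^ 2 ≠ 0 := by positivity
    simp only [Set.mem_ofPred_eq, Set.mem_preimage, SetLike.mem_coe, LinearMap.mem_ker,
      innerₛₗ_apply_apply, inner_add_right, inner_smul_right, real_inner_self_eq_norm_sq]
    field_simp
    constructor <;> intro h <;> linarith
  rw [e, measure_preimage_add_right, h0]

namespace IsStandardStep

lemma exists_ne (h : IsStandardStep w v) (hd : 0 < d) :
    ∃ i j, 0 < w i ∧ 0 < w j ∧ v i ≠ v j := by
  by_contra! hcon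
  set η : EuclideanSpace ℝ (Fin d) := EuclideanSpace.single ⟨0, hd⟩ 1 with hη
  have hcov := h.cov η
  have hmean := h.mean η
  have hn : ‖η‖ ^ 2 = 1 := by simp [hη]
  obtain ⟨i, -, hi⟩ : ∃ i ∈ Finset.univ, w i * (inner ℝ (v i) η) ^ 2 ≠ 0 :=
    Finset.exists_ne_zero_of_sum_ne_zero (by rw [hcov, hn]; exact one_ne_zero)
  have hwi : 0 < w i := (h.nonneg i).lt_of_ne fun h0 => hi (by rw [← h0, zero_mul])
  have : ∑ j, w j * inner ℝ (v j) η = inner ℝ (v i) η := by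
    calc _ = ∑ j, w j * inner ℝ (v i) η := by
          refine Finset.sum_congr rfl fun j _ => ?_
          rcases (h.nonneg j).eq_or_lt with h0 | h0
          · rw [← h0, zero_mul, zero_mul]
          · rw [hcon i j hwi h0]
      _ = _ := by rw [← Finset.sum_mul, h.sum_eq_one, one_mul]
  rw [hmean] at this
  rw [← this] at hi
  simp at hi

/-- The equality case of the triangle inequality. -/
lemma exp_eq_of_norm_eq_one (h : IsStandardStep w v) {η : EuclideanSpace ℝ (Fin d)}
    (hη : ‖stepChar w v η‖ = 1) {i : ι} (hi : 0 < w i) :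
    Complex.exp ((inner ℝ (v i) η : ℝ) * I) = stepChar w v η := by
  set ψ := stepChar w v η with hψ
  have hle : ∀ j, (Complex.exp ((inner ℝ (v j) η : ℝ) * I) * (starRingEnd ℂ) ψ).re ≤ 1 := by
    intro j
    refine (Complex.re_le_norm _).trans ?_
    rw [norm_mul, Complex.norm_exp_ofReal_mul_I, Complex.norm_conj, hη, one_mul]
  have hsum : ∑ j, w j * (1 - (Complex.exp ((inner ℝ (v j) η : ℝ) * I) *
      (starRingEnd ℂ) ψ).re) = 0 := by
    have h1 : (ψ * (starRingEnd ℂ) ψ).re = 1 := by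
      rw [Complex.mul_conj, Complex.ofReal_re, Complex.normSq_eq_norm_sq, hη, one_pow]
    have h2 : ∀ z : ℂ, (ψ * z).re = ∑ j, w j *
        (Complex.exp ((inner ℝ (v j) η : ℝ) * I) * z).re := by
      intro z
      rw [hψ, stepChar, Finset.sum_mul, Complex.re_sum]
      refine Finset.sum_congr rfl fun j _ => ?_
      rw [mul_assoc, Complex.re_ofReal_mul]
    simp only [mul_sub, mul_one, Finset.sum_sub_distrib, h.sum_eq_one]
    rw [← h2, h1, sub_self]
  have hz := (Finset.sum_eq_zero_iff_of_nonneg fun j _ =>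
    mul_nonneg (h.nonneg j) (sub_nonneg.mpr (hle j))).mp hsum i (Finset.mem_univ i)
  have hre : (Complex.exp ((inner ℝ (v i) η : ℝ) * I) * (starRingEnd ℂ) ψ).re = 1 := by
    rcases mul_eq_zero.mp hz with h0 | h0
    · exact absurd h0 hi.ne'
    · linarith
  have hn : ‖Complex.exp ((inner ℝ (v i) η : ℝ) * I) * (starRingEnd ℂ) ψ‖ = 1 := by
    rw [norm_mul, Complex.norm_exp_ofReal_mul_I, Complex.norm_conj, hη, one_mul]
  have hone : Complex.exp ((inner ℝ (v i) η : ℝ) * I) * (starRingEnd ℂ) ψ = 1 := by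
    have h3 := Complex.sq_norm (Complex.exp ((inner ℝ (v i) η : ℝ) * I) * (starRingEnd ℂ) ψ)
    rw [hn, Complex.normSq_apply, hre] at h3
    refine Complex.ext (by simpa using hre) ?_
    rw [Complex.one_im]
    nlinarith
  have h4 : (starRingEnd ℂ) ψ * ψ = 1 := by
    rw [mul_comm, Complex.mul_conj, Complex.normSq_eq_norm_sq, hη]
    simp
  calc _ = Complex.exp ((inner ℝ (v i) η : ℝ) * I) * ((starRingEnd ℂ) ψ * ψ) := by
        rw [h4, mul_one]
    _ = ψ := by rw [← mul_assoc, hone, one_mul]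

/-- For a periodic walk `|ψ| = 1` occurs away from the origin, but only on a union of countably many
hyperplanes. -/
lemma ae_norm_stepChar_lt_one (h : IsStandardStep w v) (hd : 0 < d) :
    ∀ᵐ η : EuclideanSpace ℝ (Fin d), ‖stepChar w v η‖ < 1 := by
  obtain ⟨i, j, hi, hj, hij⟩ := h.exists_ne hd
  have hnull : volume (⋃ n : ℤ, {η : EuclideanSpace ℝ (Fin d) |
      inner ℝ (v i - v j) η = n * (2 * Real.pi)}) = 0 :=
    measure_iUnion_null fun n => measure_inner_eq_zero (sub_ne_zero.mpr hij) _
  refine measure_mono_null (fun η hη => ?_) hnull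
  have h1 : ‖stepChar w v η‖ = 1 :=
    le_antisymm (h.norm_stepChar_le_one η) (not_lt.mp hη)
  have h2 := (h.exp_eq_of_norm_eq_one h1 hi).trans (h.exp_eq_of_norm_eq_one h1 hj).symm
  obtain ⟨n, hn⟩ := Complex.exp_eq_exp_iff_exists_int.mp h2
  refine Set.mem_iUnion.mpr ⟨n, ?_⟩
  have h3 : ((inner ℝ (v i) η : ℝ) : ℂ) = (inner ℝ (v j) η : ℝ) + n * (2 * Real.pi) := by
    have : ((inner ℝ (v i) η : ℝ) : ℂ) * I
        = ((inner ℝ (v j) η : ℝ) + n * (2 * Real.pi)) * I := by rw [hn]; ring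
    exact mul_right_cancel₀ Complex.I_ne_zero this
  have h4 : inner ℝ (v i) η = inner ℝ (v j) η + n * (2 * Real.pi) := by exact_mod_cast h3
  rw [Set.mem_ofPred_eq, inner_sub_left, h4]
  ring

end IsStandardStep

lemma abs_im_pow_le (z : ℂ) (n : ℕ) : |(z ^ n).im| ≤ n * |z.im| * ‖z‖ ^ (n - 1) := by
  induction n with
  | zero => simp
  | succ n ih =>
    rw [pow_succ, Complex.mul_im]
    have h1 : |(z ^ n).re * z.im| ≤ ‖z‖ ^ n * |z.im| := by
      rw [abs_mul]
      gcongr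
      exact (Complex.abs_re_le_norm _).trans (norm_pow z n).le
    have h2 : |(z ^ n).im * z.re| ≤ n * |z.im| * ‖z‖ ^ n := by
      rcases n with _ | n
      · simp
      · rw [abs_mul]
        calc _ ≤ ((n + 1 : ℕ) : ℝ) * |z.im| * ‖z‖ ^ (n + 1 - 1) * ‖z‖ := by
              gcongr
              exact Complex.abs_re_le_norm z
          _ = _ := by rw [Nat.add_sub_cancel, pow_succ]; ring
    refine (abs_add_le _ _).trans ((add_le_add h1 h2).trans (le_of_eq ?_))
    rw [Nat.add_sub_cancel]
    push_cast
    ring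

/-- The probability of exactly one success in `n` trials is at most `1`. -/
lemma nat_mul_mul_one_sub_pow_le_one {x : ℝ} (h0 : 0 ≤ x) (h1 : x ≤ 1) (n : ℕ) :
    n * x * (1 - x) ^ (n - 1) ≤ 1 := by
  rcases n with _ | n
  · simp
  rw [Nat.add_sub_cancel]
  have h2 : ((n + 1 : ℕ) : ℝ) * x ≤ 1 + n * x := by push_cast; linarith
  have h3 : 1 + n * x ≤ (1 + x) ^ n := one_add_mul_le_pow (by linarith) n
  calc _ ≤ (1 + x) ^ n * (1 - x) ^ n := by
        have : 0 ≤ 1 - x := by linarith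
        gcongr
        exact h2.trans h3
    _ = (1 - x ^ 2) ^ n := by rw [← mul_pow]; ring_nf
    _ ≤ 1 := pow_le_one₀ (by nlinarith) (by nlinarith)

namespace IsFrequencyDomain

variable {F : Set (EuclideanSpace ℝ (Fin d))}

lemma sum_walkFourier_sub (hF : IsFrequencyDomain w v F) (N : ℕ) (y : EuclideanSpace ℝ (Fin d)) :
    ∑ k ∈ Finset.range N, (walkFourier w v F k 0 - walkFourier w v F k y) =
      ∫ η in F, ((1 - stepChar w v η ^ N) *
        ((1 - Complex.exp (-(inner ℝ y η : ℝ) * I)) / (1 - stepChar w v η))).re := by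
  have hψ := continuous_stepChar (w := w) (v := v)
  have hk : ∀ k, walkFourier w v F k 0 - walkFourier w v F k y =
      ∫ η in F, (stepChar w v η ^ k * (1 - Complex.exp (-(inner ℝ y η : ℝ) * I))).re := by
    intro k
    rw [walkFourier, walkFourier, ← integral_sub (hF.integrableOn_of_continuous (by fun_prop))
      (hF.integrableOn_of_continuous (by fun_prop))]
    congr 1
    ext η
    rw [← Complex.sub_re]
    congr 1
    simp
    ring
  simp_rw [hk]
  rw [← integral_finsetSum _ fun k _ => hF.integrableOn_of_continuous (by fun_prop)]
  refine setIntegral_congr_fun hF.measurableSet fun η hη => ?_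
  rw [← Complex.re_sum, ← Finset.sum_mul]
  congr 1
  rcases eq_or_ne η 0 with rfl | h0
  · simp
  · have h1 : stepChar w v η ≠ 1 := fun h => by
      have := hF.stepChar_re_lt_one hη h0
      simp [h] at this
    rw [geom_sum_eq h1]
    have h2 : 1 - stepChar w v η ≠ 0 := sub_ne_zero.mpr h1.symm
    have h3 : stepChar w v η - 1 ≠ 0 := sub_ne_zero.mpr h1
    field_simp
    ring

/-- A bound for the integrand of the partial sums that does not depend on their length. Near the
origin the imaginary part of `(1 - exp (-i ⟨y, η⟩)) / (1 - ψ)`, of order `1 / |η|`, is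
compensated by that of `ψ ^ N`, of order `N |η|³ (1 - |η|² / 4) ^ (N - 1)`. Elsewhere `|ψ| = 1` is
possible, as the walk may be periodic, but `1 - ψ` is bounded below. -/
lemma exists_bound_partial_sum (hF : IsFrequencyDomain w v F) (h : IsStandardStep w v)
    (y : EuclideanSpace ℝ (Fin d)) : ∃ K : ℝ, ∀ N : ℕ, ∀ η ∈ F,
      |((1 - stepChar w v η ^ N) *
        ((1 - Complex.exp (-(inner ℝ y η : ℝ) * I)) / (1 - stepChar w v η))).re| ≤ K := by
  obtain ⟨K, hK, hKb⟩ := hF.exists_bound_re h y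
  obtain ⟨c, hc, hlow⟩ := hF.lower
  obtain ⟨C, hC, him⟩ := hF.exists_abs_im_le h
  obtain ⟨C3, hC3, h3⟩ := h.exists_norm_stepChar_sub_le_cube 1
  set δ : ℝ := min 1 (1 / (4 * (C3 + 1))) with hδ
  have hδ0 : 0 < δ := by positivity
  refine ⟨(K + K) + 4 * C * ‖y‖ / c + 4 / (c * δ ^ 2), fun N η hη => ?_⟩
  set f := (1 - Complex.exp (-(inner ℝ y η : ℝ) * I)) / (1 - stepChar w v η) with hf
  set ψ := stepChar w v η with hψ
  set x := ‖η‖ with hx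
  have hfK : |f.re| ≤ K := hKb η hη
  have hψ1 : ‖ψ‖ ≤ 1 := h.norm_stepChar_le_one η
  have hψN : ‖ψ ^ N‖ ≤ 1 := by rw [norm_pow]; exact pow_le_one₀ (norm_nonneg _) hψ1
  rcases eq_or_ne η 0 with h0 | h0
  · have : f = 0 := by rw [hf, h0]; simp
    rw [this, mul_zero, Complex.zero_re, abs_zero]
    positivity
  have hx0 : 0 < x := norm_pos_iff.mpr h0
  have hden : c * x ^ 2 ≤ ‖1 - ψ‖ := by
    refine (hlow η hη).trans ?_
    have := Complex.re_le_norm (1 - ψ)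
    simpa using this
  rcases le_or_gt x δ with hle | hgt
  · have hx1 : x ≤ 1 := hle.trans (min_le_left _ _)
    have hx2 : x * (4 * (C3 + 1)) ≤ 1 := by
      have := hle.trans (min_le_right _ _)
      rwa [le_div_iff₀ (by positivity)] at this
    have hψs : ‖ψ‖ ≤ 1 - x ^ 2 / 4 := by
      have e : ψ = (ψ - 1 + (x : ℂ) ^ 2 / 2) + ((1 - x ^ 2 / 2 : ℝ) : ℂ) := by push_cast; ring
      rw [e]
      refine (norm_add_le _ _).trans ?_
      have h4 := h3 η hx1
      rw [Complex.norm_real, Real.norm_eq_abs, abs_of_nonneg (by nlinarith)]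
      have : C3 * x ^ 3 ≤ x ^ 2 / 4 := by nlinarith [sq_nonneg x]
      linarith
    have hfn : |f.im| ≤ ‖y‖ / (c * x) := by
      refine (Complex.abs_im_le_norm _).trans ?_
      rw [hf, norm_div]
      calc _ ≤ ‖y‖ * x / (c * x ^ 2) := by
            gcongr
            exact (norm_one_sub_phase_le _).trans (abs_real_inner_le_norm y η)
        _ = _ := by field_simp
    have himN : |(ψ ^ N).im| ≤ N * (C * x ^ 3) * (1 - x ^ 2 / 4) ^ (N - 1) := by
      refine (abs_im_pow_le ψ N).trans ?_
      have := him η hη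
      gcongr
    have hprod : |(ψ ^ N).im * f.im| ≤ 4 * C * ‖y‖ / c := by
      rw [abs_mul]
      have hb := nat_mul_mul_one_sub_pow_le_one (x := x ^ 2 / 4) (by positivity) (by nlinarith) N
      have hnn : 0 ≤ 1 - x ^ 2 / 4 := by nlinarith
      calc _ ≤ N * (C * x ^ 3) * (1 - x ^ 2 / 4) ^ (N - 1) * (‖y‖ / (c * x)) := by gcongr
        _ = 4 * C * ‖y‖ / c * (N * (x ^ 2 / 4) * (1 - x ^ 2 / 4) ^ (N - 1)) := by field_simp
        _ ≤ 4 * C * ‖y‖ / c * 1 := by gcongr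
        _ = _ := mul_one _
    have hre : |(ψ ^ N).re * f.re| ≤ K := by
      rw [abs_mul]
      calc _ ≤ 1 * K := by
            gcongr
            exact (Complex.abs_re_le_norm _).trans hψN
        _ = K := one_mul K
    have e : ((1 - ψ ^ N) * f).re = f.re - ((ψ ^ N).re * f.re - (ψ ^ N).im * f.im) := by
      rw [sub_mul, one_mul, Complex.sub_re, Complex.mul_re]
    rw [e]
    have : 0 ≤ 4 / (c * δ ^ 2) := by positivity
    refine (abs_sub _ _).trans ?_
    linarith [abs_sub ((ψ ^ N).re * f.re) ((ψ ^ N).im * f.im)]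
  · have hfn : ‖f‖ ≤ 2 / (c * δ ^ 2) := by
      rw [hf, norm_div]
      have : c * δ ^ 2 ≤ ‖1 - ψ‖ := le_trans (by gcongr) hden
      gcongr
      exact norm_one_sub_phase_le_two _
    have h1 : ‖1 - ψ ^ N‖ ≤ 2 := by
      refine (norm_sub_le _ _).trans ?_
      rw [norm_one]
      linarith
    refine (Complex.abs_re_le_norm _).trans ?_
    rw [norm_mul]
    have h5 : 0 ≤ (K + K) + 4 * C * ‖y‖ / c := by positivity
    calc _ ≤ 2 * (2 / (c * δ ^ 2)) := by gcongr
      _ = 4 / (c * δ ^ 2) := by ring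
      _ ≤ _ := by linarith

/-- The partial sums of the potential converge, by dominated convergence on the Fourier side. -/
lemma tendsto_sum_walkFourier (hF : IsFrequencyDomain w v F) (h : IsStandardStep w v)
    (hd : 0 < d) (y : EuclideanSpace ℝ (Fin d)) :
    Tendsto (fun N => ∑ k ∈ Finset.range N, (walkFourier w v F k 0 - walkFourier w v F k y)) atTop
      (𝓝 (potentialIntegral w v F y)) := by
  have hψ := continuous_stepChar (w := w) (v := v)
  simp_rw [hF.sum_walkFourier_sub]
  obtain ⟨K, hK⟩ := hF.exists_bound_partial_sum h y
  have hfin : IsFiniteMeasure ((volume : Measure (EuclideanSpace ℝ (Fin d))).restrict F) :=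
    isFiniteMeasure_restrict.mpr hF.compact.measure_lt_top.ne
  refine tendsto_integral_of_dominated_convergence (fun _ => K) (fun N => ?_)
    (integrable_const _) (fun N => ?_) ?_
  · have hm : Measurable (stepChar w v) := hψ.measurable
    exact Measurable.aestronglyMeasurable (by fun_prop)
  · exact (ae_restrict_iff' hF.measurableSet).mpr (ae_of_all _ fun η hη => hK N η hη)
  · refine ae_restrict_of_ae ((h.ae_norm_stepChar_lt_one hd).mono fun η hη => ?_)
    have h1 := tendsto_pow_atTop_nhds_zero_of_norm_lt_one hη
    have h2 := (((tendsto_const_nhds (x := (1 : ℂ))).sub h1).mul_const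
      ((1 - Complex.exp (-(inner ℝ y η : ℝ) * I)) / (1 - stepChar w v η)))
    rw [sub_zero, one_mul] at h2
    exact (Complex.continuous_re.tendsto _).comp h2

end IsFrequencyDomain

/-! ### The heat kernel at short times -/

/-- The Chernoff bound for the tail of a Poisson distribution. -/
lemma exp_sub_sum_le (s : ℝ) (hs : 0 ≤ s) (m : ℕ) :
    Real.exp s - ∑ k ∈ Finset.range m, s ^ k / (k.factorial : ℝ)
      ≤ Real.exp (-m) * Real.exp (Real.exp 1 * s) := by
  have hsum : ∀ r : ℝ, HasSum (fun k : ℕ => r ^ k / (k.factorial : ℝ)) (Real.exp r) := fun r => by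
    rw [Real.exp_eq_exp_ℝ]; exact NormedSpace.expSeries_div_hasSum_exp r
  have h1 := (hasSum_nat_add_iff' m).mpr (hsum s)
  have h2 := ((hasSum_nat_add_iff' m).mpr (hsum (Real.exp 1 * s))).mul_left (Real.exp (-m))
  refine (hasSum_le (fun k => ?_) h1 h2).trans ?_
  · rw [mul_pow, ← mul_div_assoc, ← mul_assoc, ← Real.exp_nat_mul, ← Real.exp_add]
    have : 1 ≤ Real.exp (-(m : ℝ) + (k + m : ℕ) * 1) := by
      refine Real.one_le_exp ?_
      push_cast
      have : (0 : ℝ) ≤ k := Nat.cast_nonneg k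
      linarith
    gcongr
    exact le_mul_of_one_le_left (by positivity) this
  · gcongr
    refine sub_le_self _ (Finset.sum_nonneg fun k _ => by positivity)

/-- If the walk cannot reach `y` in fewer than `m` steps, then the heat kernel at `y` is bounded
by the probability of at least `m` jumps up to time `t`. -/
lemma abs_heatKernel_le {F : Set (EuclideanSpace ℝ (Fin d))} (hF : IsFrequencyDomain w v F)
    (h : IsStandardStep w v) {m : ℕ} {y : EuclideanSpace ℝ (Fin d)}
    (hm : ∀ k < m, walkFourier w v F k y = 0) {t : ℝ} (ht : 0 ≤ t) :
    |heatKernel w v F t y| ≤ Real.exp (2 * t - m) * volume.real F := by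
  have hψ := continuous_stepChar (w := w) (v := v)
  have hzero : ∫ η in F, ∑ k ∈ Finset.range m, Real.exp (-t) * (t ^ k / (k.factorial : ℝ)) *
      (stepChar w v η ^ k * Complex.exp (-(inner ℝ y η : ℝ) * I)).re = 0 := by
    rw [integral_finsetSum _ fun k _ => hF.integrableOn_of_continuous (by fun_prop)]
    refine Finset.sum_eq_zero fun k hk => ?_
    rw [integral_const_mul]
    change _ * walkFourier w v F k y = 0
    rw [hm k (Finset.mem_range.mp hk), mul_zero]
  rw [heatKernel, ← sub_zero (∫ η in F, _), ← hzero,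
    ← integral_sub (hF.integrableOn_of_continuous (by fun_prop))
      (hF.integrableOn_of_continuous (by fun_prop)), ← Real.norm_eq_abs]
  refine norm_setIntegral_le_of_norm_le_const hF.compact.measure_lt_top fun η _ => ?_
  have e : (Complex.exp (-(t * (1 - stepChar w v η)) - (inner ℝ y η : ℝ) * I)).re -
      ∑ k ∈ Finset.range m, Real.exp (-t) * (t ^ k / (k.factorial : ℝ)) *
      (stepChar w v η ^ k * Complex.exp (-(inner ℝ y η : ℝ) * I)).re =
      (((Real.exp (-t) : ℝ) : ℂ) * Complex.exp ((-(inner ℝ y η) : ℝ) * I) *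
        (Complex.exp (t * stepChar w v η) - ∑ k ∈ Finset.range m,
          (t * stepChar w v η) ^ k / (k.factorial : ℂ))).re := by
    rw [mul_sub (((Real.exp (-t) : ℝ) : ℂ) * Complex.exp ((-(inner ℝ y η) : ℝ) * I)),
      Complex.sub_re, Finset.mul_sum, Complex.re_sum]
    congr 1
    · congr 1
      rw [Complex.ofReal_exp, ← Complex.exp_add, ← Complex.exp_add]
      congr 1
      push_cast
      ring
    · refine Finset.sum_congr rfl fun k _ => ?_
      rw [← Complex.re_ofReal_mul]
      congr 1
      push_cast
      ring
  rw [e, Real.norm_eq_abs]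
  refine (Complex.abs_re_le_norm _).trans ?_
  have hs : ‖(t : ℂ) * stepChar w v η‖ ≤ t := by
    rw [norm_mul, Complex.norm_real, Real.norm_eq_abs, abs_of_nonneg ht]
    exact mul_le_of_le_one_right ht (h.norm_stepChar_le_one η)
  rw [norm_mul, norm_mul, Complex.norm_exp_ofReal_mul_I, mul_one, Complex.norm_real,
    Real.norm_eq_abs, Real.abs_exp]
  calc _ ≤ Real.exp (-t) * (Real.exp (-m) * Real.exp (Real.exp 1 * t)) := by
        gcongr
        refine (Complex.norm_exp_sub_sum_le_exp_norm_sub_sum _ _).trans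
          ((exp_sub_sum_le _ (norm_nonneg _) m).trans ?_)
        gcongr
    _ = Real.exp (-t + (-m + Real.exp 1 * t)) := by rw [Real.exp_add, Real.exp_add]
    _ ≤ _ := by
        refine Real.exp_le_exp.mpr ?_
        have : Real.exp 1 ≤ 3 := Real.exp_one_lt_three.le
        nlinarith

end

/-! ### Time integrals of Gaussian terms -/

/-- Substituting `1 / t` in Euler's integral. -/
lemma integral_rpow_mul_exp_neg_div {a ρ : ℝ} (ha : 0 < a) (hρ : 0 < ρ) :
    IntegrableOn (fun t : ℝ => t ^ (-(a + 1)) * Real.exp (-(ρ / t))) (Set.Ioi 0) ∧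
    ∫ t in Set.Ioi (0 : ℝ), t ^ (-(a + 1)) * Real.exp (-(ρ / t)) = Real.Gamma a * ρ ^ (-a) := by
  have e : ∀ t ∈ Set.Ioi (0 : ℝ), (|(-1 : ℝ)| * t ^ ((-1 : ℝ) - 1)) •
      ((t ^ (-1 : ℝ)) ^ (a - 1) * Real.exp (-(ρ * t ^ (-1 : ℝ))))
      = t ^ (-(a + 1)) * Real.exp (-(ρ / t)) := by
    intro t ht
    have ht : 0 < t := ht
    rw [smul_eq_mul, ← Real.rpow_mul ht.le, abs_neg, abs_one, one_mul, ← mul_assoc,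
      ← Real.rpow_add ht, Real.rpow_neg_one, div_eq_mul_inv]
    congr 2
    ring
  constructor
  · have h := (integrableOn_Ioi_comp_rpow_iff (fun u : ℝ => u ^ (a - 1) * Real.exp (-(ρ * u)))
      (p := -1) (by norm_num)).mpr ?_
    · exact (integrableOn_congr_fun e measurableSet_Ioi).mp h
    · have := integrableOn_rpow_mul_exp_neg_mul_rpow (p := 1) (s := a - 1) (b := ρ) (by linarith)
        one_pos hρ
      simpa using this
  · rw [← setIntegral_congr_fun measurableSet_Ioi e, integral_comp_rpow_Ioi
      (fun u : ℝ => u ^ (a - 1) * Real.exp (-(ρ * u))) (p := -1) (by norm_num),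
      Real.integral_rpow_mul_exp_neg_mul_Ioi ha hρ, one_div, Real.inv_rpow hρ.le,
      ← Real.rpow_neg hρ.le, mul_comm]

/-- Comparing with the value at `ρ = 1` removes the divergence at infinity for `s ≤ 1`, so that
all dimensions can be treated at once. -/
lemma integral_rpow_mul_exp_sub_exp {s ρ : ℝ} (hs : 0 < s) (hρ : 0 < ρ) :
    IntegrableOn (fun t : ℝ => t ^ (-s) * (Real.exp (-(1 / t)) - Real.exp (-(ρ / t)))) (Set.Ioi 0) ∧
    ∫ t in Set.Ioi (0 : ℝ), t ^ (-s) * (Real.exp (-(1 / t)) - Real.exp (-(ρ / t)))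
      = ∫ σ in (1 : ℝ)..ρ, Real.Gamma s * σ ^ (-s) := by
  set m := min 1 ρ with hm
  have hm0 : 0 < m := lt_min one_pos hρ
  have hmem : ∀ σ ∈ Set.uIoc 1 ρ, m ≤ σ := fun σ hσ => hσ.1.le
  have hf : Integrable (Function.uncurry fun (σ t : ℝ) => t ^ (-(s + 1)) * Real.exp (-(σ / t)))
      ((volume.restrict (Set.uIoc 1 ρ)).prod (volume.restrict (Set.Ioi 0))) := by
    have hG := (integral_rpow_mul_exp_neg_div hs hm0).1
    have hfin : IsFiniteMeasure ((volume : Measure ℝ).restrict (Set.uIoc 1 ρ)) :=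
      isFiniteMeasure_restrict.mpr (by rw [Set.uIoc, Real.volume_Ioc]; exact ENNReal.ofReal_ne_top)
    refine (Integrable.comp_snd hG (volume.restrict (Set.uIoc 1 ρ))).mono' ?_ ?_
    · have : Measurable (Function.uncurry fun (σ t : ℝ) =>
          t ^ (-(s + 1)) * Real.exp (-(σ / t))) := by
        unfold Function.uncurry; fun_prop
      exact this.aestronglyMeasurable
    · rw [Measure.prod_restrict]
      refine (ae_restrict_iff' (measurableSet_uIoc.prod measurableSet_Ioi)).mpr (ae_of_all _ ?_)
      rintro ⟨σ, t⟩ ⟨hσ, ht⟩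
      have ht : 0 < t := ht
      have := hmem σ hσ
      simp only [Function.uncurry_apply_pair, norm_mul, Real.norm_eq_abs, Real.abs_exp]
      rw [abs_of_pos (by positivity)]
      gcongr
  have hinner : ∀ t ∈ Set.Ioi (0 : ℝ), ∫ σ in (1 : ℝ)..ρ, t ^ (-(s + 1)) * Real.exp (-(σ / t))
      = t ^ (-s) * (Real.exp (-(1 / t)) - Real.exp (-(ρ / t))) := by
    intro t ht
    have ht : 0 < t := ht
    have hd : ∀ σ ∈ Set.uIcc 1 ρ, HasDerivAt (fun σ => -(t ^ (-s) * Real.exp (-(σ / t))))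
        (t ^ (-(s + 1)) * Real.exp (-(σ / t))) σ := by
      intro σ _
      have h1 : HasDerivAt (fun σ => -(σ / t)) (-(1 / t)) σ :=
        ((hasDerivAt_id σ).div_const t).neg
      have h2 : HasDerivAt (fun σ => -(t ^ (-s) * Real.exp (-(σ / t)))) _ σ :=
        (h1.exp.const_mul (t ^ (-s))).neg
      refine h2.congr_deriv ?_
      have : t ^ (-(s + 1)) = t ^ (-s) * t⁻¹ := by
        rw [neg_add, Real.rpow_add ht, Real.rpow_neg_one]
      rw [this]
      ring
    rw [intervalIntegral.integral_eq_sub_of_hasDerivAt hd (by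
      apply Continuous.intervalIntegrable; fun_prop)]
    ring
  constructor
  · have h2 := hf.integral_prod_right
    have h3 : Integrable (fun t : ℝ => ∫ σ in (1 : ℝ)..ρ, t ^ (-(s + 1)) * Real.exp (-(σ / t)))
        (volume.restrict (Set.Ioi 0)) := by
      simp_rw [intervalIntegral.intervalIntegral_eq_integral_uIoc]
      exact (h2.smul (if (1 : ℝ) ≤ ρ then (1 : ℝ) else -1)).congr (ae_of_all _ fun t => rfl)
    exact (integrableOn_congr_fun hinner measurableSet_Ioi).mp h3
  · rw [← setIntegral_congr_fun measurableSet_Ioi hinner, ← intervalIntegral_integral_swap hf]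
    refine intervalIntegral.integral_congr_ae (ae_of_all _ fun σ hσ => ?_)
    exact (integral_rpow_mul_exp_neg_div hs (hm0.trans_le (hmem σ hσ))).2

/-- The coefficient of `radialProfile d r` in `∫ σ in 1..r² / 2, Γ(d / 2) σ ^ (-d / 2)`. -/
noncomputable def profileConst (d : ℕ) : ℝ :=
  if d = 2 then 2 else -((2 : ℝ) ^ ((d : ℝ) / 2 - 1) * Real.Gamma ((d : ℝ) / 2 - 1))

lemma exists_integral_leading (d : ℕ) : ∃ b : ℝ, ∀ r : ℝ, 0 < r →
    ∫ σ in (1 : ℝ)..(r ^ 2 / 2), Real.Gamma ((d : ℝ) / 2) * σ ^ (-((d : ℝ) / 2))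
      = profileConst d * radialProfile d r + b := by
  have hnot : ∀ r : ℝ, 0 < r → (0 : ℝ) ∉ Set.uIcc 1 (r ^ 2 / 2) := by
    intro r hr h
    have : 0 < min 1 (r ^ 2 / 2) := by positivity
    exact absurd h.1 (not_le.mpr this)
  by_cases hd : d = 2
  · subst hd
    refine ⟨-Real.log 2, fun r hr => ?_⟩
    have e : ((2 : ℕ) : ℝ) / 2 = 1 := by norm_num
    simp only [e, Real.Gamma_one, one_mul, Real.rpow_neg_one, profileConst, radialProfile, if_true]
    rw [integral_inv_of_pos one_pos (by positivity), div_one, Real.log_div (by positivity)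
      (by norm_num), Real.log_pow]
    push_cast
    ring
  · refine ⟨Real.Gamma ((d : ℝ) / 2 - 1), fun r hr => ?_⟩
    have hd' : (d : ℝ) ≠ 2 := by exact_mod_cast hd
    have hs : (d : ℝ) / 2 - 1 ≠ 0 := fun h => hd' (by linarith)
    have hs' : -((d : ℝ) / 2) + 1 ≠ 0 := fun h => hd' (by linarith)
    have hΓ : Real.Gamma ((d : ℝ) / 2) = ((d : ℝ) / 2 - 1) * Real.Gamma ((d : ℝ) / 2 - 1) := by
      rw [← Real.Gamma_add_one hs, sub_add_cancel]
    rw [intervalIntegral.integral_const_mul, integral_rpow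
      (Or.inr ⟨fun h => hs' (by linarith), hnot r hr⟩), Real.one_rpow, hΓ, profileConst,
      radialProfile, if_neg hd, if_neg hd]
    have h1 : (r ^ 2 / 2) ^ (-((d : ℝ) / 2) + 1) = 2 ^ ((d : ℝ) / 2 - 1) * r ^ (2 - (d : ℤ)) := by
      rw [Real.div_rpow (by positivity) (by norm_num), ← Real.rpow_natCast r 2,
        ← Real.rpow_mul hr.le, ← Real.rpow_intCast r, div_eq_mul_inv,
        ← Real.rpow_neg (by norm_num : (0 : ℝ) ≤ 2), mul_comm]
      push_cast
      congr 2 <;> ring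
    rw [h1]
    have h2 : ((d : ℝ) / 2 - 1) / (-((d : ℝ) / 2) + 1) = -1 := by
      rw [div_eq_iff hs']; ring
    calc ((d : ℝ) / 2 - 1) * Real.Gamma ((d : ℝ) / 2 - 1) *
          ((2 ^ ((d : ℝ) / 2 - 1) * r ^ (2 - (d : ℤ)) - 1) / (-((d : ℝ) / 2) + 1))
        = (((d : ℝ) / 2 - 1) / (-((d : ℝ) / 2) + 1)) * (Real.Gamma ((d : ℝ) / 2 - 1) *
          (2 ^ ((d : ℝ) / 2 - 1) * r ^ (2 - (d : ℤ)) - 1)) := by ring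
      _ = _ := by rw [h2]; ring

lemma abs_monoFn_le {d : ℕ} (β : Fin d → ℕ) (y : EuclideanSpace ℝ (Fin d)) :
    |monoFn β y| ≤ ‖y‖ ^ (∑ l, β l) := by
  rw [monoFn, Finset.abs_prod, ← Finset.prod_pow_eq_pow_sum]
  refine Finset.prod_le_prod (fun _ _ => abs_nonneg _) fun l _ => ?_
  rw [abs_pow]
  gcongr
  simpa using PiLp.norm_apply_le y l

/-- The polynomial `∑ X_l ^ 2`, whose value is the square of the norm. -/
noncomputable def normSqPoly (d : ℕ) : MvPolynomial (Fin d) ℝ := ∑ l, MvPolynomial.X l ^ 2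

lemma eval_normSqPoly {d : ℕ} (y : EuclideanSpace ℝ (Fin d)) :
    MvPolynomial.eval y.ofLp (normSqPoly d) = ‖y‖ ^ 2 := by
  simp [normSqPoly, EuclideanSpace.norm_sq_eq]

lemma pow_two_mul_rpow_neg_half {d k : ℕ} {r : ℝ} (hr : 0 < r) :
    (r ^ 2 / 2) ^ (-((d : ℝ) / 2 + k)) = 2 ^ ((d : ℝ) / 2 + k) / r ^ (d + 2 * k) := by
  have h1 : (r ^ 2) ^ (-((d : ℝ) / 2 + k)) = (r ^ (d + 2 * k))⁻¹ := by
    rw [← Real.rpow_natCast r 2, ← Real.rpow_mul hr.le, ← Real.rpow_natCast r (d + 2 * k),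
      ← Real.rpow_neg hr.le]
    congr 1
    push_cast
    ring
  rw [Real.div_rpow (by positivity) (by norm_num), h1, Real.rpow_neg (by norm_num),
    div_inv_eq_mul, inv_mul_eq_div]

/-- A correction term `y ^ β t ^ (-(d / 2 + 1 + k)) exp (-|y|² / 2t)` integrates to a multiple of
`y ^ β / |y| ^ (d + 2 k)`, and `|β| ≤ 2 k + 1` makes this `O(|y| ^ (1 - d))`. Different
values of `k` give exponents `d + 2 k` of the same parity, so that powers of the polynomial `|y|²`
bring them to a common denominator. -/
lemma gaussTail_integral {d : ℕ} (hd : 0 < d) {H : ℝ → EuclideanSpace ℝ (Fin d) → ℝ}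
    (hH : H ∈ gaussTail d) :
    (∀ y, y ≠ 0 → IntegrableOn (fun t => H t y) (Set.Ioi 0)) ∧
    (∃ (Q : MvPolynomial (Fin d) ℝ) (e : ℕ), ∀ y, y ≠ 0 →
      ∫ t in Set.Ioi (0 : ℝ), H t y = MvPolynomial.eval y.ofLp Q / ‖y‖ ^ (d + 2 * e)) ∧
    ∀ δ > 0, ∃ C : ℝ, ∀ y, δ ≤ ‖y‖ →
      |∫ t in Set.Ioi (0 : ℝ), H t y| ≤ C * ‖y‖ ^ (1 - (d : ℤ)) := by
  have hd' : (0 : ℝ) < d := by exact_mod_cast hd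
  refine Submodule.span_induction (p := fun H _ =>
    (∀ y, y ≠ 0 → IntegrableOn (fun t => H t y) (Set.Ioi 0)) ∧
    (∃ (Q : MvPolynomial (Fin d) ℝ) (e : ℕ), ∀ y, y ≠ 0 →
      ∫ t in Set.Ioi (0 : ℝ), H t y = MvPolynomial.eval y.ofLp Q / ‖y‖ ^ (d + 2 * e)) ∧
    ∀ δ > 0, ∃ C : ℝ, ∀ y, δ ≤ ‖y‖ →
      |∫ t in Set.Ioi (0 : ℝ), H t y| ≤ C * ‖y‖ ^ (1 - (d : ℤ))) ?_ ?_ ?_ ?_ hH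
  · rintro _ ⟨β, k, hβ, rfl⟩
    have hk : (0 : ℝ) < (d : ℝ) / 2 + k := by positivity
    have hdk : (d : ℝ) / 2 + 1 + k = ((d : ℝ) / 2 + k) + 1 := by ring
    have hval : ∀ y : EuclideanSpace ℝ (Fin d), y ≠ 0 →
        ∫ t in Set.Ioi (0 : ℝ), monoFn β y * (t ^ (-((d : ℝ) / 2 + 1 + k)) *
          Real.exp (-(‖y‖ ^ 2 / 2 / t))) =
        (Real.Gamma ((d : ℝ) / 2 + k) * 2 ^ ((d : ℝ) / 2 + k)) *
            (monoFn β y / ‖y‖ ^ (d + 2 * k)) := by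
      intro y hy
      have hy' : 0 < ‖y‖ := norm_pos_iff.mpr hy
      rw [integral_const_mul, hdk, (integral_rpow_mul_exp_neg_div hk (by positivity)).2,
        pow_two_mul_rpow_neg_half hy']
      ring
    refine ⟨fun y hy => ?_, ⟨MvPolynomial.C (Real.Gamma ((d : ℝ) / 2 + k) * 2 ^ ((d : ℝ) / 2 + k)) *
      ∏ l, MvPolynomial.X l ^ β l, k, fun y hy => ?_⟩, fun δ hδ => ?_⟩
    · have hy' : 0 < ‖y‖ := norm_pos_iff.mpr hy
      rw [hdk]
      exact (integral_rpow_mul_exp_neg_div hk (by positivity)).1.const_mul _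
    · rw [hval y hy]
      simp only [map_mul, MvPolynomial.eval_C, map_prod, map_pow, MvPolynomial.eval_X, monoFn]
      ring
    · set c := Real.Gamma ((d : ℝ) / 2 + k) * 2 ^ ((d : ℝ) / 2 + k) with hc
      refine ⟨|c| * δ⁻¹ ^ (2 * k + 1 - ∑ l, β l), fun y hy => ?_⟩
      have hy' : 0 < ‖y‖ := hδ.trans_le hy
      have hyδ : 1 ≤ δ⁻¹ * ‖y‖ := by rw [inv_mul_eq_div, one_le_div hδ]; exact hy
      rw [hval y (norm_pos_iff.mp hy'), abs_mul, mul_assoc]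
      gcongr
      rw [abs_div, abs_of_pos (by positivity : 0 < ‖y‖ ^ (d + 2 * k)), div_le_iff₀ (by positivity)]
      have h1 : ‖y‖ ^ (1 - (d : ℤ)) * ‖y‖ ^ (d + 2 * k) = ‖y‖ ^ (2 * k + 1) := by
        rw [← zpow_natCast, ← zpow_natCast, ← zpow_add₀ hy'.ne']
        congr 1
        push_cast
        ring
      rw [mul_assoc, h1]
      calc |monoFn β y| ≤ ‖y‖ ^ (∑ l, β l) * 1 := by rw [mul_one]; exact abs_monoFn_le β y
        _ ≤ ‖y‖ ^ (∑ l, β l) * (δ⁻¹ * ‖y‖) ^ (2 * k + 1 - ∑ l, β l) := by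
            gcongr
            exact one_le_pow₀ hyδ
        _ = δ⁻¹ ^ (2 * k + 1 - ∑ l, β l) * (‖y‖ ^ (∑ l, β l) * ‖y‖ ^ (2 * k + 1 - ∑ l, β l)) := by
            rw [mul_pow]; ring
        _ = _ := by rw [← pow_add, Nat.add_sub_cancel' hβ]
  · refine ⟨fun y _ => by simp, ⟨0, 0, fun y _ => by simp⟩, fun δ _ => ⟨0, fun y _ => by simp⟩⟩
  · rintro F G _ _ ⟨hFi, ⟨Q, e, hQ⟩, hFb⟩ ⟨hGi, ⟨Q', e', hQ'⟩, hGb⟩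
    have hadd : ∀ y, y ≠ 0 → ∫ t in Set.Ioi (0 : ℝ), (F + G) t y =
        (∫ t in Set.Ioi (0 : ℝ), F t y) + ∫ t in Set.Ioi (0 : ℝ), G t y := fun y hy =>
      integral_add (hFi y hy) (hGi y hy)
    refine ⟨fun y hy => (hFi y hy).add (hGi y hy),
      ⟨Q * normSqPoly d ^ e' + Q' * normSqPoly d ^ e, e + e', fun y hy => ?_⟩, fun δ hδ => ?_⟩
    · have hy' : ‖y‖ ≠ 0 := norm_ne_zero_iff.mpr hy
      rw [hadd y hy, hQ y hy, hQ' y hy]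
      simp only [map_add, map_mul, map_pow, eval_normSqPoly]
      rw [div_add_div _ _ (by positivity) (by positivity), div_eq_div_iff (by positivity)
        (by positivity)]
      ring
    · obtain ⟨C, hC⟩ := hFb δ hδ
      obtain ⟨C', hC'⟩ := hGb δ hδ
      refine ⟨C + C', fun y hy => ?_⟩
      rw [hadd y (norm_pos_iff.mp (hδ.trans_le hy)), add_mul]
      exact (abs_add_le _ _).trans (add_le_add (hC y hy) (hC' y hy))
  · rintro c F _ ⟨hFi, ⟨Q, e, hQ⟩, hFb⟩
    have hmul : ∀ y, ∫ t in Set.Ioi (0 : ℝ), (c • F) t y = c * ∫ t in Set.Ioi (0 : ℝ), F t y :=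
      fun y => integral_const_mul _ _
    refine ⟨fun y hy => (hFi y hy).const_mul c, ⟨MvPolynomial.C c * Q, e, fun y hy => ?_⟩,
      fun δ hδ => ?_⟩
    · rw [hmul, hQ y hy, map_mul, MvPolynomial.eval_C]
      ring
    · obtain ⟨C, hC⟩ := hFb δ hδ
      refine ⟨|c| * C, fun y hy => ?_⟩
      rw [hmul, abs_mul, mul_assoc]
      have := hC y hy
      gcongr

/-- For `t` up to a multiple of `x`, the Gaussian factor is smaller than any power of `x`. -/
lemma exists_rpow_mul_exp_le {a ε : ℝ} (ha : 0 ≤ a) (hε : 0 < ε) (K : ℕ) :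
    ∃ C : ℝ, 0 ≤ C ∧ ∀ x : ℝ, 1 ≤ x → ∀ t ∈ Set.Ioc 0 (ε * x),
      t ^ (-a) * Real.exp (-(x ^ 2 / 2 / t)) ≤ C * (x ^ K)⁻¹ := by
  obtain ⟨n, hn⟩ := exists_nat_ge (a + K)
  have hK : (0 : ℝ) ≤ K := Nat.cast_nonneg K
  refine ⟨n.factorial * 2 ^ n * ε ^ ((n : ℝ) - a), by positivity, fun x hx t ht => ?_⟩
  obtain ⟨ht0, ht1⟩ := ht
  have hx0 : 0 < x := by linarith
  have h1 := Real.pow_div_factorial_le_exp (x := x ^ 2 / 2 / t) (by positivity) n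
  have h2 : Real.exp (-(x ^ 2 / 2 / t)) ≤ n.factorial * 2 ^ n * (t ^ n * (x ^ (2 * n))⁻¹) := by
    rw [Real.exp_neg]
    refine (inv_anti₀ (by positivity) h1).trans (le_of_eq ?_)
    rw [div_div, div_pow, mul_pow, pow_mul]
    field_simp
  have h3 : t ^ (-a) * t ^ n = t ^ ((n : ℝ) - a) := by
    rw [← Real.rpow_natCast t n, ← Real.rpow_add ht0]
    ring_nf
  calc t ^ (-a) * Real.exp (-(x ^ 2 / 2 / t))
      ≤ t ^ (-a) * (n.factorial * 2 ^ n * (t ^ n * (x ^ (2 * n))⁻¹)) := by gcongr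
    _ = n.factorial * 2 ^ n * (x ^ (2 * n))⁻¹ * t ^ ((n : ℝ) - a) := by rw [← h3]; ring
    _ ≤ n.factorial * 2 ^ n * (x ^ (2 * n))⁻¹ * (ε * x) ^ ((n : ℝ) - a) := by
        gcongr
        linarith
    _ = n.factorial * 2 ^ n * ε ^ ((n : ℝ) - a) *
        (x ^ (-((2 * n : ℕ) : ℝ)) * x ^ ((n : ℝ) - a)) := by
        rw [Real.mul_rpow hε.le hx0.le, Real.rpow_neg hx0.le, Real.rpow_natCast]; ring
    _ ≤ n.factorial * 2 ^ n * ε ^ ((n : ℝ) - a) * x ^ (-(K : ℝ)) := by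
        rw [← Real.rpow_add hx0]
        gcongr
        push_cast
        linarith
    _ = _ := by rw [Real.rpow_neg hx0.le, Real.rpow_natCast]

lemma gaussTail_short_time {d : ℕ} {H : ℝ → EuclideanSpace ℝ (Fin d) → ℝ}
    (hH : H ∈ gaussTail d) {ε : ℝ} (hε : 0 < ε) (K : ℕ) :
    ∃ C : ℝ, 0 ≤ C ∧ ∀ y, 1 ≤ ‖y‖ → ∀ t ∈ Set.Ioc 0 (ε * ‖y‖), |H t y| ≤ C * (‖y‖ ^ K)⁻¹ := by
  refine Submodule.span_induction (p := fun H _ => ∃ C : ℝ, 0 ≤ C ∧ ∀ y, 1 ≤ ‖y‖ →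
    ∀ t ∈ Set.Ioc 0 (ε * ‖y‖), |H t y| ≤ C * (‖y‖ ^ K)⁻¹) ?_ ?_ ?_ ?_ hH
  · rintro _ ⟨β, k, -, rfl⟩
    obtain ⟨C, hC, hb⟩ := exists_rpow_mul_exp_le (a := (d : ℝ) / 2 + 1 + k) (by positivity) hε
      (∑ l, β l + K)
    refine ⟨C, hC, fun y hy t ht => ?_⟩
    have ht0 : 0 < t := ht.1
    have hy0 : 0 < ‖y‖ := by linarith
    rw [abs_mul, abs_of_nonneg (a := _ * Real.exp _) (by positivity)]
    calc _ ≤ ‖y‖ ^ (∑ l, β l) * (C * (‖y‖ ^ (∑ l, β l + K))⁻¹) := by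
          have := hb ‖y‖ hy t ht
          have := abs_monoFn_le β y
          gcongr
      _ = _ := by rw [pow_add]; field_simp
  · exact ⟨0, le_rfl, fun y _ t _ => by simp⟩
  · rintro F G _ _ ⟨C, hC, hF⟩ ⟨C', hC', hG⟩
    refine ⟨C + C', by positivity, fun y hy t ht => ?_⟩
    rw [add_mul]
    exact (abs_add_le _ _).trans (add_le_add (hF y hy t ht) (hG y hy t ht))
  · rintro c F _ ⟨C, hC, hF⟩
    refine ⟨|c| * C, by positivity, fun y hy t ht => ?_⟩
    rw [Pi.smul_apply, Pi.smul_apply, smul_eq_mul, abs_mul, mul_assoc]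
    have := hF y hy t ht
    gcongr

/-! ### The expansion of the potential -/

section
variable {d : ℕ} {ι : Type*} [Fintype ι] {w : ι → ℝ} {v : ι → EuclideanSpace ℝ (Fin d)}
  {F : Set (EuclideanSpace ℝ (Fin d))}

/-- The heat kernel of Brownian motion, with the normalization of `heatKernel`. -/
noncomputable def gaussLead (d : ℕ) (t : ℝ) (y : EuclideanSpace ℝ (Fin d)) : ℝ :=
  (2 * Real.pi) ^ ((d : ℝ) / 2) * (t ^ (-((d : ℝ) / 2)) * Real.exp (-(‖y‖ ^ 2 / 2 / t)))

lemma continuous_heatKernel (hF : IsFrequencyDomain w v F) (y : EuclideanSpace ℝ (Fin d)) :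
    Continuous fun t => heatKernel w v F t y := by
  have hψ := continuous_stepChar (w := w) (v := v)
  refine continuous_parametric_integral_of_continuous (f := fun (t : ℝ) η =>
    (Complex.exp (-(t * (1 - stepChar w v η)) - (inner ℝ y η : ℝ) * I)).re) ?_ hF.compact
  unfold Function.uncurry
  fun_prop

lemma integrableOn_inv_pow {N : ℕ} (hN : 2 ≤ N) {T : ℝ} (hT : 0 < T) :
    IntegrableOn (fun t : ℝ => (t ^ N)⁻¹) (Set.Ioi T) := by
  have hN' : (2 : ℝ) ≤ N := by exact_mod_cast hN
  refine (integrableOn_congr_fun (fun t ht => ?_) measurableSet_Ioi).mp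
    (integrableOn_Ioi_rpow_of_lt (a := -(N : ℝ)) (by linarith) hT)
  have ht0 : 0 < t := hT.trans ht
  rw [Real.rpow_neg ht0.le, Real.rpow_natCast]

lemma integral_inv_pow_le {N : ℕ} (hN : 2 ≤ N) {T : ℝ} (hT : 0 < T) :
    ∫ t in Set.Ioi T, (t ^ N)⁻¹ ≤ (T ^ (N - 1))⁻¹ := by
  have hN' : (2 : ℝ) ≤ N := by exact_mod_cast hN
  have e : ∫ t in Set.Ioi T, (t ^ N)⁻¹ = ∫ t in Set.Ioi T, t ^ (-(N : ℝ)) := by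
    refine setIntegral_congr_fun measurableSet_Ioi fun t ht => ?_
    have ht0 : 0 < t := hT.trans ht
    rw [Real.rpow_neg ht0.le, Real.rpow_natCast]
  rw [e, integral_Ioi_rpow_of_lt (by linarith) hT]
  have h1 : T ^ (-(N : ℝ) + 1) = (T ^ (N - 1))⁻¹ := by
    rw [← Real.rpow_natCast T (N - 1), ← Real.rpow_neg hT.le, Nat.cast_sub (by omega)]
    congr 1
    push_cast
    ring
  rw [h1, neg_div, ← div_neg, neg_add, neg_neg]
  refine div_le_self (by positivity) ?_
  linarith

lemma integrableOn_of_bound_Ioi_one {f : ℝ → ℝ} (h0 : IntegrableOn f (Set.Ioc 0 1)) {N : ℕ}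
    (hN : 2 ≤ N) {C : ℝ} (hf : AEStronglyMeasurable f (volume.restrict (Set.Ioi 1)))
    (hb : ∀ t : ℝ, 1 ≤ t → |f t| ≤ C * (t ^ N)⁻¹) : IntegrableOn f (Set.Ioi 0) := by
  rw [← Set.Ioc_union_Ioi_eq_Ioi (zero_le_one' ℝ)]
  refine h0.union (((integrableOn_inv_pow hN one_pos).const_mul C).mono' hf ?_)
  exact (ae_restrict_iff' measurableSet_Ioi).mpr (ae_of_all _ fun t ht => hb t (le_of_lt ht))

lemma gaussLead_integrableOn_Ioc {y : EuclideanSpace ℝ (Fin d)} (hd : 0 < d) (hy : y ≠ 0) :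
    IntegrableOn (fun t => gaussLead d t y) (Set.Ioc 0 1) := by
  have hd' : (0 : ℝ) < d := by exact_mod_cast hd
  have hy' : 0 < ‖y‖ := norm_pos_iff.mpr hy
  have h := (integral_rpow_mul_exp_neg_div (a := (d : ℝ) / 2) (ρ := ‖y‖ ^ 2 / 2) (by positivity)
    (by positivity)).1.mono_set (Set.Ioc_subset_Ioi_self : Set.Ioc (0 : ℝ) 1 ⊆ _)
  refine Integrable.mono' (h.const_mul ((2 * Real.pi) ^ ((d : ℝ) / 2))) ?_ ?_
  · refine Measurable.aestronglyMeasurable ?_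
    unfold gaussLead
    fun_prop
  · refine (ae_restrict_iff' measurableSet_Ioc).mpr (ae_of_all _ fun t ht => ?_)
    have ht0 : 0 < t := ht.1
    rw [gaussLead, Real.norm_eq_abs, abs_of_nonneg (by positivity)]
    gcongr ?_ * (?_ * ?_)
    exact Real.rpow_le_rpow_of_exponent_ge ht0 ht.2 (by linarith)

lemma integrableOn_remainder (hF : IsFrequencyDomain w v F) (hd : 0 < d)
    {H : ℝ → EuclideanSpace ℝ (Fin d) → ℝ} (hH : H ∈ gaussTail d) {N : ℕ} (hN : 2 ≤ N) {C : ℝ}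
    (hb : ∀ t : ℝ, 1 ≤ t → ∀ y, |heatKernel w v F t y - (gaussLead d t y + H t y)| ≤ C * (t ^ N)⁻¹)
    {y : EuclideanSpace ℝ (Fin d)} (hy : y ≠ 0) :
    IntegrableOn (fun t => heatKernel w v F t y - (gaussLead d t y + H t y)) (Set.Ioi 0) := by
  have hHi := (gaussTail_integral hd hH).1 y hy
  have hp := continuous_heatKernel hF y
  refine integrableOn_of_bound_Ioi_one ?_ hN ?_ fun t ht => hb t ht y
  · refine Integrable.sub (hp.integrableOn_Ioc)
      (Integrable.add (gaussLead_integrableOn_Ioc hd hy) ?_)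
    exact hHi.mono_set Set.Ioc_subset_Ioi_self
  · refine hp.aestronglyMeasurable.sub (AEStronglyMeasurable.add ?_ ?_)
    · refine Measurable.aestronglyMeasurable ?_
      unfold gaussLead
      fun_prop
    · exact (hHi.mono_set (Set.Ioi_subset_Ioi zero_le_one)).aestronglyMeasurable

/-- The constant of the expansion, up to the constant coming from `exists_integral_leading`. The
value `1` in the exponent is arbitrary: subtracting the leading term at a point with `|y|² / 2 = 1`
makes the integral converge at both ends, in every dimension. -/
noncomputable def heatConst (w : ι → ℝ) (v : ι → EuclideanSpace ℝ (Fin d))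
    (F : Set (EuclideanSpace ℝ (Fin d))) : ℝ :=
  ∫ t in Set.Ioi (0 : ℝ), (heatKernel w v F t 0 -
    (2 * Real.pi) ^ ((d : ℝ) / 2) * (t ^ (-((d : ℝ) / 2)) * Real.exp (-(1 / t))))

/-- Splitting the time integral of `heatKernel t 0 - heatKernel t y` into the constant, the leading
term, the corrections and the remainder. -/
lemma potentialIntegral_eq (hF : IsFrequencyDomain w v F) (h : IsStandardStep w v) (hd : 0 < d)
    {H : ℝ → EuclideanSpace ℝ (Fin d) → ℝ} (hH : H ∈ gaussTail d) {N : ℕ} (hN : 2 ≤ N) {C : ℝ}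
    (hb : ∀ t : ℝ, 1 ≤ t → ∀ y, |heatKernel w v F t y - (gaussLead d t y + H t y)| ≤ C * (t ^ N)⁻¹)
    {y : EuclideanSpace ℝ (Fin d)} (hy : y ≠ 0) :
    potentialIntegral w v F y = heatConst w v F + (2 * Real.pi) ^ ((d : ℝ) / 2) *
        (∫ σ in (1 : ℝ)..(‖y‖ ^ 2 / 2), Real.Gamma ((d : ℝ) / 2) * σ ^ (-((d : ℝ) / 2)))
      - (∫ t in Set.Ioi (0 : ℝ), H t y)
      - ∫ t in Set.Ioi (0 : ℝ), (heatKernel w v F t y - (gaussLead d t y + H t y)) := by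
  have hd' : (0 : ℝ) < d := by exact_mod_cast hd
  have hy' : 0 < ‖y‖ := norm_pos_iff.mpr hy
  obtain ⟨hDi, hD⟩ := hF.potential_eq_integral_heat h y
  have hHi := (gaussTail_integral hd hH).1 y hy
  have hRi := integrableOn_remainder hF hd hH hN hb hy
  obtain ⟨hJi, hJ⟩ := integral_rpow_mul_exp_sub_exp (s := (d : ℝ) / 2) (ρ := ‖y‖ ^ 2 / 2)
    (by positivity) (by positivity)
  have hJi' := hJi.const_mul ((2 * Real.pi) ^ ((d : ℝ) / 2))
  have e : heatConst w v F = ∫ t in Set.Ioi (0 : ℝ),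
      ((((heatKernel w v F t 0 - heatKernel w v F t y) - (2 * Real.pi) ^ ((d : ℝ) / 2) *
        (t ^ (-((d : ℝ) / 2)) * (Real.exp (-(1 / t)) - Real.exp (-(‖y‖ ^ 2 / 2 / t))))) + H t y)
        + (heatKernel w v F t y - (gaussLead d t y + H t y))) := by
    rw [heatConst]
    congr 1
    ext t
    rw [gaussLead]
    ring
  rw [e]
  have i1 : IntegrableOn (fun t => (heatKernel w v F t 0 - heatKernel w v F t y) -
      (2 * Real.pi) ^ ((d : ℝ) / 2) *
        (t ^ (-((d : ℝ) / 2)) * (Real.exp (-(1 / t)) - Real.exp (-(‖y‖ ^ 2 / 2 / t)))))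
      (Set.Ioi 0) := hDi.sub hJi'
  have i2 : IntegrableOn (fun t => ((heatKernel w v F t 0 - heatKernel w v F t y) -
      (2 * Real.pi) ^ ((d : ℝ) / 2) *
        (t ^ (-((d : ℝ) / 2)) * (Real.exp (-(1 / t)) - Real.exp (-(‖y‖ ^ 2 / 2 / t))))) + H t y)
      (Set.Ioi 0) := i1.add hHi
  rw [integral_add i2 hRi, integral_add i1 hHi, integral_sub hDi hJi',
    integral_const_mul, hJ, hD]
  ring

/-- For `t ≤ |y| / 4B` each of the three terms of the remainder is small by itself: a walk with
steps of length at most `B` needs `|y| / B` steps to reach `y`. -/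
lemma exists_remainder_short_time (hF : IsFrequencyDomain w v F) (h : IsStandardStep w v)
    {H : ℝ → EuclideanSpace ℝ (Fin d) → ℝ} (hH : H ∈ gaussTail d) {B : ℝ} (hB : 0 < B) (K : ℕ) :
    ∃ C : ℝ, 0 ≤ C ∧ ∀ y : EuclideanSpace ℝ (Fin d), 1 ≤ ‖y‖ →
      (∀ k : ℕ, k * B < ‖y‖ → walkFourier w v F k y = 0) →
      ∀ t ∈ Set.Ioc 0 (1 / (4 * B) * ‖y‖),
        |heatKernel w v F t y - (gaussLead d t y + H t y)| ≤ C * (‖y‖ ^ K)⁻¹ := by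
  have hε : 0 < 1 / (4 * B) := by positivity
  obtain ⟨C1, hC1, h1⟩ := gaussTail_short_time hH hε K
  obtain ⟨C2, hC2, h2⟩ := exists_rpow_mul_exp_le (a := (d : ℝ) / 2) (by positivity) hε K
  refine ⟨K.factorial * (2 * B) ^ K * volume.real F + ((2 * Real.pi) ^ ((d : ℝ) / 2) * C2 + C1),
    by positivity, fun y hy hvan t ht => ?_⟩
  have ht0 : 0 < t := ht.1
  have hy0 : 0 < ‖y‖ := by linarith
  have hp : |heatKernel w v F t y| ≤ K.factorial * (2 * B) ^ K * volume.real F * (‖y‖ ^ K)⁻¹ := by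
    have hm : ∀ k < ⌈‖y‖ / B⌉₊, walkFourier w v F k y = 0 := by
      intro k hk
      refine hvan k ?_
      rw [← lt_div_iff₀ hB]
      exact Nat.lt_ceil.mp hk
    refine (abs_heatKernel_le hF h hm ht0.le).trans ?_
    have hexp : Real.exp (2 * t - ⌈‖y‖ / B⌉₊) ≤ K.factorial * (2 * B) ^ K * (‖y‖ ^ K)⁻¹ := by
      have h3 : 2 * t - ⌈‖y‖ / B⌉₊ ≤ -(‖y‖ / (2 * B)) := by
        have h4 := Nat.le_ceil (‖y‖ / B)
        have h5 := ht.2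
        have h6 : 1 / (4 * B) * ‖y‖ = ‖y‖ / B / 4 := by field_simp
        have h7 : ‖y‖ / (2 * B) = ‖y‖ / B / 2 := by field_simp
        rw [h6] at h5
        rw [h7]
        linarith
      have h8 := Real.pow_div_factorial_le_exp (x := ‖y‖ / (2 * B)) (by positivity) K
      calc _ ≤ Real.exp (-(‖y‖ / (2 * B))) := Real.exp_le_exp.mpr h3
        _ ≤ ((‖y‖ / (2 * B)) ^ K / K.factorial)⁻¹ := by
            rw [Real.exp_neg]
            exact inv_anti₀ (by positivity) h8
        _ = _ := by rw [div_pow]; field_simp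
    calc _ ≤ K.factorial * (2 * B) ^ K * (‖y‖ ^ K)⁻¹ * volume.real F := by gcongr
      _ = _ := by ring
  have hg : |gaussLead d t y| ≤ (2 * Real.pi) ^ ((d : ℝ) / 2) * C2 * (‖y‖ ^ K)⁻¹ := by
    rw [gaussLead, abs_of_nonneg (by positivity), mul_assoc]
    have := h2 ‖y‖ hy t ht
    gcongr
  have hH' := h1 y hy t ht
  calc _ ≤ _ := abs_sub _ _
    _ ≤ _ := add_le_add hp ((abs_add_le _ _).trans (add_le_add hg hH'))
    _ = _ := by ring

/-- The integral of the remainder is small: at short times because the walk needs at least a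
multiple of `|y|` steps to reach `y`, at long times by the local expansion. -/
lemma exists_remainder_bound (hF : IsFrequencyDomain w v F) (h : IsStandardStep w v) (hd : 0 < d)
    {H : ℝ → EuclideanSpace ℝ (Fin d) → ℝ} (hH : H ∈ gaussTail d) {B : ℝ} (hB : 0 < B) {K : ℕ}
    (hK : 0 < K) {C : ℝ} (hC : 0 ≤ C)
    (hb : ∀ t : ℝ, 1 ≤ t → ∀ y,
      |heatKernel w v F t y - (gaussLead d t y + H t y)| ≤ C * (t ^ (K + 1))⁻¹) :
    ∃ C' : ℝ, 0 ≤ C' ∧ ∀ y : EuclideanSpace ℝ (Fin d), 1 + 4 * B ≤ ‖y‖ →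
      (∀ k : ℕ, k * B < ‖y‖ → walkFourier w v F k y = 0) →
      |∫ t in Set.Ioi (0 : ℝ), (heatKernel w v F t y - (gaussLead d t y + H t y))|
        ≤ C' * (‖y‖ ^ K)⁻¹ := by
  obtain ⟨C1, hC1, h1⟩ := exists_remainder_short_time hF h hH hB (K + 1)
  refine ⟨C1 * (1 / (4 * B)) + C * (4 * B) ^ K, by positivity, fun y hy hvan => ?_⟩
  have hy1 : 1 ≤ ‖y‖ := by linarith
  have hy0 : 0 < ‖y‖ := by linarith
  set T := 1 / (4 * B) * ‖y‖ with hT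
  have hT0 : 0 < T := by positivity
  -- the local expansion holds from time `1` on, hence the condition on `‖y‖`
  have hT1 : 1 ≤ T := by
    rw [hT, one_div_mul_eq_div, one_le_div (by positivity)]
    linarith
  have hRi := integrableOn_remainder hF hd hH (by omega) hb (norm_pos_iff.mp hy0)
  rw [← Set.Ioc_union_Ioi_eq_Ioi hT0.le] at hRi ⊢
  rw [setIntegral_union (Set.Ioc_disjoint_Ioi le_rfl) measurableSet_Ioi
    (hRi.mono_set Set.subset_union_left) (hRi.mono_set Set.subset_union_right), add_mul]
  refine (abs_add_le _ _).trans (add_le_add ?_ ?_)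
  · rw [← Real.norm_eq_abs]
    refine (norm_setIntegral_le_of_norm_le_const (by simp) fun t ht => h1 y hy1 hvan t ht).trans ?_
    rw [Real.volume_real_Ioc_of_le hT0.le, sub_zero, hT, pow_succ]
    refine le_of_eq ?_
    field_simp
  · rw [← Real.norm_eq_abs]
    refine (norm_integral_le_of_norm_le
      ((integrableOn_inv_pow (N := K + 1) (by omega) hT0).const_mul C) ?_).trans ?_
    · exact (ae_restrict_iff' measurableSet_Ioi).mpr
        (ae_of_all _ fun t ht => hb t (hT1.trans (le_of_lt ht)) y)
    · rw [integral_const_mul]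
      have h2 := integral_inv_pow_le (N := K + 1) (by omega) hT0
      rw [Nat.add_sub_cancel] at h2
      calc _ ≤ C * (T ^ K)⁻¹ := by gcongr
        _ = _ := by
          rw [hT, mul_pow, div_pow, one_pow]
          field_simp

/-- The asymptotic expansion of the potential of a standardized step, at the points `y` that cannot
be reached in fewer than `|y| / B` steps. The constant does not depend on the order `K`. -/
theorem exists_potential_expansion (hF : IsFrequencyDomain w v F) (h : IsStandardStep w v)
    (hd : 0 < d) {B : ℝ} (hB : 0 < B) : ∃ lam : ℝ, ∀ K : ℕ, 0 < K →
    ∃ (Q : MvPolynomial (Fin d) ℝ) (e : ℕ),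
      (∀ δ > 0, ∃ C : ℝ, ∀ y : EuclideanSpace ℝ (Fin d), δ ≤ ‖y‖ →
        |MvPolynomial.eval y.ofLp Q / ‖y‖ ^ (d + 2 * e)| ≤ C * ‖y‖ ^ (1 - (d : ℤ))) ∧
      ∃ C : ℝ, 0 ≤ C ∧ ∀ y : EuclideanSpace ℝ (Fin d), 1 + 4 * B ≤ ‖y‖ →
        (∀ k : ℕ, k * B < ‖y‖ → walkFourier w v F k y = 0) →
        |potentialIntegral w v F y - ((2 * Real.pi) ^ ((d : ℝ) / 2) *
            (profileConst d * radialProfile d ‖y‖) + lam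
            + MvPolynomial.eval y.ofLp Q / ‖y‖ ^ (d + 2 * e))| ≤ C * (‖y‖ ^ K)⁻¹ := by
  obtain ⟨b, hb⟩ := exists_integral_leading d
  refine ⟨heatConst w v F + (2 * Real.pi) ^ ((d : ℝ) / 2) * b, fun K hK => ?_⟩
  obtain ⟨H, hH, C, hC, hloc⟩ := h.exists_local_expansion hF (K + 1)
  obtain ⟨-, ⟨Q, e, hQ⟩, hbd⟩ := gaussTail_integral hd hH
  obtain ⟨C', hC', hrem⟩ := exists_remainder_bound hF h hd hH hB hK hC hloc
  have hval : ∀ y : EuclideanSpace ℝ (Fin d), y ≠ 0 →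
      MvPolynomial.eval y.ofLp (-Q) / ‖y‖ ^ (d + 2 * e) = -∫ t in Set.Ioi (0 : ℝ), H t y := by
    intro y hy
    rw [hQ y hy, map_neg, neg_div]
  refine ⟨-Q, e, fun δ hδ => ?_, C', hC', fun y hy hvan => ?_⟩
  · obtain ⟨C'', hC''⟩ := hbd δ hδ
    refine ⟨C'', fun y hy => ?_⟩
    rw [hval y (norm_pos_iff.mp (hδ.trans_le hy)), abs_neg]
    exact hC'' y hy
  · have hy0 : 0 < ‖y‖ := by linarith
    have hy' : y ≠ 0 := norm_pos_iff.mp hy0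
    rw [hval y hy', potentialIntegral_eq hF h hd hH (N := K + 1) (by omega) hloc hy', hb _ hy0]
    refine le_trans (le_of_eq ?_) (hrem y hy hvan)
    rw [← abs_neg]
    congr 1
    ring

end

/-! ### The transition probabilities of the walk -/

section
variable {n : ℕ} {Ω : Type*} [MeasurableSpace Ω] {P : Measure Ω}
  {Z : Submodule ℤ (EuclideanSpace ℝ (Fin n))} {R : ℕ → Ω → Z}

lemma finite_norm_le_of_discrete (Z : Submodule ℤ (EuclideanSpace ℝ (Fin n)))
    [DiscreteTopology Z] (r : ℝ) : {z : Z | ‖z‖ ≤ r}.Finite := by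
  have hcl : IsClosed (Z : Set (EuclideanSpace ℝ (Fin n))) := by
    have : DiscreteTopology Z.toAddSubgroup := inferInstanceAs (DiscreteTopology Z)
    exact AddSubgroup.isClosed_of_discrete (H := Z.toAddSubgroup)
  have hdisc : IsDiscrete (Z : Set (EuclideanSpace ℝ (Fin n))) :=
    isDiscrete_iff_discreteTopology.mpr inferInstance
  have h := Metric.finite_isBounded_inter_isClosed hdisc
    (Metric.isBounded_closedBall (x := (0 : EuclideanSpace ℝ (Fin n))) (r := r)) hcl
  refine Set.Finite.of_finite_image (f := Subtype.val) (h.subset ?_) Subtype.val_injective.injOn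
  rintro _ ⟨z, hz, rfl⟩
  exact ⟨by simpa using hz, z.2⟩

/-- The distribution of a step of the walk. -/
noncomputable def stepProb (P : Measure Ω) (R : ℕ → Ω → Z) (z : Z) : ℝ :=
  P.real {ω | R 1 ω - R 0 ω = z}

namespace IsRandomWalk

lemma measurable_step [DiscreteTopology Z] (hR : IsRandomWalk P Z R) (k : ℕ) :
    Measurable fun ω => R (k + 1) ω - R k ω :=
  (hR.measurable (k + 1)).sub (hR.measurable k)

lemma ae_eq_sum (hR : IsRandomWalk P Z R) (k : ℕ) :
    ∀ᵐ ω ∂P, R k ω = ∑ j ∈ Finset.range k, (R (j + 1) ω - R j ω) := by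
  filter_upwards [hR.start] with ω hω
  rw [Finset.sum_range_sub (fun j => R j ω), hω, sub_zero]

lemma indepFun_step [IsProbabilityMeasure P] [DiscreteTopology Z] (hR : IsRandomWalk P Z R)
    (k : ℕ) :
    IndepFun (R k) (fun ω => R (k + 1) ω - R k ω) P := by
  have h := hR.indep.indepFun_finsetSum_of_notMem hR.measurable_step
    (s := Finset.range k) (i := k) (by simp)
  refine IndepFun.congr h ?_ (ae_eq_refl _)
  filter_upwards [hR.ae_eq_sum k] with ω hω
  rw [hω, Finset.sum_apply]

lemma prob_step_eq [DiscreteTopology Z] (hR : IsRandomWalk P Z R) (k : ℕ) (z : Z) :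
    P.real {ω | R (k + 1) ω - R k ω = z} = stepProb P R z := by
  have := (hR.identDistrib k).measure_mem_eq (measurableSet_singleton z)
  simp only [stepProb, Measure.real]
  exact congrArg ENNReal.toReal this

lemma walkProb_zero [IsProbabilityMeasure P] (hR : IsRandomWalk P Z R) (z : Z) [Decidable (z = 0)] :
    walkProb P R 0 z = if z = 0 then 1 else 0 := by
  split_ifs with hz
  · have : P {ω | R 0 ω = z} = 1 := by
      rw [← measure_univ (μ := P)]
      refine measure_congr ?_
      filter_upwards [hR.start] with ω hω
      change (R 0 ω = z) = True
      simp [hω, hz]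
    simp [walkProb, Measure.real, this]
  · have : P {ω | R 0 ω = z} = 0 := by
      refine measure_eq_zero_iff_ae_notMem.mpr ?_
      filter_upwards [hR.start] with ω hω h
      exact hz (h.symm.trans hω)
    simp [walkProb, Measure.real, this]

/-- The steps take values in a finite set. -/
lemma _root_.IsBoundedWalk.exists_step_support [DiscreteTopology Z] (hb : IsBoundedWalk P R) :
    ∃ S : Finset Z, ∀ k, ∀ᵐ ω ∂P, R (k + 1) ω - R k ω ∈ S := by
  obtain ⟨C, hC⟩ := hb
  refine ⟨(finite_norm_le_of_discrete Z C).toFinset, fun k => ?_⟩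
  filter_upwards [hC k] with ω hω
  simpa using hω

lemma stepProb_nonneg (P : Measure Ω) (R : ℕ → Ω → Z) (z : Z) : 0 ≤ stepProb P R z :=
  measureReal_nonneg

lemma integral_step [IsProbabilityMeasure P] [DiscreteTopology Z] (hR : IsRandomWalk P Z R)
    {S : Finset Z}
    (hS : ∀ k, ∀ᵐ ω ∂P, R (k + 1) ω - R k ω ∈ S) {G : Type*} [NormedAddCommGroup G]
    [NormedSpace ℝ G] [CompleteSpace G] (f : Z → G) :
    ∫ ω, f (R 1 ω) ∂P = ∑ x ∈ S, stepProb P R x • f x := by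
  have hm : ∀ x : Z, MeasurableSet {ω | R 1 ω - R 0 ω = x} := fun x =>
    (hR.measurable_step 0) (measurableSet_singleton x)
  have e : ∀ᵐ ω ∂P, f (R 1 ω) =
      ∑ x ∈ S, ({ω | R 1 ω - R 0 ω = x}.indicator (fun _ => f x) ω) := by
    filter_upwards [hS 0, hR.start] with ω h1 h0
    rw [zero_add] at h1
    rw [Finset.sum_eq_single (R 1 ω - R 0 ω)]
    · rw [Set.indicator_of_mem (by exact rfl), h0, sub_zero]
    · intro x _ hx
      exact Set.indicator_of_notMem (fun h => hx (Eq.symm h)) _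
    · exact fun h => absurd h1 h
  rw [integral_congr_ae e, integral_finsetSum _ fun x _ => (integrable_const _).indicator (hm x)]
  refine Finset.sum_congr rfl fun x _ => ?_
  rw [integral_indicator_const _ (hm x), stepProb]

lemma sum_stepProb [IsProbabilityMeasure P] [DiscreteTopology Z] (hR : IsRandomWalk P Z R)
    {S : Finset Z}
    (hS : ∀ k, ∀ᵐ ω ∂P, R (k + 1) ω - R k ω ∈ S) : ∑ x ∈ S, stepProb P R x = 1 := by
  have := hR.integral_step hS (fun _ => (1 : ℝ))
  simpa using this.symm

lemma walkProb_succ [IsProbabilityMeasure P] [DiscreteTopology Z] (hR : IsRandomWalk P Z R)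
    {S : Finset Z}
    (hS : ∀ k, ∀ᵐ ω ∂P, R (k + 1) ω - R k ω ∈ S) (k : ℕ) (z : Z) :
    walkProb P R (k + 1) z = ∑ x ∈ S, stepProb P R x * walkProb P R k (z - x) := by
  have hm1 : ∀ x : Z, MeasurableSet {ω | R (k + 1) ω - R k ω = x} := fun x =>
    (hR.measurable_step k) (measurableSet_singleton x)
  have hm2 : ∀ x : Z, MeasurableSet {ω | R k ω = x} := fun x =>
    (hR.measurable k) (measurableSet_singleton x)
  have e : {ω | R (k + 1) ω = z} =ᵐ[P]
      ⋃ x ∈ S, ({ω | R k ω = z - x} ∩ {ω | R (k + 1) ω - R k ω = x}) := by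
    filter_upwards [hS k] with ω hω
    change (R (k + 1) ω = z) =
      (ω ∈ ⋃ x ∈ S, ({ω | R k ω = z - x} ∩ {ω | R (k + 1) ω - R k ω = x}))
    simp only [Set.mem_iUnion, eq_iff_iff]
    constructor
    · rintro rfl
      exact ⟨_, hω, by simp, rfl⟩
    · rintro ⟨x, -, h1, h2⟩
      have h1 : R k ω = z - x := h1
      have h2 : R (k + 1) ω - R k ω = x := h2
      rw [h1] at h2
      exact (sub_eq_iff_eq_add.mp h2).trans (by abel)
  rw [walkProb, measureReal_congr e, measureReal_biUnion_finset]
  · refine Finset.sum_congr rfl fun x _ => ?_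
    rw [walkProb, ← hR.prob_step_eq k x, mul_comm, Measure.real, Measure.real, Measure.real,
      ← ENNReal.toReal_mul]
    congr 1
    exact (hR.indepFun_step k).measure_inter_preimage_eq_mul _ _
      (measurableSet_singleton (z - x)) (measurableSet_singleton x)
  · intro x _ x' _ hxx
    refine Set.disjoint_left.mpr fun ω h h' => hxx ?_
    exact (Eq.symm h.2).trans h'.2
  · exact fun x _ => (hm2 _).inter (hm1 _)

lemma walkProb_nonneg (P : Measure Ω) (R : ℕ → Ω → Z) (k : ℕ) (z : Z) : 0 ≤ walkProb P R k z :=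
  measureReal_nonneg

/-- The steps of positive probability generate `Z`, as a monoid. -/
lemma mem_of_steps_mem [IsProbabilityMeasure P] [DiscreteTopology Z] (hR : IsRandomWalk P Z R)
    {S : Finset Z}
    (hS : ∀ k, ∀ᵐ ω ∂P, R (k + 1) ω - R k ω ∈ S) (M : AddSubmonoid Z)
    (hM : ∀ x ∈ S, 0 < stepProb P R x → x ∈ M) (z : Z) : z ∈ M := by
  classical
  have key : ∀ k z, 0 < walkProb P R k z → z ∈ M := by
    intro k
    induction k with
    | zero =>
      intro z hz
      rw [hR.walkProb_zero] at hz
      split_ifs at hz with h0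
      · rw [h0]; exact M.zero_mem
      · exact absurd hz (lt_irrefl _)
    | succ k ih =>
      intro z hz
      rw [hR.walkProb_succ hS] at hz
      obtain ⟨x, hx, hx'⟩ := Finset.exists_lt_of_sum_lt (s := S) (f := fun _ => (0 : ℝ))
        (by simpa using hz)
      have h1 : 0 < stepProb P R x := (stepProb_nonneg P R x).lt_of_ne fun h => by
        rw [← h, zero_mul] at hx'; exact lt_irrefl _ hx'
      have h2 : 0 < walkProb P R k (z - x) := (walkProb_nonneg P R k _).lt_of_ne fun h => by
        rw [← h, mul_zero] at hx'; exact lt_irrefl _ hx'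
      have := M.add_mem (ih _ h2) (hM x hx h1)
      rwa [sub_add_cancel] at this
  obtain ⟨k, hk⟩ := hR.reaches z
  exact key k z (ENNReal.toReal_pos hk.ne' (measure_ne_top P _))

/-- The walk has finite range. -/
lemma walkProb_eq_zero_of_lt [IsProbabilityMeasure P] [DiscreteTopology Z]
    (hR : IsRandomWalk P Z R) {S : Finset Z}
    (hS : ∀ k, ∀ᵐ ω ∂P, R (k + 1) ω - R k ω ∈ S) {E : Type*} [NormedAddCommGroup E]
    [NormedSpace ℝ E] (y : EuclideanSpace ℝ (Fin n) →ₗ[ℝ] E) {B : ℝ}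
    (hB : ∀ x ∈ S, ‖y x‖ ≤ B) (k : ℕ) (z : Z) (hz : k * B < ‖y z‖) : walkProb P R k z = 0 := by
  classical
  induction k generalizing z with
  | zero =>
    rw [hR.walkProb_zero, if_neg]
    rintro rfl
    simp at hz
  | succ k ih =>
    rw [hR.walkProb_succ hS]
    refine Finset.sum_eq_zero fun x hx => ?_
    rw [ih, mul_zero]
    have h1 : ‖y z‖ ≤ ‖y (z - x : Z)‖ + ‖y x‖ := by
      have : y z = y (z - x : Z) + y x := by rw [← map_add]; simp
      rw [this]
      exact norm_add_le _ _
    have := hB x hx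
    push_cast at hz
    linarith

end IsRandomWalk
end

/-! ### The frequency cell of a lattice -/

/-- The `η` whose pairings with the rows of `Y` are at most `π` in absolute value: a fundamental
cell, centred at the origin, for `2π` times the lattice dual to the one spanned by the rows. -/
def dualCell {d : ℕ} (Y : Matrix (Fin d) (Fin d) ℝ) : Set (EuclideanSpace ℝ (Fin d)) :=
  (fun η : EuclideanSpace ℝ (Fin d) => Y.mulVec η.ofLp) ⁻¹'
    Set.Icc (fun _ => -Real.pi) (fun _ => Real.pi)

section
variable {d : ℕ} {Y : Matrix (Fin d) (Fin d) ℝ}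

lemma continuous_mulVec_ofLp (Y : Matrix (Fin d) (Fin d) ℝ) :
    Continuous fun η : EuclideanSpace ℝ (Fin d) => Y.mulVec η.ofLp :=
  Continuous.matrix_mulVec continuous_const (PiLp.continuous_ofLp 2 _)

lemma map_mulVec_volume (hY : Y.det ≠ 0) :
    Measure.map (fun η : EuclideanSpace ℝ (Fin d) => Y.mulVec η.ofLp) volume =
      ENNReal.ofReal |Y.det⁻¹| • volume := by
  rw [← Real.map_matrix_volume_pi_eq_smul_volume_pi hY,
    ← (PiLp.volume_preserving_ofLp (Fin d)).map_eq, Measure.map_map]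
  · rfl
  · exact (LinearMap.continuous_of_finiteDimensional _).measurable
  · exact (PiLp.continuous_ofLp 2 _).measurable

lemma integral_dualCell (hY : Y.det ≠ 0) {g : (Fin d → ℝ) → ℂ} (hg : Continuous g) :
    ∫ η in dualCell Y, g (Y.mulVec η.ofLp) =
      |Y.det⁻¹| • ∫ θ in Set.Icc (fun _ : Fin d => -Real.pi) (fun _ => Real.pi), g θ := by
  have hm := (continuous_mulVec_ofLp Y).measurable
  rw [dualCell, ← setIntegral_map measurableSet_Icc hg.aestronglyMeasurable hm.aemeasurable,
    map_mulVec_volume hY, Measure.restrict_smul, integral_smul_measure,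
    ENNReal.toReal_ofReal (abs_nonneg _)]

lemma volume_dualCell (hY : Y.det ≠ 0) :
    volume.real (dualCell Y) = |Y.det|⁻¹ * (2 * Real.pi) ^ d := by
  have hm := (continuous_mulVec_ofLp Y).measurable
  rw [Measure.real, dualCell, ← Measure.map_apply hm measurableSet_Icc, map_mulVec_volume hY,
    Measure.smul_apply, smul_eq_mul, ENNReal.toReal_mul, ENNReal.toReal_ofReal (abs_nonneg _),
    Real.volume_Icc_pi_toReal (fun _ => by linarith [Real.pi_pos]), abs_inv]
  congr 1
  simp only [Finset.prod_const, Finset.card_univ, Fintype.card_fin]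
  congr 1
  ring

/-- Orthogonality of characters. -/
lemma integral_dualCell_exp_eq_zero (hY : Y.det ≠ 0) {m : Fin d → ℤ} (hm : m ≠ 0) :
    ∫ η in dualCell Y, Complex.exp (-((∑ j, m j * (Y.mulVec η.ofLp) j : ℝ) : ℂ) * I) = 0 := by
  have h := integral_dualCell hY
    (g := fun θ => Complex.exp (-((∑ j, m j * θ j : ℝ) : ℂ) * I)) (by fun_prop)
  rw [h]
  have hpi : Set.Icc (fun _ : Fin d => -Real.pi) (fun _ => Real.pi) =
      Set.univ.pi fun _ => Set.Icc (-Real.pi) Real.pi := (Set.pi_univ_Icc _ _).symm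
  rw [hpi, volume_pi, Measure.restrict_pi_pi]
  have e : ∀ θ : Fin d → ℝ, Complex.exp (-((∑ j, m j * θ j : ℝ) : ℂ) * I) =
      ∏ j, Complex.exp ((-(m j : ℂ) * I) * (θ j : ℝ)) := by
    intro θ
    rw [← Complex.exp_sum]
    congr 1
    push_cast
    rw [← Finset.sum_neg_distrib, Finset.sum_mul]
    exact Finset.sum_congr rfl fun j _ => by ring
  simp_rw [e]
  rw [integral_fintype_prod_eq_prod (fun j (x : ℝ) => Complex.exp ((-(m j : ℂ) * I) * (x : ℝ)))]
  obtain ⟨j, hj⟩ := Function.ne_iff.mp hm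
  rw [Finset.prod_eq_zero (Finset.mem_univ j), smul_zero]
  have hj' : (m j : ℂ) ≠ 0 := by simpa using hj
  rw [integral_Icc_eq_integral_Ioc, ← intervalIntegral.integral_of_le (by linarith [Real.pi_pos]),
    integral_exp_mul_complex (mul_ne_zero (neg_ne_zero.mpr hj') Complex.I_ne_zero)]
  rw [div_eq_zero_iff]
  left
  rw [sub_eq_zero, Complex.exp_eq_exp_iff_exists_int]
  exact ⟨-m j, by push_cast; ring⟩

lemma isCompact_dualCell (hY : Y.det ≠ 0) : IsCompact (dualCell Y) := by
  have hu : IsUnit Y.det := isUnit_iff_ne_zero.mpr hY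
  have : dualCell Y = (fun θ : Fin d → ℝ => WithLp.toLp 2 (Y⁻¹.mulVec θ)) ''
      Set.Icc (fun _ => -Real.pi) (fun _ => Real.pi) := by
    ext η
    constructor
    · intro h
      refine ⟨_, h, ?_⟩
      change WithLp.toLp 2 (Y⁻¹.mulVec (Y.mulVec η.ofLp)) = η
      rw [Matrix.mulVec_mulVec, Matrix.nonsing_inv_mul _ hu, Matrix.one_mulVec]
    · rintro ⟨θ, hθ, rfl⟩
      simpa [dualCell, Matrix.mulVec_mulVec, Matrix.mul_nonsing_inv _ hu] using hθ
  rw [this]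
  refine isCompact_Icc.image ?_
  exact (PiLp.continuous_toLp 2 _).comp (Continuous.matrix_mulVec continuous_const continuous_id)

lemma dualCell_mem_nhds (Y : Matrix (Fin d) (Fin d) ℝ) : dualCell Y ∈ 𝓝 0 := by
  refine (continuous_mulVec_ofLp Y).continuousAt.preimage_mem_nhds ?_
  simp only [WithLp.ofLp_zero, Matrix.mulVec_zero]
  exact pi_Icc_mem_nhds (fun _ => by simp [Real.pi_pos]) (fun _ => Real.pi_pos)

end

/-! ### The walk in standardized coordinates -/

section
variable {n d : ℕ} {Ω : Type*} [MeasurableSpace Ω] {P : Measure Ω}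
  {Z : Submodule ℤ (EuclideanSpace ℝ (Fin n))} {R : ℕ → Ω → Z}

/-- The matrix with rows `y (e j)`. -/
def frameMatrix (y : EuclideanSpace ℝ (Fin n) →ₗ[ℝ] EuclideanSpace ℝ (Fin d)) (e : Fin d → Z) :
    Matrix (Fin d) (Fin d) ℝ :=
  Matrix.of fun j l => y (e j) l

lemma frameMatrix_mulVec (y : EuclideanSpace ℝ (Fin n) →ₗ[ℝ] EuclideanSpace ℝ (Fin d))
    (e : Fin d → Z) (η : EuclideanSpace ℝ (Fin d)) (j : Fin d) :
    (frameMatrix y e).mulVec η.ofLp j = inner ℝ (y (e j)) η := by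
  simp [frameMatrix, Matrix.mulVec, dotProduct, PiLp.inner_apply, mul_comm]

lemma inner_eq_sum_frame (y : EuclideanSpace ℝ (Fin n) →ₗ[ℝ] EuclideanSpace ℝ (Fin d))
    (e : Fin d → Z) (m : Fin d → ℤ) (η : EuclideanSpace ℝ (Fin d)) :
    inner ℝ (y (∑ j, m j • e j : Z)) η = ∑ j, m j * (frameMatrix y e).mulVec η.ofLp j := by
  simp only [frameMatrix_mulVec]
  push_cast
  rw [map_sum, sum_inner]
  refine Finset.sum_congr rfl fun j _ => ?_
  rw [map_zsmul, ← Int.cast_smul_eq_zsmul ℝ, real_inner_smul_left]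

variable {y : EuclideanSpace ℝ (Fin n) →ₗ[ℝ] EuclideanSpace ℝ (Fin d)} {e : Fin d → Z}

/-- The Fourier inversion formula for the transition probabilities. -/
lemma IsRandomWalk.walkFourier_eq [IsProbabilityMeasure P] [DiscreteTopology Z]
    (hR : IsRandomWalk P Z R) {S : Finset Z}
    (hS : ∀ k, ∀ᵐ ω ∂P, R (k + 1) ω - R k ω ∈ S)
    (he : ∀ z : Z, ∃ m : Fin d → ℤ, z = ∑ j, m j • e j) (hY : (frameMatrix y e).det ≠ 0)
    (k : ℕ) (z : Z) :
    walkFourier (fun x : S => stepProb P R x) (fun x : S => y x) (dualCell (frameMatrix y e)) k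
        (y z) = volume.real (dualCell (frameMatrix y e)) * walkProb P R k z := by
  classical
  have hcpt := isCompact_dualCell hY
  set w : S → ℝ := fun x => stepProb P R x with hw
  set v : S → EuclideanSpace ℝ (Fin d) := fun x => y x with hv
  have hψ := continuous_stepChar (w := w) (v := v)
  induction k generalizing z with
  | zero =>
    rw [hR.walkProb_zero, walkFourier]
    split_ifs with hz
    · rw [hz]
      simp
    · obtain ⟨m, hm⟩ := he z
      have hm0 : m ≠ 0 := by
        rintro rfl
        exact hz (by simpa using hm)
      have h0 := integral_dualCell_exp_eq_zero hY hm0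
      simp_rw [← inner_eq_sum_frame, ← hm] at h0
      simp only [pow_zero, one_mul, mul_zero]
      have hi : IntegrableOn (fun η : EuclideanSpace ℝ (Fin d) =>
          Complex.exp (-(inner ℝ (y z) η : ℝ) * I)) (dualCell (frameMatrix y e)) :=
        (Continuous.continuousOn (by fun_prop)).integrableOn_compact hcpt
      have h1 := integral_re hi
      simp only [RCLike.re_to_complex] at h1
      rw [h1, h0, Complex.zero_re]
  | succ k ih =>
    rw [hR.walkProb_succ hS, walkFourier, Finset.mul_sum, ← Finset.sum_coe_sort S]
    have hs : ∀ η : EuclideanSpace ℝ (Fin d),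
        (stepChar w v η ^ (k + 1) * Complex.exp (-(inner ℝ (y z) η : ℝ) * I)).re =
        ∑ x : S, w x * (stepChar w v η ^ k *
          Complex.exp (-(inner ℝ (y (z - x : Z)) η : ℝ) * I)).re := by
      intro η
      rw [pow_succ]
      conv_lhs => rw [mul_assoc]; enter [1, 2, 1]; rw [stepChar]
      rw [Finset.sum_mul, Finset.mul_sum, Complex.re_sum]
      refine Finset.sum_congr rfl fun x _ => ?_
      rw [← Complex.re_ofReal_mul]
      congr 1
      have : inner ℝ (y (z - x : Z)) η = inner ℝ (y z) η - inner ℝ (v x) η := by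
        rw [hv, ← inner_sub_left, ← map_sub]
        simp
      rw [this]
      have h2 : Complex.exp (-((inner ℝ (y z) η - inner ℝ (v x) η : ℝ) : ℂ) * I) =
          Complex.exp ((inner ℝ (v x) η : ℝ) * I) * Complex.exp (-(inner ℝ (y z) η : ℝ) * I) := by
        rw [← Complex.exp_add]
        congr 1
        push_cast
        ring
      rw [h2]
      ring
    simp_rw [hs]
    rw [integral_finsetSum _ fun x _ =>
      (Continuous.continuousOn (by fun_prop)).integrableOn_compact hcpt]
    refine Finset.sum_congr rfl fun x _ => ?_
    rw [integral_const_mul]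
    have := ih (z - x)
    rw [walkFourier] at this
    rw [this, hw]
    ring

/-- The frequency cell of the lattice is a frequency domain: as the steps generate the lattice,
the characteristic function takes the value `1` only at the origin of the cell. -/
lemma IsRandomWalk.isFrequencyDomain [IsProbabilityMeasure P] [DiscreteTopology Z]
    (hR : IsRandomWalk P Z R) {S : Finset Z} (hS : ∀ k, ∀ᵐ ω ∂P, R (k + 1) ω - R k ω ∈ S)
    (hY : (frameMatrix y e).det ≠ 0)
    (hstd : IsStandardStep (fun x : S => stepProb P R x) (fun x : S => y x)) :
    IsFrequencyDomain (fun x : S => stepProb P R x) (fun x : S => y x)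
      (dualCell (frameMatrix y e)) := by
  refine ⟨isCompact_dualCell hY, dualCell_mem_nhds _, ?_⟩
  set w : S → ℝ := fun x => stepProb P R x with hw
  set v : S → EuclideanSpace ℝ (Fin d) := fun x => y x with hv
  set F := dualCell (frameMatrix y e) with hF
  have hcpt : IsCompact F := isCompact_dualCell hY
  have hψ := continuous_stepChar (w := w) (v := v)
  obtain ⟨B, hB, hB'⟩ := exists_step_bound v
  have hre : ∀ η, 1 - (stepChar w v η).re = ∑ x, w x * (1 - Real.cos (inner ℝ (v x) η)) := by
    intro η
    simp only [mul_sub, mul_one, Finset.sum_sub_distrib, hstd.sum_eq_one]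
    rw [stepChar, Complex.re_sum]
    congr 1
    refine Finset.sum_congr rfl fun x _ => ?_
    rw [Complex.re_ofReal_mul, Complex.exp_ofReal_mul_I_re]
  have hterm : ∀ η x, 0 ≤ w x * (1 - Real.cos (inner ℝ (v x) η)) := fun η x =>
    mul_nonneg (hstd.nonneg x) (by linarith [Real.cos_le_one (inner ℝ (v x) η)])
  set r : ℝ := Real.pi / (B + 1) with hr
  have hr0 : 0 < r := by have := Real.pi_pos; positivity
  have hnear : ∀ η, ‖η‖ ≤ r → 2 / Real.pi ^ 2 * ‖η‖ ^ 2 ≤ 1 - (stepChar w v η).re := by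
    intro η hη
    rw [hre, ← hstd.cov η, Finset.mul_sum]
    refine Finset.sum_le_sum fun x _ => ?_
    have h1 : |inner ℝ (v x) η| ≤ Real.pi := by
      refine (hB' x η).trans ?_
      rw [hr, le_div_iff₀ (by positivity)] at hη
      nlinarith [norm_nonneg η]
    have h2 := Real.cos_le_one_sub_mul_cos_sq h1
    calc 2 / Real.pi ^ 2 * (w x * inner ℝ (v x) η ^ 2)
        = w x * (2 / Real.pi ^ 2 * inner ℝ (v x) η ^ 2) := by ring
      _ ≤ _ := by
        refine mul_le_mul_of_nonneg_left ?_ (hstd.nonneg x)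
        linarith
  have hpos : ∀ η ∈ F, η ≠ 0 → 0 < 1 - (stepChar w v η).re := by
    intro η hη h0
    rw [hre]
    refine lt_of_le_of_ne (Finset.sum_nonneg fun x _ => hterm η x) fun hz => h0 ?_
    have hz' := (Finset.sum_eq_zero_iff_of_nonneg fun x _ => hterm η x).mp hz.symm
    -- the lattice points pairing with `η` to a multiple of `2π`
    let M : AddSubmonoid Z :=
      { carrier := {z | ∃ m : ℤ, inner ℝ (y z) η = m * (2 * Real.pi)}
        zero_mem' := ⟨0, by simp⟩
        add_mem' := by
          rintro a b ⟨m, hm⟩ ⟨m', hm'⟩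
          refine ⟨m + m', ?_⟩
          push_cast
          rw [map_add, inner_add_left, hm, hm']
          ring }
    have hM : ∀ x ∈ S, 0 < stepProb P R x → x ∈ M := by
      intro x hx hx0
      have h1 := hz' ⟨x, hx⟩ (Finset.mem_univ _)
      have h2 : Real.cos (inner ℝ (y x) η) = 1 := by
        rcases mul_eq_zero.mp h1 with h | h
        · exact absurd h hx0.ne'
        · have : Real.cos (inner ℝ (v ⟨x, hx⟩) η) = 1 := by linarith
          exact this
      obtain ⟨m, hm⟩ := (Real.cos_eq_one_iff _).mp h2
      exact ⟨m, hm.symm⟩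
    have hzero : (frameMatrix y e).mulVec η.ofLp = 0 := by
      ext j
      obtain ⟨m, hm⟩ := hR.mem_of_steps_mem hS M hM (e j)
      have hj := frameMatrix_mulVec y e η j
      have h1 := hη.1 j
      have h2 := hη.2 j
      simp only [hj, hm] at h1 h2
      have hpi := Real.pi_pos
      have hm1 : (m : ℝ) < 1 := by nlinarith
      have hm2 : (-1 : ℝ) < m := by nlinarith
      have hm0 : m = 0 := by
        have h3 : m < 1 := by exact_mod_cast hm1
        have h4 : -1 < m := by exact_mod_cast hm2
        omega
      rw [hj, hm, hm0]
      simp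
    have := Matrix.eq_zero_of_mulVec_eq_zero hY hzero
    ext j
    rw [this]
    rfl
  obtain ⟨ρ, hρ⟩ := hcpt.isBounded.exists_norm_le
  have hfar : ∃ μ > 0, ∀ η ∈ F, r ≤ ‖η‖ → μ ≤ 1 - (stepChar w v η).re := by
    have hK : IsCompact (F ∩ {η | r ≤ ‖η‖}) :=
      hcpt.inter_right (isClosed_le continuous_const continuous_norm)
    rcases (F ∩ {η | r ≤ ‖η‖}).eq_empty_or_nonempty with hemp | hne
    · exact ⟨1, one_pos, fun η h1 h2 =>
        (Set.eq_empty_iff_forall_notMem.mp hemp η ⟨h1, h2⟩).elim⟩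
    · obtain ⟨η₀, ⟨h1, h2⟩, hmin⟩ := hK.exists_isMinOn hne
        (f := fun η => 1 - (stepChar w v η).re) (by fun_prop)
      have h2 : r ≤ ‖η₀‖ := h2
      exact ⟨_, hpos η₀ h1 (norm_pos_iff.mp (hr0.trans_le h2)), fun η h3 h4 => hmin ⟨h3, h4⟩⟩
  obtain ⟨μ, hμ, hfar⟩ := hfar
  have hpi := Real.pi_pos
  refine ⟨min (2 / Real.pi ^ 2) (μ / (ρ ^ 2 + 1)), by positivity, fun η hη => ?_⟩
  rcases le_total ‖η‖ r with h | h
  · refine le_trans ?_ (hnear η h)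
    gcongr
    exact min_le_left _ _
  · refine le_trans ?_ (hfar η hη h)
    have h1 : ‖η‖ ^ 2 ≤ ρ ^ 2 + 1 := by
      have := hρ η hη
      nlinarith [norm_nonneg η]
    calc _ ≤ μ / (ρ ^ 2 + 1) * (ρ ^ 2 + 1) := by
          gcongr
          exact min_le_right _ _
      _ = μ := by field_simp

end

/-! ### The lattice in orthonormal coordinates -/

lemma coords_eq_zero_of_mem_span {n d : ℕ} {b : Fin d → EuclideanSpace ℝ (Fin n)}
    {v : EuclideanSpace ℝ (Fin n)}
    (hv : v ∈ Submodule.span ℝ (Set.range b)) (h : coords b v = 0) : v = 0 := by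
  have h1 : v ∈ (Submodule.span ℝ (Set.range b))ᗮ := by
    rw [Submodule.mem_orthogonal']
    intro u hu
    induction hu using Submodule.span_induction with
    | mem x hx =>
      obtain ⟨i, rfl⟩ := hx
      rw [real_inner_comm]
      exact congrFun h i
    | zero => simp
    | add x y _ _ hx hy => rw [inner_add_right, hx, hy, add_zero]
    | smul c x _ hx => rw [inner_smul_right, hx, mul_zero]
  have := (Submodule.mem_orthogonal _ _).mp h1 v hv
  exact inner_self_eq_zero.mp this

/-- A lattice has an integral basis, as many vectors as the dimension of its span, and its covolume
is the determinant of such a basis in orthonormal coordinates. -/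
lemma exists_lattice_frame {n d : ℕ} (Z : Submodule ℤ (EuclideanSpace ℝ (Fin n)))
    [DiscreteTopology Z] {b : Fin d → EuclideanSpace ℝ (Fin n)} (hb : Orthonormal ℝ b)
    (hbZ : Submodule.span ℝ (Set.range b)
      = Submodule.span ℝ (Z : Set (EuclideanSpace ℝ (Fin n)))) :
    ∃ e : Fin d → Z, (∀ z : Z, ∃ m : Fin d → ℤ, z = ∑ j, m j • e j) ∧
      |(Matrix.of fun j l => coords b (e j) l).det| = latticeVolume Z ∧ 0 < latticeVolume Z := by
  set V := Submodule.span ℝ (Z : Set (EuclideanSpace ℝ (Fin n))) with hV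
  have hbV : ∀ i, b i ∈ V := fun i => hbZ ▸ Submodule.subset_span (Set.mem_range_self i)
  have hb' : Orthonormal ℝ (fun i => (⟨b i, hbV i⟩ : V)) := hb.codRestrict V hbV
  have hspan : ⊤ ≤ Submodule.span ℝ (Set.range fun i => (⟨b i, hbV i⟩ : V)) := by
    rw [← Submodule.map_le_map_iff_of_injective V.injective_subtype, Submodule.map_span,
      Submodule.map_top, Submodule.range_subtype, ← Set.range_comp]
    exact hbZ.symm.le
  let b₀ : OrthonormalBasis (Fin d) ℝ V := OrthonormalBasis.mk hb' hspan
  have hb₀ : ∀ i, (b₀ i : EuclideanSpace ℝ (Fin n)) = b i := fun i => by simp [b₀]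
  let Λ : Submodule ℤ V := ZLattice.comap ℝ Z V.subtype
  have : DiscreteTopology Λ :=
    ZLattice.comap_discreteTopology ℝ Z continuous_subtype_val V.injective_subtype
  have : IsZLattice ℝ Λ := ⟨Submodule.span_span_coe_preimage⟩
  have hfin : Module.finrank ℤ Λ = d := by
    rw [ZLattice.rank ℝ, Module.finrank_eq_card_basis b₀.toBasis, Fintype.card_fin]
  have := ZLattice.module_finite ℝ Λ
  have := ZLattice.module_free ℝ Λ
  let eL : Module.Basis (Fin d) ℤ Λ := (Module.finBasis ℤ Λ).reindex (finCongr hfin)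
  have hvol : latticeVolume Z = |b₀.toBasis.det ((↑) ∘ eL)| := by
    have h1 := ZLattice.covolume_eq_det_mul_measureReal Λ volume eL b₀.toBasis
    have h2 : volume.real (ZSpan.fundamentalDomain b₀.toBasis) = 1 := by
      rw [measureReal_congr (ZSpan.fundamentalDomain_ae_parallelepiped b₀.toBasis volume),
        Measure.real, b₀.coe_toBasis, b₀.volume_parallelepiped, ENNReal.toReal_one]
    rw [h2, mul_one] at h1
    exact h1
  refine ⟨fun j => ⟨((eL j : V) : EuclideanSpace ℝ (Fin n)), (eL j).2⟩, fun z => ?_, ?_, ?_⟩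
  · let z' : Λ := ⟨⟨z, Submodule.subset_span z.2⟩, z.2⟩
    refine ⟨eL.repr z', ?_⟩
    have h := congrArg (fun x : Λ => ((x : V) : EuclideanSpace ℝ (Fin n))) (eL.sum_repr z')
    ext1
    rw [← show _ = (z : EuclideanSpace ℝ (Fin n)) from h]
    push_cast
    rfl
  · rw [hvol, Module.Basis.det_apply, ← Matrix.det_transpose]
    congr 2
    ext j l
    simp only [Matrix.transpose_apply, Matrix.of_apply, Module.Basis.toMatrix_apply, coords,
      Function.comp_apply, b₀.coe_toBasis_repr_apply, b₀.repr_apply_apply, Submodule.coe_inner,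
      hb₀]
  · exact ZLattice.covolume_pos Λ volume

/-! ### The covariance matrix and its inverse square root -/

open scoped MatrixOrder in
lemma Matrix.PosDef.exists_inv_sqrt {d : ℕ} {M : Matrix (Fin d) (Fin d) ℝ} (hM : M.PosDef) :
    ∃ A : Matrix (Fin d) (Fin d) ℝ, A.PosDef ∧ A * A = M⁻¹ := by
  have hn : (0 : Matrix (Fin d) (Fin d) ℝ) ≤ M⁻¹ := hM.inv.posSemidef.nonneg
  have hsq : CFC.sqrt M⁻¹ * CFC.sqrt M⁻¹ = M⁻¹ := CFC.sqrt_mul_sqrt_self _ hn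
  refine ⟨CFC.sqrt M⁻¹, ?_, hsq⟩
  rw [(Matrix.nonneg_iff_posSemidef.mp (CFC.sqrt_nonneg M⁻¹)).posDef_iff_det_ne_zero]
  intro h0
  have := congrArg Matrix.det hsq
  rw [Matrix.det_mul, h0, zero_mul] at this
  exact hM.inv.det_pos.ne this

section
variable {d : ℕ} {M A : Matrix (Fin d) (Fin d) ℝ}

lemma det_inv_sqrt (hA : A.PosDef) (h : A * A = M⁻¹) :
    A.det = (Real.sqrt M.det)⁻¹ := by
  have h1 := congrArg Matrix.det h
  rw [Matrix.det_mul, Matrix.det_nonsing_inv, Ring.inverse_eq_inv'] at h1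
  rw [← Real.sqrt_inv, ← h1, Real.sqrt_mul_self hA.det_pos.le]

lemma inv_sqrt_conj (hM : M.PosDef) (hA : A.PosDef) (h : A * A = M⁻¹) : A * M * A = 1 := by
  have hu : IsUnit M.det := isUnit_iff_ne_zero.mpr hM.det_pos.ne'
  have hAu : IsUnit A.det := isUnit_iff_ne_zero.mpr hA.det_pos.ne'
  have h1 : A * (A * M) = 1 := by rw [← mul_assoc, h, Matrix.nonsing_inv_mul _ hu]
  rw [mul_eq_one_comm] at h1
  exact h1

end

/-- The coordinates `A ⟨b, v⟩`. For `A` the inverse square root of the covariance matrix, the step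
covariance becomes the identity in them. -/
noncomputable def stdCoords {n d : ℕ} (A : Matrix (Fin d) (Fin d) ℝ)
    (b : Fin d → EuclideanSpace ℝ (Fin n)) :
    EuclideanSpace ℝ (Fin n) →ₗ[ℝ] EuclideanSpace ℝ (Fin d) where
  toFun v := WithLp.toLp 2 (A.mulVec (coords b v))
  map_add' u v := by
    have : coords b (u + v) = coords b u + coords b v := funext fun i => inner_add_right _ _ _
    rw [this, Matrix.mulVec_add, WithLp.toLp_add]
  map_smul' c v := by
    have : coords b (c • v) = c • coords b v := funext fun i => inner_smul_right _ _ _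
    rw [this, Matrix.mulVec_smul, WithLp.toLp_smul, RingHom.id_apply]

lemma norm_stdCoords {n d : ℕ} (A : Matrix (Fin d) (Fin d) ℝ)
    (b : Fin d → EuclideanSpace ℝ (Fin n)) (v : EuclideanSpace ℝ (Fin n)) :
    ‖stdCoords A b v‖ = normMulVec A (coords b v) := rfl

lemma inner_stdCoords {n d : ℕ} (A : Matrix (Fin d) (Fin d) ℝ)
    (b : Fin d → EuclideanSpace ℝ (Fin n)) (v : EuclideanSpace ℝ (Fin n))
    (η : EuclideanSpace ℝ (Fin d)) :
    inner ℝ (stdCoords A b v) η = coords b v ⬝ᵥ A.transpose.mulVec η.ofLp := by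
  rw [Matrix.mulVec_transpose, dotProduct_comm, ← Matrix.dotProduct_mulVec,
    EuclideanSpace.inner_eq_star_dotProduct]
  rfl

section
variable {n d : ℕ} {Ω : Type*} [MeasurableSpace Ω] {P : Measure Ω} [IsProbabilityMeasure P]
  {Z : Submodule ℤ (EuclideanSpace ℝ (Fin n))} [DiscreteTopology Z] {R : ℕ → Ω → Z}
  {b : Fin d → EuclideanSpace ℝ (Fin n)} {S : Finset Z}

namespace IsRandomWalk

lemma sum_stepProb_dotProduct (hR : IsRandomWalk P Z R) (hbal : IsBalancedWalk P R)
    (hS : ∀ k, ∀ᵐ ω ∂P, R (k + 1) ω - R k ω ∈ S) (u : Fin d → ℝ) :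
    ∑ x ∈ S, stepProb P R x * (coords b x ⬝ᵥ u) = 0 := by
  have h := hR.integral_step hS (fun x => (x : EuclideanSpace ℝ (Fin n)))
  rw [hbal.2] at h
  have h2 := congrArg (fun v => inner ℝ v (∑ i, u i • b i)) h
  simp only [inner_zero_left, sum_inner, inner_smul_left] at h2
  rw [h2]
  refine Finset.sum_congr rfl fun x _ => ?_
  rw [inner_sum, dotProduct]
  simp only [inner_smul_right, coords, real_inner_comm, mul_comm]
  rfl

lemma dotProduct_covMatrix_mulVec (hR : IsRandomWalk P Z R)
    (hS : ∀ k, ∀ᵐ ω ∂P, R (k + 1) ω - R k ω ∈ S) (u : Fin d → ℝ) :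
    u ⬝ᵥ (covMatrix P R b).mulVec u = ∑ x ∈ S, stepProb P R x * (coords b x ⬝ᵥ u) ^ 2 := by
  have h : ∀ i j, covMatrix P R b i j =
      ∑ x ∈ S, stepProb P R x * (coords b x i * coords b x j) := fun i j =>
    hR.integral_step hS (fun x : Z => coords b x i * coords b x j)
  simp only [dotProduct, Matrix.mulVec, h, Finset.mul_sum, Finset.sum_mul, sq]
  simp_rw [Finset.sum_comm (s := Finset.univ) (t := S)]
  refine Finset.sum_congr rfl fun x _ => ?_
  rw [Finset.sum_comm]
  exact Finset.sum_congr rfl fun i _ => Finset.sum_congr rfl fun j _ => by ring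

/-- If `u` is in the kernel of the covariance, all steps, hence all of `Z`, are orthogonal
to `u`. -/
lemma covMatrix_posDef (hR : IsRandomWalk P Z R) (hS : ∀ k, ∀ᵐ ω ∂P, R (k + 1) ω - R k ω ∈ S)
    (hb : Orthonormal ℝ b) (hbZ : Submodule.span ℝ (Set.range b)
      = Submodule.span ℝ (Z : Set (EuclideanSpace ℝ (Fin n)))) :
    (covMatrix P R b).PosDef := by
  refine Matrix.PosDef.of_dotProduct_mulVec_pos ?_ fun u hu => ?_
  · ext i j
    simp [covMatrix, mul_comm]
  rw [star_trivial, hR.dotProduct_covMatrix_mulVec hS]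
  have hnn : ∀ x ∈ S, 0 ≤ stepProb P R x * (coords b x ⬝ᵥ u) ^ 2 := fun x _ =>
    mul_nonneg (stepProb_nonneg P R x) (sq_nonneg _)
  refine (Finset.sum_nonneg hnn).lt_of_ne' fun h0 => hu ?_
  rw [Finset.sum_eq_zero_iff_of_nonneg hnn] at h0
  set t : EuclideanSpace ℝ (Fin n) := ∑ i, u i • b i with ht
  have hdot : ∀ v, coords b v ⬝ᵥ u = inner ℝ v t := fun v => by
    rw [ht, inner_sum, dotProduct]
    refine Finset.sum_congr rfl fun i _ => ?_
    rw [inner_smul_right, real_inner_comm, mul_comm]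
    rfl
  let N : AddSubmonoid Z :=
    { carrier := {z | inner ℝ (z : EuclideanSpace ℝ (Fin n)) t = 0}
      zero_mem' := by simp
      add_mem' := fun {x y} (hx : inner ℝ _ t = 0) (hy : inner ℝ _ t = 0) => by
        simp [inner_add_left, hx, hy] }
  have hZ : ∀ z : Z, inner ℝ (z : EuclideanSpace ℝ (Fin n)) t = 0 := fun z =>
    hR.mem_of_steps_mem hS N (fun x hx hpx => by
      have := h0 x hx
      rw [hdot] at this
      exact pow_eq_zero_iff two_ne_zero |>.mp ((mul_eq_zero.mp this).resolve_left hpx.ne')) z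
  have hmem : t ∈ Submodule.span ℝ (Z : Set (EuclideanSpace ℝ (Fin n))) := by
    rw [← hbZ]
    exact Submodule.sum_mem _ fun i _ =>
      Submodule.smul_mem _ _ (Submodule.subset_span (Set.mem_range_self i))
  have hall : ∀ v ∈ Submodule.span ℝ (Z : Set (EuclideanSpace ℝ (Fin n))), inner ℝ v t = 0 := by
    intro v hv
    induction hv using Submodule.span_induction with
    | mem x hx => exact hZ ⟨x, hx⟩
    | zero => simp
    | add x y _ _ hx hy => rw [inner_add_left, hx, hy, add_zero]
    | smul c x _ hx => rw [inner_smul_left, hx, mul_zero]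
  have h00 : t = 0 := inner_self_eq_zero.mp (hall t hmem)
  ext i
  exact Fintype.linearIndependent_iff.mp hb.linearIndependent u h00 i

lemma isStandardStep (hR : IsRandomWalk P Z R) (hbal : IsBalancedWalk P R)
    (hS : ∀ k, ∀ᵐ ω ∂P, R (k + 1) ω - R k ω ∈ S) {A : Matrix (Fin d) (Fin d) ℝ}
    (hM : (covMatrix P R b).PosDef) (hA : A.PosDef) (hAM : A * A = (covMatrix P R b)⁻¹) :
    IsStandardStep (fun x : S => stepProb P R x) (fun x : S => stdCoords A b x) := by
  have hAt : A.transpose = A := by simpa using hA.isHermitian.eq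
  refine ⟨fun x => stepProb_nonneg P R x, ?_, fun η => ?_, fun η => ?_⟩
  · rw [Finset.sum_coe_sort S (fun x => stepProb P R x), hR.sum_stepProb hS]
  · simp only [inner_stdCoords]
    rw [Finset.sum_coe_sort S (fun x => stepProb P R x * (coords b x ⬝ᵥ _)),
      hR.sum_stepProb_dotProduct hbal hS]
  · simp only [inner_stdCoords]
    rw [Finset.sum_coe_sort S (fun x => stepProb P R x * (coords b x ⬝ᵥ _) ^ 2),
      ← hR.dotProduct_covMatrix_mulVec hS, hAt, dotProduct_comm, Matrix.dotProduct_mulVec,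
      ← Matrix.mulVec_transpose, hAt, Matrix.mulVec_mulVec, Matrix.mulVec_mulVec,
      inv_sqrt_conj hM hA hAM, Matrix.one_mulVec, ← real_inner_self_eq_norm_sq,
      EuclideanSpace.inner_eq_star_dotProduct]
    rfl

end IsRandomWalk
end

/-! ### The expansion in the coordinates of the lattice -/

section
variable {n d : ℕ} {Z : Submodule ℤ (EuclideanSpace ℝ (Fin n))}
  {b : Fin d → EuclideanSpace ℝ (Fin n)} {A : Matrix (Fin d) (Fin d) ℝ}

/-- Standardized coordinates are injective on the span of the lattice, so that they control the
norm. -/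
lemma exists_norm_le_mul_norm_stdCoords (hbZ : Submodule.span ℝ (Set.range b)
      = Submodule.span ℝ (Z : Set (EuclideanSpace ℝ (Fin n)))) (hA : A.PosDef) :
    ∃ c : ℝ, 0 < c ∧ ∀ z : Z, ‖z‖ ≤ c * ‖stdCoords A b z‖ := by
  let V := Submodule.span ℝ (Z : Set (EuclideanSpace ℝ (Fin n)))
  let f : V →ₗ[ℝ] EuclideanSpace ℝ (Fin d) := stdCoords A b ∘ₗ V.subtype
  have hker : LinearMap.ker f = ⊥ := by
    rw [LinearMap.ker_eq_bot']
    intro v hv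
    have h1 : A.mulVec (coords b v) = 0 := congrArg WithLp.ofLp hv
    have h2 := Matrix.eq_zero_of_mulVec_eq_zero hA.det_pos.ne' h1
    exact Subtype.ext (coords_eq_zero_of_mem_span (hbZ ▸ v.2) h2)
  obtain ⟨c, hc, hf⟩ := LinearMap.exists_antilipschitzWith f hker
  refine ⟨c, hc, fun z => ?_⟩
  have h := hf.le_mul_dist (⟨z, Submodule.subset_span z.2⟩ : V) 0
  rwa [map_zero, dist_zero_right, dist_zero_right] at h

lemma exists_pos_le_norm (Z : Submodule ℤ (EuclideanSpace ℝ (Fin n))) [DiscreteTopology Z] :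
    ∃ ε > 0, ∀ z : Z, z ≠ 0 → ε ≤ ‖z‖ := by
  obtain ⟨ε, hε, h⟩ := Metric.isOpen_singleton_iff.mp (isOpen_discrete ({0} : Set Z))
  refine ⟨ε, hε, fun z hz => ?_⟩
  by_contra! hlt
  exact hz (h z (by rwa [dist_zero_right]))

/-- A polynomial in the standardized coordinates, as a polynomial in the orthonormal ones. -/
lemma exists_eval_coords_eq (A : Matrix (Fin d) (Fin d) ℝ) (b : Fin d → EuclideanSpace ℝ (Fin n))
    (Q : MvPolynomial (Fin d) ℝ) (s : ℝ) :
    ∃ Q' : MvPolynomial (Fin d) ℝ, ∀ v,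
      MvPolynomial.eval (coords b v) Q' = s * MvPolynomial.eval (stdCoords A b v).ofLp Q := by
  refine ⟨MvPolynomial.C s * MvPolynomial.bind₁
    (fun i => ∑ j, MvPolynomial.C (A i j) * MvPolynomial.X j) Q, fun v => ?_⟩
  rw [map_mul, MvPolynomial.eval_C]
  congr 1
  rw [MvPolynomial.eval, MvPolynomial.eval₂Hom_bind₁]
  congr 1
  congr 1
  ext i
  simp [stdCoords, Matrix.mulVec, dotProduct]

lemma zpow_neg_le_of_norm_le {s t c : ℝ} (ht : 0 < t) (h : t ≤ c * s) (hc : 0 < c) (m : ℕ) :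
    (s ^ m)⁻¹ ≤ c ^ m * t ^ (-(m : ℤ)) := by
  have hs : 0 < s := pos_of_mul_pos_right (ht.trans_le h) hc.le
  rw [zpow_neg, zpow_natCast, inv_le_iff_one_le_mul₀ (by positivity), mul_right_comm, ← mul_pow,
    ← div_eq_mul_inv, one_le_div (by positivity)]
  exact pow_le_pow_left₀ ht.le h m

/-- The denominator on the right is the volume of the frequency cell. -/
lemma leadingConst_eq_div [DiscreteTopology Z] {M : Matrix (Fin d) (Fin d) ℝ}
    (hM : M.PosDef) (hZ : 0 < latticeVolume Z) :
    leadingConst Z M = ((2 * Real.pi) ^ ((d : ℝ) / 2) * profileConst d) /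
      ((latticeVolume Z * (Real.sqrt M.det)⁻¹)⁻¹ * (2 * Real.pi) ^ d) := by
  have h2 : (0 : ℝ) < 2 * Real.pi := by positivity
  have h1 : (2 * Real.pi) ^ d = (2 * Real.pi) ^ ((d : ℝ) / 2) * (2 * Real.pi) ^ ((d : ℝ) / 2) := by
    rw [← Real.rpow_add h2, add_halves, Real.rpow_natCast]
  have h3 : 0 < Real.sqrt M.det := Real.sqrt_pos.mpr hM.det_pos
  have h4 := Real.rpow_pos_of_pos h2 ((d : ℝ) / 2)
  rw [h1, leadingConst, ← profileConst]
  field_simp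

/-- A bound off a finite set of lattice points is a bound at all nonzero ones, with a larger
constant. -/
lemma exists_bound_of_eventual_bound {f : Z → ℝ} {C : ℝ} (hC : 0 ≤ C) {T : Set Z} (hT : T.Finite)
    (K : ℕ) (h : ∀ z, z ≠ 0 → z ∉ T → |f z| ≤ C * ‖z‖ ^ (-(K : ℤ))) :
    ∃ C : ℝ, ∀ z, z ≠ 0 → |f z| ≤ C * ‖z‖ ^ (-(K : ℤ)) := by
  refine ⟨C + ∑ z ∈ hT.toFinset, |f z| * ‖z‖ ^ K, fun z hz => ?_⟩
  have hz' : 0 < ‖z‖ := norm_pos_iff.mpr hz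
  have hp : 0 < ‖z‖ ^ (-(K : ℤ)) := by positivity
  have hnn : ∀ x ∈ hT.toFinset, 0 ≤ |f x| * ‖x‖ ^ K := fun x _ => by positivity
  by_cases hzT : z ∈ T
  · have h1 := Finset.single_le_sum hnn (hT.mem_toFinset.mpr hzT)
    calc |f z| = |f z| * ‖z‖ ^ K * ‖z‖ ^ (-(K : ℤ)) := by
          rw [zpow_neg, zpow_natCast]; field_simp
      _ ≤ _ := by gcongr; linarith
  · refine (h z hz hzT).trans ?_
    gcongr
    linarith [Finset.sum_nonneg hnn]

end

theorem mainTheorem1 {n d : ℕ} (Z : Submodule ℤ (EuclideanSpace ℝ (Fin n))) [DiscreteTopology Z]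
    (b : Fin d → EuclideanSpace ℝ (Fin n)) (hb : Orthonormal ℝ b)
    (hbZ : Submodule.span ℝ (Set.range b)
      = Submodule.span ℝ (Z : Set (EuclideanSpace ℝ (Fin n))))
    {Ω : Type*} [MeasurableSpace Ω] (P : Measure Ω) [IsProbabilityMeasure P]
    (R : ℕ → Ω → Z) (hR : IsRandomWalk P Z R) (hbdd : IsBoundedWalk P R)
    (hbal : IsBalancedWalk P R) :
    (covMatrix P R b).PosDef ∧
    ∃ a : Z → ℝ, IsHarmonicPotential P R a ∧
    ∃ A : Matrix (Fin d) (Fin d) ℝ, A.PosDef ∧ A * A = (covMatrix P R b)⁻¹ ∧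
    ∃ lam : ℝ, ∀ K : ℕ, 0 < K →
    ∃ (Q : MvPolynomial (Fin d) ℝ) (L : ℕ), (Even d → Even L) ∧
      (∃ C : ℝ, ∀ z : Z, z ≠ 0 →
        |MvPolynomial.eval (coords b z) Q / normMulVec A (coords b z) ^ L|
          ≤ C * ‖z‖ ^ (1 - (d : ℤ))) ∧
      (∃ C : ℝ, ∀ z : Z, z ≠ 0 →
        |a z - (leadingConst Z (covMatrix P R b) * radialProfile d (normMulVec A (coords b z))
            + lam + MvPolynomial.eval (coords b z) Q / normMulVec A (coords b z) ^ L)|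
          ≤ C * ‖z‖ ^ (-(K : ℤ))) := by
  obtain ⟨S, hS⟩ := hbdd.exists_step_support
  have hM := hR.covMatrix_posDef hS hb hbZ
  refine ⟨hM, ?_⟩
  obtain ⟨A, hA, hAM⟩ := hM.exists_inv_sqrt
  rcases Nat.eq_zero_or_pos d with rfl | hd
  · -- In dimension zero the lattice is trivial and nothing is claimed away from the origin.
    have hZ0 : ∀ z : Z, z = 0 := fun z => by
      have h := Submodule.subset_span (R := ℝ) z.2
      rw [← hbZ, Set.range_eq_empty, Submodule.span_empty] at h
      exact Subtype.ext h
    refine ⟨0, fun z => ?_, A, hA, hAM, 0, fun K _ => ⟨0, 0, by simp,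
      ⟨0, fun z hz => absurd (hZ0 z) hz⟩, ⟨0, fun z hz => absurd (hZ0 z) hz⟩⟩⟩
    simp [hZ0 z]
  obtain ⟨e, he, hdetC, hvolZ⟩ := exists_lattice_frame Z hb hbZ
  set y := stdCoords A b with hy
  have hY' : (frameMatrix y e).det = (Matrix.of fun j l => coords b (e j) l).det * A.det := by
    rw [← Matrix.det_transpose A, ← Matrix.det_mul]
    congr 1
    ext j l
    simp [frameMatrix, hy, stdCoords, Matrix.mulVec, Matrix.mul_apply, dotProduct, mul_comm]
  have hY : (frameMatrix y e).det ≠ 0 := by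
    rw [hY']
    exact mul_ne_zero (abs_pos.mp (hdetC ▸ hvolZ)) hA.det_pos.ne'
  -- the cell of the dual lattice, over which the Fourier inversion formula integrates
  set F := dualCell (frameMatrix y e) with hFdef
  set v : ℝ := volume.real F with hv
  have hvol : v = (latticeVolume Z * (Real.sqrt (covMatrix P R b).det)⁻¹)⁻¹ *
      (2 * Real.pi) ^ d := by
    rw [hv, hFdef, volume_dualCell hY, hY', abs_mul, hdetC, det_inv_sqrt hA hAM,
      abs_of_nonneg (inv_nonneg.mpr (Real.sqrt_nonneg _))]
  have hv0 : 0 < v := by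
    have := Real.sqrt_pos.mpr hM.det_pos
    rw [hvol]
    positivity
  have hstd := hR.isStandardStep hbal hS hM hA hAM
  have hF := hR.isFrequencyDomain hS hY hstd
  have hwf := hR.walkFourier_eq hS he hY
  set w : S → ℝ := fun x => stepProb P R x
  set u : S → EuclideanSpace ℝ (Fin d) := fun x => y x
  -- a positive bound for the length of a step
  set B : ℝ := 1 + ∑ x ∈ S, ‖y x‖ with hB
  have hB0 : 0 < B := by positivity
  have hyB : ∀ x ∈ S, ‖y x‖ ≤ B := fun x hx =>
    (Finset.single_le_sum (f := fun x : Z => ‖y x‖) (fun _ _ => norm_nonneg _) hx).trans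
      (by linarith)
  obtain ⟨lam, hlam⟩ := exists_potential_expansion hF hstd hd hB0
  obtain ⟨c, hc, hyc⟩ := exists_norm_le_mul_norm_stdCoords (A := A) hbZ hA
  obtain ⟨ε, hε, hεZ⟩ := exists_pos_le_norm Z
  refine ⟨fun z => potentialIntegral w u F (y z) / v, fun z => ?_, A, hA, hAM, lam / v,
    fun K hK => ?_⟩
  · have h := (hF.tendsto_sum_walkFourier hstd hd (y z)).div_const v
    refine h.congr fun N => ?_
    rw [Finset.sum_div]
    refine Finset.sum_congr rfl fun k _ => ?_
    have h0 := hwf k 0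
    rw [Submodule.coe_zero, map_zero] at h0
    rw [h0, hwf k z, ← mul_sub, ← hFdef, ← hv, mul_div_cancel_left₀ _ hv0.ne']
  obtain ⟨Q, m, hQ, C, hC, hexp⟩ := hlam K hK
  obtain ⟨Q', hQ'⟩ := exists_eval_coords_eq A b Q v⁻¹
  refine ⟨Q', d + 2 * m, fun h => h.add (even_two_mul m), ?_, ?_⟩
  · obtain ⟨C', hC'⟩ := hQ (ε / c) (by positivity)
    refine ⟨v⁻¹ * (|C'| * c ^ (d - 1)), fun z hz => ?_⟩
    have hz0 : 0 < ‖z‖ := norm_pos_iff.mpr hz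
    have h1 := hC' (y z) (by rw [div_le_iff₀' hc]; exact (hεZ z hz).trans (hyc z))
    have hexpo : (1 : ℤ) - d = -((d - 1 : ℕ) : ℤ) := by omega
    have h2 := zpow_neg_le_of_norm_le hz0 (hyc z) hc (d - 1)
    rw [hQ', mul_div_assoc, abs_mul, abs_of_pos (inv_pos.mpr hv0), mul_assoc]
    gcongr
    refine h1.trans ?_
    rw [hexpo, zpow_neg, zpow_natCast] at *
    rw [mul_assoc]
    exact mul_le_mul (le_abs_self _) (by simpa using h2) (by positivity) (abs_nonneg _)
  · -- the expansion holds for `‖y z‖ ≥ 1 + 4 * B`, that is, off a finite set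
    have hfin : {z : Z | ‖y z‖ < 1 + 4 * B}.Finite :=
      (finite_norm_le_of_discrete Z (c * (1 + 4 * B))).subset fun z hz =>
        (hyc z).trans (mul_le_mul_of_nonneg_left (le_of_lt hz) hc.le)
    refine exists_bound_of_eventual_bound (C := v⁻¹ * (C * c ^ K)) (by positivity) hfin K
      fun z hz hzT => ?_
    have hz0 : 0 < ‖z‖ := norm_pos_iff.mpr hz
    have h1 := hexp (y z) (not_lt.mp hzT) fun k hk => by
      rw [hwf k z, hR.walkProb_eq_zero_of_lt hS y hyB k z hk, mul_zero]
    have h2 := zpow_neg_le_of_norm_le hz0 (hyc z) hc K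
    rw [hQ', leadingConst_eq_div hM hvolZ, ← hvol, ← norm_stdCoords, ← hy]
    calc _ = v⁻¹ * |potentialIntegral w u F (y z) -
          ((2 * Real.pi) ^ ((d : ℝ) / 2) * (profileConst d * radialProfile d ‖y z‖) + lam +
            MvPolynomial.eval (y z).ofLp Q / ‖y z‖ ^ (d + 2 * m))| := by
          rw [← abs_of_pos (inv_pos.mpr hv0), ← abs_mul, abs_of_pos (inv_pos.mpr hv0)]
          congr 1
          ring
      _ ≤ v⁻¹ * (C * (c ^ K * ‖z‖ ^ (-(K : ℤ)))) := by
          gcongr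
          exact h1.trans (mul_le_mul_of_nonneg_left h2 hC)
      _ = _ := by ring
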